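/- Work over $\mathbb{C}$. Let $Q\subset\mathbb{P}^k$ be an irreducible closed subvariety of codimension at least $2$. For a point $a\in\mathbb{P}^k\setminus Q$ let $\pi_a\colon Q\to\mathbb{P}^{k-1}$ be the restriction to $Q$ of the linear projection from $a$, and let $R=\pi_a(Q)$, with its reduced structure. For a point $a$ of general position (that is, for every $a$ in some non-empty Zariski open subset of $\mathbb{P}^k$, disjoint from $Q$) the morphism $\pi_a\colon Q\to R$ is birational. Moreover, for every $a\in\mathbb{P}^k\setminus Q$ such that $\pi_a\colon Q\to R$ is birational and for every point $q\in Q$, with $r=\pi_a(q)$, the equality $$\operatorname{mult}_rR=\operatorname{mult}_qQ$$ holds if and only if the following two conditions are satisfied: (i) the line $L_{a,q}\subset\mathbb{P}^k$ that connects $a$ and $q$ has no other points of intersection with $Q$: $L_{a,q}\cap Q=\{q\}$; (ii) the line $L_{a,q}$ is not tangent to $Q$ at $q$: $L_{a,q}\not\subset T_qQ$, where $T_qQ\subset\mathbb{P}^k$ is the (projective, embedded) tangent cone of $Q$ at $q$, the common zero set of the initial forms at $q$ of all the forms vanishing on $Q$. Here $\operatorname{mult}_xX$ is the Hilbert-Samuel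 multiplicity of the local ring $\mathcal{O}_{X,x}$. -/

import Mathlib

open scoped LinearAlgebra.Projectivization

noncomputable section

namespace ProjMult

attribute [local instance] MvPolynomial.gradedAlgebra

/-- The complex projective space with `n` homogeneous coordinates: `PSpace (k + 1)` is `ℙ^k`. -/
abbrev PSpace (n : ℕ) : Type := ℙ ℂ (Fin n → ℂ)

/-- The polynomial ring in the homogeneous coordinates of `PSpace n`. -/
abbrev Coord (n : ℕ) : Type := MvPolynomial (Fin n) ℂ

/-- The common zeros in projective space of a set of forms. -/
def zeros {n : ℕ} (S : Set (Coord n)) : Set (PSpace n) :=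
  {x | ∀ f ∈ S, MvPolynomial.eval x.rep f = 0}

/-- The Zariski topology on projective space: the closed sets are the zero sets of (arbitrary)
sets of homogeneous polynomials. -/
instance zariskiTopology (n : ℕ) : TopologicalSpace (PSpace n) :=
  TopologicalSpace.ofClosed
    {Z | ∃ S : Set (Coord n), (∀ f ∈ S, ∃ d : ℕ, f.IsHomogeneous d) ∧ Z = zeros S}
    ⟨{1}, by
      rintro f rfl
      exact ⟨0, MvPolynomial.isHomogeneous_one _ _⟩, by
      ext x
      simp [zeros]⟩
    (by
      intro A hA
      refine ⟨{f | (∃ d : ℕ, f.IsHomogeneous d) ∧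
        ∃ Z ∈ A, ∀ x ∈ Z, MvPolynomial.eval x.rep f = 0}, fun f hf => hf.1, ?_⟩
      ext x
      constructor
      · rintro hx f ⟨-, Z, hZ, hf⟩
        exact hf x (hx Z hZ)
      · intro hx Z hZ
        obtain ⟨S, hS, rfl⟩ := hA hZ
        intro f hf
        exact hx f ⟨hS f hf, _, hZ, fun y hy => hy f hf⟩)
    (by
      rintro _ ⟨S, hS, rfl⟩ _ ⟨T, hT, rfl⟩
      refine ⟨{h | ∃ f ∈ S, ∃ g ∈ T, h = f * g}, ?_, ?_⟩
      · rintro _ ⟨f, hf, g, hg, rfl⟩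
        obtain ⟨d, hd⟩ := hS f hf
        obtain ⟨e, he⟩ := hT g hg
        exact ⟨d + e, hd.mul he⟩
      · ext x
        constructor
        · rintro (hx | hx)
          · rintro _ ⟨f, hf, g, hg, rfl⟩
            simp [hx f hf]
          · rintro _ ⟨f, hf, g, hg, rfl⟩
            simp [hx g hg]
        · intro hx
          by_contra hcon
          simp only [Set.mem_union, not_or] at hcon
          obtain ⟨h1, h2⟩ := hcon
          simp only [zeros, Set.mem_ofPred_eq, not_forall] at h1 h2
          obtain ⟨f, hf, hf0⟩ := h1
          obtain ⟨g, hg, hg0⟩ := h2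
          have := hx (f * g) ⟨f, hf, g, hg, rfl⟩
          rw [map_mul] at this
          exact (mul_ne_zero hf0 hg0) this)

/-- The homogeneous ideal `I(X)` of a set of points of projective space: the polynomials which
vanish on all nonzero vectors representing a point of `X`. -/
def homIdeal {n : ℕ} (X : Set (PSpace n)) : Ideal (Coord n) :=
  MvPolynomial.vanishingIdeal ℂ {v | ∃ h : v ≠ 0, Projectivization.mk ℂ v h ∈ X}

/-- The homogeneous ideal of a point is prime. -/
instance homIdeal_singleton_isPrime {n : ℕ} (x : PSpace n) : (homIdeal {x}).IsPrime := by
  -- The ideal is the kernel of the restriction to the line of representatives of `x`.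
  let ρ : Coord n →ₐ[ℂ] Polynomial ℂ :=
    MvPolynomial.aeval (fun i => Polynomial.C (x.rep i) * Polynomial.X)
  have key : ∀ (f : Coord n) (t : ℂ),
      (ρ f).eval t = MvPolynomial.aeval (t • x.rep) f := by
    intro f t
    have : ((Polynomial.aeval t).comp ρ) f = MvPolynomial.aeval (t • x.rep) f := by
      refine DFunLike.congr_fun (MvPolynomial.algHom_ext fun i => ?_) f
      simp only [AlgHom.comp_apply, ρ, MvPolynomial.aeval_X, map_mul, Polynomial.aeval_C,
        Polynomial.aeval_X, Pi.smul_apply, smul_eq_mul, Algebra.algebraMap_self_apply]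
      exact mul_comm _ _
    rw [← this, AlgHom.comp_apply, ← Polynomial.coe_aeval_eq_eval]
  have hker : homIdeal {x} = RingHom.ker ρ.toRingHom := by
    ext f
    rw [RingHom.mem_ker]
    constructor
    · intro hf
      refine Polynomial.eq_zero_of_infinite_isRoot _ ?_
      refine Set.Infinite.mono (s := {t : ℂ | t ≠ 0}) ?_
        (Set.finite_singleton (0 : ℂ)).infinite_compl
      intro t ht
      have h0 : t • x.rep ≠ 0 := smul_ne_zero ht x.rep_nonzero
      have hmem : Projectivization.mk ℂ (t • x.rep) h0 ∈ ({x} : Set (PSpace n)) := by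
        rw [Set.mem_singleton_iff]
        conv_rhs => rw [← x.mk_rep]
        rw [Projectivization.mk_eq_mk_iff']
        exact ⟨t, rfl⟩
      exact (key f t).trans (hf _ ⟨h0, hmem⟩)
    · rintro hf v ⟨h, hv⟩
      rw [Set.mem_singleton_iff] at hv
      rw [← x.mk_rep, Projectivization.mk_eq_mk_iff'] at hv
      obtain ⟨t, rfl⟩ := hv
      rw [← key]
      have : ρ f = 0 := hf
      rw [this, Polynomial.eval_zero]
  rw [hker]
  exact RingHom.ker_isPrime _

/-- The local ring `𝒪_{ℙ,x}` of projective space at `x`: the fractions `f / g` of forms of the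
same degree with `g(x) ≠ 0`. -/
abbrev AmbientLocalRing {n : ℕ} (x : PSpace n) : Type :=
  HomogeneousLocalization.AtPrime (MvPolynomial.homogeneousSubmodule (Fin n) ℂ) (homIdeal {x})

/-- The ideal of `X` in `𝒪_{ℙ,x}`: the fractions which lie in the extension of `I(X)`, that is,
which can be written with a numerator in `I(X)`. -/
def localIdeal {n : ℕ} (X : Set (PSpace n)) (x : PSpace n) : Ideal (AmbientLocalRing x) :=
  ((homIdeal X).map (algebraMap (Coord n) (Localization.AtPrime (homIdeal {x})))).comap
    (algebraMap (AmbientLocalRing x) (Localization.AtPrime (homIdeal {x})))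

/-- The local ring `𝒪_{X,x}` of `X` (with its reduced structure) at `x`. -/
abbrev LocalRingAt {n : ℕ} (X : Set (PSpace n)) (x : PSpace n) : Type :=
  AmbientLocalRing x ⧸ localIdeal X x

/-- The maximal ideal of `𝒪_{X,x}` (for `x ∈ X`). -/
def maxIdealAt {n : ℕ} (X : Set (PSpace n)) (x : PSpace n) : Ideal (LocalRingAt X x) :=
  (IsLocalRing.maximalIdeal (AmbientLocalRing x)).map (Ideal.Quotient.mk (localIdeal X x))

/-- `P` is the Hilbert-Samuel polynomial of the ideal `m` of `B`: the length of `B / m ^ t` is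
`P(t)` for all large `t`. -/
def IsSamuelPolynomial {B : Type*} [CommRing B] (m : Ideal B) (P : Polynomial ℚ) : Prop :=
  ∀ᶠ t : ℕ in Filter.atTop, ∃ l : ℕ, Module.length B (B ⧸ m ^ t) = l ∧ (l : ℚ) = P.eval (t : ℚ)

open Classical in
/-- The Samuel multiplicity: `d!` times the leading coefficient of the Hilbert-Samuel polynomial,
where `d` is the degree of this polynomial. -/
def samuelMultiplicity {B : Type*} [CommRing B] (m : Ideal B) : ℚ :=
  if h : ∃ P : Polynomial ℚ, IsSamuelPolynomial m P then
    (h.choose.natDegree.factorial : ℚ) * h.choose.leadingCoeff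
  else 0

/-- The multiplicity `mult_x X` of `X` at its point `x`. -/
def mult {n : ℕ} (X : Set (PSpace n)) (x : PSpace n) : ℚ :=
  samuelMultiplicity (maxIdealAt X x)

/-- The homogeneous part of degree `j`, in the displacement `v`, of `f(q + v)`, where `q` stands
for a vector representing the point `q`. -/
def taylorPart {n : ℕ} (q : PSpace n) (f : Coord n) (j : ℕ) : Coord n :=
  MvPolynomial.homogeneousComponent j
    (MvPolynomial.aeval (fun i => MvPolynomial.X i + MvPolynomial.C (q.rep i)) f)

/-- The (projective, embedded) tangent cone `T_q X`: the common zeros of the initial forms at `q`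
of all the forms vanishing on `X`. The initial form of `f` at `q` is the first nonzero homogeneous
part of `v ↦ f(q + v)`; for a form `f` it does not change when a multiple of `q` is added to `v`,
so that `T_q X` is a cone in projective space with vertex `q`. -/
def tangentCone {n : ℕ} (X : Set (PSpace n)) (q : PSpace n) : Set (PSpace n) :=
  {x | ∀ f ∈ homIdeal X, (∃ d : ℕ, f.IsHomogeneous d) →
    ∀ m : ℕ, (∀ j < m, taylorPart q f j = 0) → MvPolynomial.eval x.rep (taylorPart q f m) = 0}

/-- The line through two distinct points. -/
def lineThrough {n : ℕ} (a q : PSpace n) : Set (PSpace n) :=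
  {x | x.submodule ≤ a.submodule ⊔ q.submodule}

/-- A linear map whose kernel is the line representing `a` kills no point other than `a`. -/
theorem map_rep_ne_zero {k : ℕ} {a : PSpace (k + 1)} {φ : (Fin (k + 1) → ℂ) →ₗ[ℂ] (Fin k → ℂ)}
    (hφ : LinearMap.ker φ = a.submodule) {x : PSpace (k + 1)} (hx : x ≠ a) : φ x.rep ≠ 0 := by
  intro h
  have h1 : x.rep ∈ a.submodule := by
    rw [← hφ]
    exact h
  rw [Projectivization.submodule_eq, Submodule.mem_span_singleton] at h1
  obtain ⟨t, ht⟩ := h1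
  apply hx
  rw [← x.mk_rep, ← a.mk_rep, Projectivization.mk_eq_mk_iff']
  exact ⟨t, ht⟩

/-- The linear projection `π_a : ℙ^k ⇢ ℙ^(k-1)` from the point `a`, restricted to a set `Q` not
containing `a`. It is given by a linear map `φ` whose kernel is the line representing `a`
(such a `φ` is automatically onto, and unique up to linear automorphisms of the target). -/
def projFrom {k : ℕ} (a : PSpace (k + 1)) (φ : (Fin (k + 1) → ℂ) →ₗ[ℂ] (Fin k → ℂ))
    (hφ : LinearMap.ker φ = a.submodule) (Q : Set (PSpace (k + 1))) (ha : a ∉ Q)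
    (x : Q) : PSpace k :=
  Projectivization.mk ℂ (φ x.1.rep) (map_rep_ne_zero hφ (fun h => ha (h ▸ x.2)))

/-- A morphism `π` from an irreducible `Q` is birational onto its image: there is a rational map
`ψ` from the image, given by forms `G 0, …, G (m - 1)` of the same degree which do not all vanish
identically on the image, such that `ψ ∘ π` is the identity of `Q` as a rational map (and hence
`π ∘ ψ` is the identity of the image). -/
def IsBirationalOntoImage {m n : ℕ} {Q : Set (PSpace m)} (π : Q → PSpace n) : Prop :=
  ∃ (d : ℕ) (G : Fin m → Coord n), (∀ i, (G i).IsHomogeneous d) ∧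
    (∃ x : Q, (fun i => MvPolynomial.eval (π x).rep (G i)) ≠ 0) ∧
    ∀ (x : Q) (h : (fun i => MvPolynomial.eval (π x).rep (G i)) ≠ 0),
      Projectivization.mk ℂ (fun i => MvPolynomial.eval (π x).rep (G i)) h = x.1

end ProjMult

end

/-! Fix a functional `τ` on the target of the projection with value 1 at the image of `q`. In the
charts `τ = 1` the image `R` and the variety `Q` have coordinate rings `A ⊆ B`, and `B = A[y]`,
where `y` is the coordinate along `a` centred at `q`. A form vanishing on `Q` but not at `a`
becomes, up to a scalar, a monic equation for `y`, so `B` is finite over `A` (`finite_chart`);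
birationality gives a nonzero `h` in `A` with `h B ⊆ A` (`exists_conductor_of_isBirational`). Let
`m` be the maximal ideal of `r` in `A`, let `I = mB`, and let `M = I + (y)` be the maximal ideal of
`q` in `B`. Write `d` for the common dimension.

By Artin–Rees the dimension of `A / (h, m ^ t)` is `o(t ^ d)`. Hence `A / m ^ t` and `B / I ^ t`
have the same leading growth (`tendsto_finrank_map_pow`), and the question is whether `B / I ^ t`
and `B / M ^ t` agree to order `t ^ d`. There are two obstructions. A second point of `B` over `r`
adds its own Samuel function, by the Chinese remainder theorem (`finrank_add_le_of_ne`). If `y ^ (N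
+ 1)` is never in `I M ^ N + M ^ (N + 2)`, the chart `k[y, x_i / y]` of the blowing-up of `M` has a
point `y = x_i / y = 0`, where the `x_i` generate `I`, and the Samuel function of this point is
added (`exists_point_blowUp`). In both cases the excess has order `t ^ d`. If neither obstruction
occurs, then `M ^ (t + N) ⊆ I ^ t` for a fixed `N` (`pow_add_le_of_mem`), so the leading terms
agree. Absence of the first obstruction is condition (i). Absence of the second says that some
initial form at `q` of a form vanishing on `Q` is nonzero at `a`, which is condition (ii).

Two general facts on Samuel functions of affine algebras are needed. They are eventually polynomial,
since the standard monomials form a basis and Dickson's lemma applies. For an affine domain they lie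
between positive multiples of `t ^ d` (`samuel_growth`): Noether normalization gives the upper
bound, and a trace argument in a Galois closure gives the lower one. The passage from the local
rings of projective space to the charts is `mult_eq_of_eventually`.

For the first claim, a count of transcendence degrees puts `Q` on a cone over a hypersurface with
any prescribed vertex. Choose `q` in `Q` and a form in the ideal of `Q` with nonzero differential at
`q`. If `a` avoids the cone with vertex `q` and the zeros of the differential, the fibre through `q`
is a single unramified point. Nakayama then makes the inverse regular near the image of `q`. -/

open Filter Topology

universe u

/-! ### Eventually polynomial functions; counting exponents outside an upper set. -/

/-- A function on the natural numbers which agrees with a rational polynomial for large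
arguments. -/
def EventuallyPolynomial (f : ℕ → ℕ) : Prop :=
  ∃ P : Polynomial ℚ, ∀ᶠ t : ℕ in atTop, (f t : ℚ) = P.eval (t : ℚ)

/-- By linearity only powers have to be summed, and Faulhaber's formula expresses these sums through
Bernoulli polynomials. -/
theorem Polynomial.exists_sum_range_eval (P : Polynomial ℚ) :
    ∃ S : Polynomial ℚ, ∀ n : ℕ, ∑ i ∈ Finset.range n, P.eval (i : ℚ) = S.eval (n : ℚ) := by
  induction P using Polynomial.induction_on' with
  | add p q hp hq =>
    obtain ⟨S, hS⟩ := hp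
    obtain ⟨T, hT⟩ := hq
    exact ⟨S + T, fun n => by simp [Finset.sum_add_distrib, hS, hT]⟩
  | monomial m a =>
    refine ⟨Polynomial.C (a / (m + 1)) * (Polynomial.bernoulli m.succ -
      Polynomial.C (_root_.bernoulli m.succ)), fun n => ?_⟩
    have h := Polynomial.sum_range_pow_eq_bernoulli_sub n m
    have hm : (m + 1 : ℚ) ≠ 0 := by positivity
    simp only [Polynomial.eval_monomial, Polynomial.eval_mul, Polynomial.eval_C,
      Polynomial.eval_sub, ← Finset.mul_sum]
    rw [← h]
    field_simp

namespace EventuallyPolynomial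

theorem congr {f g : ℕ → ℕ} (hf : EventuallyPolynomial f) (h : ∀ᶠ t in atTop, g t = f t) :
    EventuallyPolynomial g := by
  obtain ⟨P, hP⟩ := hf
  exact ⟨P, by filter_upwards [hP, h] with t h1 h2; rw [h2, h1]⟩

theorem add {f g : ℕ → ℕ} (hf : EventuallyPolynomial f) (hg : EventuallyPolynomial g) :
    EventuallyPolynomial (fun t => f t + g t) := by
  obtain ⟨P, hP⟩ := hf
  obtain ⟨S, hS⟩ := hg
  exact ⟨P + S, by filter_upwards [hP, hS] with t h1 h2; simp [h1, h2]⟩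

theorem zero : EventuallyPolynomial (fun _ => 0) := ⟨0, by simp⟩

theorem sum {ι : Type*} (s : Finset ι) {f : ι → ℕ → ℕ}
    (hf : ∀ i ∈ s, EventuallyPolynomial (f i)) :
    EventuallyPolynomial (fun t => ∑ i ∈ s, f i t) := by
  classical
  induction s using Finset.induction_on with
  | empty => simpa using zero
  | insert a s ha ih =>
    simp only [Finset.sum_insert ha]
    exact (hf a (by simp)).add (ih fun i hi => hf i (by simp [hi]))

theorem shift {f : ℕ → ℕ} (hf : EventuallyPolynomial f) (j : ℕ) :
    EventuallyPolynomial (fun t => f (t - j)) := by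
  obtain ⟨P, hP⟩ := hf
  refine ⟨P.comp (Polynomial.X - Polynomial.C (j : ℚ)), ?_⟩
  filter_upwards [(tendsto_sub_atTop_nat j).eventually hP, eventually_ge_atTop j] with t h1 h2
  rw [h1, Nat.cast_sub h2]
  simp

theorem sum_range {f : ℕ → ℕ} (hf : EventuallyPolynomial f) :
    EventuallyPolynomial (fun t => ∑ i ∈ Finset.range t, f i) := by
  obtain ⟨P, hP⟩ := hf
  obtain ⟨N, hN⟩ := eventually_atTop.1 hP
  obtain ⟨S, hS⟩ := P.exists_sum_range_eval
  refine ⟨S + Polynomial.C (∑ i ∈ Finset.range N, ((f i : ℚ) - P.eval (i : ℚ))), ?_⟩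
  filter_upwards [eventually_ge_atTop N] with t ht
  have h1 : ∑ i ∈ Finset.range t, ((f i : ℚ) - P.eval (i : ℚ)) =
      ∑ i ∈ Finset.range N, ((f i : ℚ) - P.eval (i : ℚ)) := by
    symm
    apply Finset.sum_subset
    · intro i hi
      simp only [Finset.mem_range] at *
      omega
    · intro i _ hi
      simp only [Finset.mem_range, not_lt] at hi
      rw [hN i hi, sub_self]
  rw [Polynomial.eval_add, Polynomial.eval_C, ← h1, ← hS, Finset.sum_sub_distrib]
  push_cast
  ring

end EventuallyPolynomial

open Classical in
/-- The number of exponents of degree `t` outside `E`. -/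
noncomputable def countCompl {s : ℕ} (E : Set (Fin s → ℕ)) (t : ℕ) : ℕ :=
  ((Finset.Nat.antidiagonalTuple s t).filter (· ∉ E)).card

/-- Sorting by the first exponent is what allows an induction on the number of variables. -/
theorem countCompl_succ {s : ℕ} (E : Set (Fin (s + 1) → ℕ)) (t : ℕ) :
    countCompl E t = ∑ j ∈ Finset.range (t + 1),
      countCompl {α : Fin s → ℕ | (Fin.cons j α : Fin (s + 1) → ℕ) ∈ E} (t - j) := by
  classical
  unfold countCompl
  rw [← Finset.card_sigma]
  refine Finset.card_nbij' (fun α => ⟨α 0, Fin.tail α⟩) (fun p => Fin.cons p.1 p.2) ?_ ?_ ?_ ?_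
  · intro α hα
    simp only [Finset.coe_filter, Finset.Nat.mem_antidiagonalTuple, Set.mem_ofPred_eq,
      Fin.sum_univ_succ] at hα
    simp only [Finset.coe_sigma, Set.mem_sigma_iff, Finset.coe_range, Set.mem_Iio,
      Finset.coe_filter, Finset.Nat.mem_antidiagonalTuple, Set.mem_ofPred_eq, Fin.cons_self_tail]
    refine ⟨by omega, ?_, hα.2⟩
    simp only [Fin.tail]
    omega
  · rintro ⟨j, α⟩ h
    simp only [Finset.coe_sigma, Set.mem_sigma_iff, Finset.coe_range, Set.mem_Iio,
      Finset.coe_filter, Finset.Nat.mem_antidiagonalTuple, Set.mem_ofPred_eq] at h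
    simp only [Finset.coe_filter, Finset.Nat.mem_antidiagonalTuple, Set.mem_ofPred_eq,
      Fin.sum_univ_succ, Fin.cons_zero, Fin.cons_succ]
    exact ⟨by omega, h.2.2⟩
  · intro α _
    simp
  · rintro ⟨j, α⟩ _
    simp

/-- The Hilbert function of the complement of an upper set of exponents is eventually
polynomial. -/
theorem eventuallyPolynomial_countCompl {s : ℕ} (E : Set (Fin s → ℕ)) (hE : IsUpperSet E) :
    EventuallyPolynomial (countCompl E) := by
  classical
  induction s with
  | zero =>
    refine EventuallyPolynomial.zero.congr ?_
    filter_upwards [eventually_gt_atTop 0] with t ht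
    unfold countCompl
    rw [Finset.card_eq_zero, Finset.filter_eq_empty_iff]
    intro α hα
    rw [Finset.Nat.mem_antidiagonalTuple] at hα
    simp at hα
    omega
  | succ s ih =>
    set F : ℕ → Set (Fin s → ℕ) := fun j => {α | (Fin.cons j α : Fin (s + 1) → ℕ) ∈ E} with hF
    have hup : ∀ j, IsUpperSet (F j) := fun j α β hab hα =>
      hE (Fin.cons_le_cons.2 ⟨le_rfl, hab⟩) hα
    have hmono : Monotone F := fun i j hij α hα => hE (Fin.cons_le_cons.2 ⟨hij, le_rfl⟩) hα
    -- Dickson's lemma: if the increasing chain never stabilised, there would be elements `α (a n)`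
    -- of `F (a (n + 1))` outside `F (a n)`. Among them some `α (a m) ≤ α (a n)` with `m < n`, and
    -- then `α (a n)` would lie in `F (a (m + 1)) ⊆ F (a n)`.
    obtain ⟨J, hJ⟩ : ∃ J, ∀ j, J ≤ j → F j = F J := by
      by_contra! hcon
      choose g hg1 hg2 using hcon
      have h1 : ∀ j, ∃ α, α ∈ F (g j) ∧ α ∉ F j := by
        intro j
        by_contra! h
        exact hg2 j (Set.Subset.antisymm h (hmono (hg1 j)))
      choose α hα1 hα2 using h1
      let a : ℕ → ℕ := fun n => g^[n] 0
      have ha : ∀ n, a (n + 1) = g (a n) := fun n => Function.iterate_succ_apply' g n 0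
      have hamono : Monotone a := monotone_nat_of_le_succ fun n => by
        rw [ha]
        exact hg1 _
      obtain ⟨m, n, hmn, hle⟩ := wellQuasiOrdered_le (fun n => α (a n))
      apply hα2 (a n)
      refine hup _ hle (hmono ?_ (hα1 (a m)))
      rw [← ha]
      exact hamono hmn
    have key : ∀ᶠ t in atTop, countCompl E t = ∑ j ∈ Finset.range J, countCompl (F j) (t - j) +
        ∑ i ∈ Finset.range (t - J + 1), countCompl (F J) i := by
      filter_upwards [eventually_ge_atTop J] with t ht
      rw [countCompl_succ, show t + 1 = J + (t - J + 1) by omega, Finset.sum_range_add]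
      congr 1
      rw [← Finset.sum_range_reflect]
      refine Finset.sum_congr rfl fun i hi => ?_
      rw [Finset.mem_range] at hi
      have := hJ (J + (t - J + 1 - 1 - i)) (by omega)
      simp only [hF] at this
      rw [this]
      congr 1
      omega
    refine EventuallyPolynomial.congr ?_ key
    refine (EventuallyPolynomial.sum _ fun j _ => (ih (F j) (hup j)).shift j).add ?_
    have h2 := ((ih (F J) (hup J)).sum_range)
    -- The shifted sum runs over `i < t - J`, one term short of the range `t - J + 1`; evaluating at
    -- `t + 1` supplies this term.
    obtain ⟨P, hP⟩ := h2.shift J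
    refine ⟨P.comp (Polynomial.X + 1), ?_⟩
    have h3 : Tendsto (fun t : ℕ => t + 1) atTop atTop := tendsto_add_atTop_nat 1
    filter_upwards [h3.eventually hP, eventually_ge_atTop J] with t h4 h5
    rw [show t + 1 - J = t - J + 1 by omega] at h4
    rw [h4]
    simp

/-! ### Standard monomials and polynomiality of the Samuel function. -/

section LeadingExponents

variable {k B : Type*} [Field k] [CommRing B] [Algebra k B] {s : ℕ} (x : Fin s → B)

/-- The product of powers of `x` with exponent `α`. -/
def monomialAt (α : Fin s →₀ ℕ) : B := α.prod fun i e => x i ^ e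

theorem monomialAt_add (α β : Fin s →₀ ℕ) :
    monomialAt x (α + β) = monomialAt x α * monomialAt x β :=
  Finsupp.prod_add_index' (fun _ => pow_zero _) (fun _ _ _ => pow_add _ _ _)

theorem aeval_eq_sum_monomialAt (p : MvPolynomial (Fin s) k) :
    MvPolynomial.aeval x p = ∑ α ∈ p.support, p.coeff α • monomialAt x α := by
  rw [MvPolynomial.aeval_def, MvPolynomial.eval₂_eq']
  refine Finset.sum_congr rfl fun α _ => ?_
  rw [Algebra.smul_def, monomialAt, Finsupp.prod_fintype _ _ (by simp)]

theorem aeval_monomial_one (α : Fin s →₀ ℕ) :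
    MvPolynomial.aeval x (MvPolynomial.monomial α (1 : k)) = monomialAt x α := by
  rw [MvPolynomial.aeval_monomial, map_one, one_mul]
  rfl

theorem monomialAt_mem_pow (α : Fin s →₀ ℕ) (t : ℕ) (h : t ≤ α.degree) :
    monomialAt x α ∈ Ideal.span (Set.range x) ^ t := by
  refine Ideal.pow_le_pow_right h ?_
  rw [monomialAt, Finsupp.prod_fintype _ _ (by simp), Finsupp.degree_eq_sum,
    ← Finset.prod_pow_eq_pow_sum]
  exact Ideal.prod_mem_prod fun i _ => Ideal.pow_mem_pow
    (Ideal.subset_span (Set.mem_range_self i)) _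

/-- If `x` generates the algebra, the powers of the ideal of `x` are spanned by monomials. -/
theorem mem_pow_iff_mem_span (hx : Function.Surjective (MvPolynomial.aeval (R := k) x)) (t : ℕ)
    (b : B) : b ∈ Ideal.span (Set.range x) ^ t ↔
      b ∈ Submodule.span k (monomialAt x '' {α | t ≤ α.degree}) := by
  constructor
  · intro hb
    have h1 : Ideal.span (Set.range x) =
        (MvPolynomial.idealOfVars (Fin s) k).map (MvPolynomial.aeval (R := k) x) := by
      rw [MvPolynomial.idealOfVars, Ideal.map_span, ← Set.range_comp]
      congr 2
      ext i
      simp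
    rw [h1, ← Ideal.map_pow, Ideal.mem_map_iff_of_surjective _ hx] at hb
    obtain ⟨p, hp, rfl⟩ := hb
    rw [MvPolynomial.mem_pow_idealOfVars_iff] at hp
    rw [aeval_eq_sum_monomialAt]
    exact Submodule.sum_mem _ fun α hα => Submodule.smul_mem _ _
      (Submodule.subset_span ⟨α, hp α hα, rfl⟩)
  · intro hb
    have : Submodule.span k (monomialAt x '' {α | t ≤ α.degree}) ≤
        (Ideal.span (Set.range x) ^ t).restrictScalars k := by
      rw [Submodule.span_le]
      rintro _ ⟨α, hα, rfl⟩
      exact monomialAt_mem_pow x α t hα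
    exact this hb

variable (k) in
/-- The exponents whose monomial is a combination of larger ones, for the order which compares
degrees first. -/
def leadingExponents : Set (Fin s →₀ ℕ) :=
  {α | monomialAt x α ∈ Submodule.span k (monomialAt x ''
    {β | MonomialOrder.degLex.toSyn α < MonomialOrder.degLex.toSyn β})}

theorem isUpperSet_leadingExponents : IsUpperSet (leadingExponents k x) := by
  intro α β hab hα
  obtain ⟨γ, rfl⟩ := exists_add_of_le hab
  simp only [leadingExponents, Set.mem_ofPred_eq] at hα ⊢
  rw [monomialAt_add, mul_comm]
  have := Submodule.mem_map_of_mem (f := LinearMap.mulLeft k (monomialAt x γ)) hα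
  rw [Submodule.map_span] at this
  refine Submodule.span_mono ?_ this
  rintro _ ⟨_, ⟨β, hβ, rfl⟩, rfl⟩
  refine ⟨β + γ, ?_, ?_⟩
  · simp only [Set.mem_ofPred_eq, map_add] at hβ ⊢
    exact add_lt_add_left hβ _
  · rw [monomialAt_add, mul_comm]
    rfl

theorem degree_le_of_degLex_lt {α β : Fin s →₀ ℕ}
    (h : MonomialOrder.degLex.toSyn α < MonomialOrder.degLex.toSyn β) :
    α.degree ≤ β.degree := by
  rw [MonomialOrder.degLex_lt_iff] at h
  exact Finsupp.DegLex.monotone_degree h.le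

/-- The standard exponents of degree less than `t`. -/
abbrev StandardExponents (k : Type*) {B : Type*} [Field k] [CommRing B] [Algebra k B] {s : ℕ}
    (x : Fin s → B) (t : ℕ) : Type :=
  {α : Fin s →₀ ℕ // α ∉ leadingExponents k x ∧ α.degree < t}

/-- In a nontrivial relation modulo the power, isolate the smallest exponent with nonzero
coefficient. The other terms are larger, and so are the monomials of degree at least `t` which span
the power, so this exponent would be leading. -/
theorem linearIndependent_standard
    (hx : Function.Surjective (MvPolynomial.aeval (R := k) x)) (t : ℕ) :
    LinearIndependent k (fun α : StandardExponents k x t =>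
      Ideal.Quotient.mk (Ideal.span (Set.range x) ^ t) (monomialAt x α.1)) := by
  classical
  rw [linearIndependent_iff']
  intro S c hc
  by_contra! hcon
  obtain ⟨i, hiS, hi⟩ := hcon
  set T := S.filter (fun i => c i ≠ 0)
  have hT : T.Nonempty := ⟨i, by simp [T, hiS, hi]⟩
  obtain ⟨α, hαT, hmin⟩ := T.exists_min_image
    (fun α => MonomialOrder.degLex.toSyn α.1) hT
  have hcα : c α ≠ 0 := (Finset.mem_filter.1 hαT).2
  apply α.2.1
  have h1 : ∑ i ∈ S, c i • monomialAt x i.1 ∈ Ideal.span (Set.range x) ^ t := by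
    rw [← Ideal.Quotient.eq_zero_iff_mem, ← hc, map_sum]
    rfl
  rw [mem_pow_iff_mem_span x hx] at h1
  have h2 : ∑ i ∈ S, c i • monomialAt x i.1 = ∑ i ∈ T, c i • monomialAt x i.1 := by
    symm
    refine Finset.sum_subset (Finset.filter_subset _ _) fun j hj hjT => ?_
    have : c j = 0 := by
      by_contra h
      exact hjT (Finset.mem_filter.2 ⟨hj, h⟩)
    rw [this, zero_smul]
  rw [h2, ← Finset.add_sum_erase _ _ hαT] at h1
  set W := Submodule.span k (monomialAt x ''
    {β | MonomialOrder.degLex.toSyn α.1 < MonomialOrder.degLex.toSyn β}) with hW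
  have h3 : ∑ i ∈ T.erase α, c i • monomialAt x i.1 ∈ W := by
    refine Submodule.sum_mem _ fun j hj => Submodule.smul_mem _ _ (Submodule.subset_span
      ⟨j.1, ?_, rfl⟩)
    rw [Finset.mem_erase] at hj
    refine lt_of_le_of_ne (hmin j hj.2) fun h => hj.1 ?_
    exact Subtype.ext (MonomialOrder.degLex.toSyn.injective h.symm)
  have h4 : Submodule.span k (monomialAt x '' {α | t ≤ α.degree}) ≤ W := by
    refine Submodule.span_mono (Set.image_mono fun β hβ => ?_)
    by_contra h
    rw [Set.mem_ofPred_eq] at h hβ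
    rcases (not_lt.1 h).lt_or_eq with h | h
    · have := degree_le_of_degLex_lt h
      have := α.2.2
      omega
    · have := MonomialOrder.degLex.toSyn.injective h
      have h5 := α.2.2
      rw [← this] at h5
      omega
  have h5 : c α • monomialAt x α.1 ∈ W := (Submodule.add_mem_iff_left _ h3).1 (h4 h1)
  exact (Submodule.smul_mem_iff _ hcα).1 h5

/-- Descending induction on the finitely many exponents of degree less than `t`: the monomial of a
leading exponent is rewritten in larger monomials, and those reaching degree `t` vanish in the
quotient. -/
theorem span_standard
    (hx : Function.Surjective (MvPolynomial.aeval (R := k) x)) (t : ℕ) :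
    ⊤ ≤ Submodule.span k (Set.range (fun α : StandardExponents k x t =>
      Ideal.Quotient.mk (Ideal.span (Set.range x) ^ t) (monomialAt x α.1))) := by
  set W := Submodule.span k (Set.range (fun α : StandardExponents k x t =>
      Ideal.Quotient.mk (Ideal.span (Set.range x) ^ t) (monomialAt x α.1))) with hW
  have hfin : Finite {α : Fin s →₀ ℕ // α.degree < t} :=
    Set.Finite.to_subtype (Set.Finite.subset (Finsupp.finite_of_degree_le t)
      (fun α hα => Nat.le_of_lt hα))
  have key : ∀ α : {α : Fin s →₀ ℕ // α.degree < t},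
      Ideal.Quotient.mk (Ideal.span (Set.range x) ^ t) (monomialAt x α.1) ∈ W := by
    have hwf : WellFounded (fun α β : {α : Fin s →₀ ℕ // α.degree < t} =>
        MonomialOrder.degLex.toSyn β.1 < MonomialOrder.degLex.toSyn α.1) := by
      have : IsTrans {α : Fin s →₀ ℕ // α.degree < t} (fun α β =>
        MonomialOrder.degLex.toSyn β.1 < MonomialOrder.degLex.toSyn α.1) :=
        ⟨fun a b c h1 h2 => h2.trans h1⟩
      have : Std.Irrefl (α := {α : Fin s →₀ ℕ // α.degree < t}) (fun α β =>
        MonomialOrder.degLex.toSyn β.1 < MonomialOrder.degLex.toSyn α.1) :=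
        ⟨fun a => lt_irrefl _⟩
      exact Finite.wellFounded_of_trans_of_irrefl _
    intro α
    induction α using hwf.induction with
    | h α ih =>
      by_cases hα : α.1 ∈ leadingExponents k x
      · have h1 := Submodule.mem_map_of_mem
          (f := (Ideal.Quotient.mkₐ k (Ideal.span (Set.range x) ^ t)).toLinearMap)
          (show monomialAt x α.1 ∈ Submodule.span k _ from hα)
        rw [Submodule.map_span] at h1
        refine (Submodule.span_le.2 ?_) h1
        rintro _ ⟨_, ⟨β, hβ, rfl⟩, rfl⟩
        by_cases hβt : β.degree < t
        · exact ih ⟨β, hβt⟩ hβ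
        · have : Ideal.Quotient.mk (Ideal.span (Set.range x) ^ t) (monomialAt x β) = 0 :=
            Ideal.Quotient.eq_zero_iff_mem.2 (monomialAt_mem_pow x β t (not_lt.1 hβt))
          simp [this]
      · exact Submodule.subset_span ⟨⟨α.1, hα, α.2⟩, rfl⟩
  rintro b -
  obtain ⟨b, rfl⟩ := Ideal.Quotient.mk_surjective b
  obtain ⟨p, rfl⟩ := hx b
  rw [aeval_eq_sum_monomialAt, map_sum]
  refine Submodule.sum_mem _ fun α _ => ?_
  change p.coeff α • Ideal.Quotient.mk (Ideal.span (Set.range x) ^ t) (monomialAt x α) ∈ W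
  refine Submodule.smul_mem _ _ ?_
  by_cases hαt : α.degree < t
  · exact key ⟨α, hαt⟩
  · have : Ideal.Quotient.mk (Ideal.span (Set.range x) ^ t) (monomialAt x α) = 0 :=
      Ideal.Quotient.eq_zero_iff_mem.2 (monomialAt_mem_pow x α t (not_lt.1 hαt))
    rw [this]
    exact zero_mem _

theorem finite_standardExponents (t : ℕ) : Finite (StandardExponents k x t) :=
  Set.Finite.to_subtype (Set.Finite.subset (Finsupp.finite_of_degree_le t)
    (fun _ hα => Nat.le_of_lt hα.2))

theorem finrank_quotient_pow_eq_card
    (hx : Function.Surjective (MvPolynomial.aeval (R := k) x)) (t : ℕ) :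
    Module.finrank k (B ⧸ Ideal.span (Set.range x) ^ t) = Nat.card (StandardExponents k x t) := by
  have := finite_standardExponents (k := k) x t
  exact Module.finrank_eq_nat_card_basis
    (Module.Basis.mk (linearIndependent_standard x hx t) (span_standard x hx t))

theorem finite_quotient_pow
    (hx : Function.Surjective (MvPolynomial.aeval (R := k) x)) (t : ℕ) :
    Module.Finite k (B ⧸ Ideal.span (Set.range x) ^ t) := by
  have := finite_standardExponents (k := k) x t
  exact Module.Finite.of_basis
    (Module.Basis.mk (linearIndependent_standard x hx t) (span_standard x hx t))

/-- The Samuel function of the ideal of a system of generators is eventually polynomial. -/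
theorem eventuallyPolynomial_finrank_quotient_pow
    (hx : Function.Surjective (MvPolynomial.aeval (R := k) x)) :
    EventuallyPolynomial (fun t => Module.finrank k (B ⧸ Ideal.span (Set.range x) ^ t)) := by
  classical
  set E : Set (Fin s → ℕ) := {α | Finsupp.equivFunOnFinite.symm α ∈ leadingExponents k x}
  have hE : IsUpperSet E := fun α β hab hα => isUpperSet_leadingExponents x hab hα
  refine (eventuallyPolynomial_countCompl E hE).sum_range.congr (Eventually.of_forall fun t => ?_)
  rw [finrank_quotient_pow_eq_card x hx]
  unfold countCompl
  rw [← Finset.card_sigma, ← Fintype.card_coe, ← Nat.card_eq_fintype_card]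
  refine Nat.card_congr
    { toFun := fun α => ⟨⟨α.1.degree, α.1⟩, ?_⟩
      invFun := fun p => ⟨Finsupp.equivFunOnFinite.symm p.1.2, ?_⟩
      left_inv := fun α => ?_
      right_inv := fun p => ?_ }
  · simp only [Finset.mem_sigma, Finset.mem_range, Finset.mem_filter,
      Finset.Nat.mem_antidiagonalTuple, Finsupp.degree_eq_sum]
    refine ⟨?_, trivial, ?_⟩
    · rw [← Finsupp.degree_eq_sum]
      exact α.2.2
    · change Finsupp.equivFunOnFinite.symm _ ∉ leadingExponents k x
      convert α.2.1
      exact Finsupp.equivFunOnFinite_symm_coe _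
  · obtain ⟨⟨j, β⟩, hp⟩ := p
    simp only [Finset.mem_sigma, Finset.mem_range, Finset.mem_filter,
      Finset.Nat.mem_antidiagonalTuple] at hp
    refine ⟨hp.2.2, ?_⟩
    rw [Finsupp.degree_eq_sum]
    simp only [Finsupp.equivFunOnFinite_symm_apply_apply]
    omega
  · exact Subtype.ext (Finsupp.equivFunOnFinite_symm_coe _)
  · obtain ⟨⟨j, β⟩, hp⟩ := p
    simp only [Finset.mem_sigma, Finset.mem_range, Finset.mem_filter,
      Finset.Nat.mem_antidiagonalTuple] at hp
    obtain ⟨-, rfl, -⟩ := hp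
    refine Subtype.ext (Sigma.ext ?_ ?_)
    · simp [Finsupp.degree_eq_sum]
    · simp

end LeadingExponents

/-! ### Contraction of powers of a maximal ideal along a finite extension of a normal domain. -/

open scoped Pointwise in
/-- In a finite Galois situation, a power of a maximal ideal contracts into a comparable power
of its contraction. -/
theorem Ideal.exists_comap_pow_le_of_isInvariant {R T G : Type*} [CommRing R] [CommRing T]
    [Algebra R T] [Algebra ℚ R] [IsNoetherianRing T] [Group G] [Finite G] [MulSemiringAction G T]
    [SMulCommClass G R T] [Algebra.IsInvariant R T G] [FaithfulSMul R T]
    (p : Ideal T) [hp : p.IsMaximal] :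
    ∃ c, 0 < c ∧ ∀ m, (p ^ (c * m)).comap (algebraMap R T) ≤ (p.under R) ^ m := by
  classical
  have := Fintype.ofFinite G
  have hint : Algebra.IsIntegral R T := Algebra.IsInvariant.isIntegral R T G
  have hpR : (p.under R).IsMaximal := Ideal.isMaximal_comap_of_isIntegral_of_isMaximal p
  set n := p.under R with hn
  set O : Finset (Ideal T) := Finset.univ.image (fun σ : G => σ • p)
  have hOmax : ∀ q ∈ O, q.IsMaximal := by
    intro q hq
    obtain ⟨σ, -, rfl⟩ := Finset.mem_image.1 hq
    have : (σ • p).IsPrime := hp.isPrime.smul σ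
    refine Ideal.isMaximal_of_isIntegral_of_isMaximal_comap (R := R) _ ?_
    have h1 : (σ • p).under R = p.under R := p.under_smul R σ
    rw [Ideal.under_def] at h1
    rw [h1]
    exact hpR
  -- A prime containing `n T` contracts to the maximal ideal `n`, hence is a conjugate of `p` and
  -- contains the product of all conjugates.
  have hrad : ∏ q ∈ O, q ≤ (n.map (algebraMap R T)).radical := by
    rw [Ideal.radical_eq_sInf]
    refine le_sInf ?_
    rintro q ⟨hq1, hq2⟩
    have h1 : q.under R = p.under R :=
      (hpR.eq_of_le (Ideal.comap_ne_top _ hq2.ne_top) (Ideal.map_le_iff_le_comap.1 hq1)).symm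
    obtain ⟨σ, rfl⟩ := Algebra.IsInvariant.exists_smul_of_under_eq R T G p q h1.symm
    exact Ideal.prod_le_inf.trans (Finset.inf_le (Finset.mem_image_of_mem _ (Finset.mem_univ σ)))
  obtain ⟨c, hc⟩ := Ideal.exists_radical_pow_le_of_fg (n.map (algebraMap R T))
    (IsNoetherian.noetherian _)
  -- The exponent of the radical may be 0; adding 1 makes the constant positive.
  refine ⟨c + 1, by omega, fun m f hf => ?_⟩
  rw [Ideal.mem_comap] at hf
  have h1 : ∀ q ∈ O, algebraMap R T f ∈ q ^ ((c + 1) * m) := by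
    intro q hq
    obtain ⟨σ, -, rfl⟩ := Finset.mem_image.1 hq
    rw [← smul_pow', ← smul_algebraMap σ f]
    exact Ideal.smul_mem_pointwise_smul σ _ _ hf
  have h2 : algebraMap R T f ∈ (∏ q ∈ O, q) ^ ((c + 1) * m) := by
    rw [← Finset.prod_pow, Ideal.prod_eq_iInf_of_pairwise_isCoprime]
    · simpa [Ideal.mem_iInf] using h1
    · intro q hq q' hq' hne
      have h3 := hOmax q hq
      have h4 := hOmax q' hq'
      exact (Ideal.isCoprime_of_isMaximal hne).pow
  have h3 : algebraMap R T f ∈ (n ^ m).map (algebraMap R T) := by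
    rw [Ideal.map_pow]
    refine (Ideal.pow_right_mono ((Ideal.pow_le_pow_right (Nat.le_succ c)).trans
      ((Ideal.pow_right_mono hrad c).trans hc)) m) ?_
    rwa [← pow_mul]
  -- The trace over `G` carries `n ^ m T` into `n ^ m`. The trace of the invariant element `f` is
  -- `|G| f`, and `|G|` is invertible because the ring contains the rationals.
  have h4 : ∀ u ∈ (n ^ m).map (algebraMap R T), ∀ a : T, ∃ r ∈ n ^ m,
      algebraMap R T r = ∑ σ : G, σ • (a * u) := by
    intro u hu
    rw [Ideal.map] at hu
    induction hu using Submodule.span_induction with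
    | zero => exact fun a => ⟨0, zero_mem _, by simp⟩
    | add u v _ _ hu hv =>
      intro a
      obtain ⟨r, hr, hr'⟩ := hu a
      obtain ⟨s, hs, hs'⟩ := hv a
      exact ⟨r + s, add_mem hr hs, by simp [hr', hs', mul_add, Finset.sum_add_distrib]⟩
    | mem u hu =>
      intro a
      obtain ⟨r, hr, rfl⟩ := hu
      obtain ⟨s, hs⟩ := Algebra.IsInvariant.isInvariant (A := R) (G := G) (∑ σ : G, σ • a)
        (fun τ => by
          rw [Finset.smul_sum]
          exact Fintype.sum_equiv (Equiv.mulLeft τ) _ _ fun σ => (mul_smul τ σ a).symm)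
      refine ⟨s * r, Ideal.mul_mem_left _ _ hr, ?_⟩
      rw [map_mul, hs, Finset.sum_mul]
      simp [smul_mul', smul_algebraMap]
    | smul b u _ hu =>
      intro a
      rw [smul_eq_mul, ← mul_assoc]
      exact hu _
  obtain ⟨r, hr, hr'⟩ := h4 _ h3 1
  have h5 : r = (Fintype.card G : ℚ) • f := by
    apply FaithfulSMul.algebraMap_injective R T
    rw [hr', Nat.cast_smul_eq_nsmul, map_nsmul]
    simp [smul_algebraMap]
  have h6 : f = (Fintype.card G : ℚ)⁻¹ • r := by
    rw [h5, smul_smul, inv_mul_cancel₀ (by simp), one_smul]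
  rw [h6, Algebra.smul_def]
  exact Ideal.mul_mem_left _ _ hr

/-- A power of a maximal ideal of a finite extension of a normal domain contracts into a
comparable power of its contraction. -/
theorem Ideal.exists_comap_pow_le {R S : Type*} [CommRing R] [CommRing S] [IsDomain R]
    [IsDomain S] [IsIntegrallyClosed R] [IsNoetherianRing R] [Algebra ℚ R] [Algebra R S]
    [Module.IsTorsionFree R S] [Module.Finite R S] (p : Ideal S) [hp : p.IsMaximal] :
    ∃ c, 0 < c ∧ ∀ m, (p ^ (c * m)).comap (algebraMap R S) ≤ (p.under R) ^ m := by
  have hR : CharZero R := algebraRat.charZero R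
  have hR2 : CharZero (FractionRing R) :=
    charZero_of_injective_algebraMap (IsFractionRing.injective R (FractionRing R))
  let K := FractionRing R
  let F := FractionRing S
  let : Algebra K F := FractionRing.liftAlgebra _ _
  -- The integral closure `T` of `R` in this Galois extension contains `S`. Its ring of Galois
  -- invariants is `R` because `R` is integrally closed, and a prime of `T` over `p` reduces the
  -- claim to the invariant case.
  let L := IntermediateField.normalClosure K F (AlgebraicClosure F)
  have hL : IsScalarTower R F L := IsScalarTower.to₁₃₄ R K F L
  let T := integralClosure R L
  let ψ : S →ₐ[R] T := ((IsScalarTower.toAlgHom R F L).comp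
    (IsScalarTower.toAlgHom R S F)).codRestrict T fun s =>
      (Algebra.IsIntegral.isIntegral (R := R) s).map _
  let : Algebra S T := ψ.toRingHom.toAlgebra
  have hST : IsScalarTower R S T := IsScalarTower.of_algebraMap_eq fun r => (ψ.commutes r).symm
  have h1 : Algebra.IsIntegral S T := Algebra.IsIntegral.tower_top R
  have hinj : Function.Injective (algebraMap S T) := by
    intro a b hab
    refine IsFractionRing.injective S F ((algebraMap F L).injective ?_)
    exact congrArg (algebraMap T L) hab
  have hinj2 : FaithfulSMul R T := by
    rw [faithfulSMul_iff_algebraMap_injective, IsScalarTower.algebraMap_eq R S T]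
    exact hinj.comp (FaithfulSMul.algebraMap_injective R S)
  have h4 : IsGalois K L := inferInstance
  have h5 : FiniteDimensional K L := inferInstance
  have hfrac : IsFractionRing T L := integralClosure.isFractionRing_of_finite_extension K L
  have h6 : Algebra.IsInvariant R T (T ≃ₐ[R] T) :=
    Algebra.isInvariant_of_isGalois' R K L T
  have h7 : Finite (T ≃ₐ[R] T) :=
    Finite.of_equiv _ (galRestrict R K L T).toEquiv
  have h8 : IsNoetherianRing T :=
    IsIntegralClosure.isNoetherianRing R K L T
  obtain ⟨q, hq, hqp⟩ := Ideal.exists_ideal_over_maximal_of_isIntegral (S := T) p (by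
    rw [(RingHom.injective_iff_ker_eq_bot _).1 hinj]
    exact bot_le)
  obtain ⟨c, hc, h⟩ := Ideal.exists_comap_pow_le_of_isInvariant (R := R) (G := T ≃ₐ[R] T) q
  refine ⟨c, hc, fun m f hf => ?_⟩
  have h9 : p.under R = q.under R := by
    rw [Ideal.under_def, Ideal.under_def, ← hqp, Ideal.comap_comap, IsScalarTower.algebraMap_eq R S T]
  rw [h9]
  refine h m ?_
  rw [Ideal.mem_comap] at hf ⊢
  rw [IsScalarTower.algebraMap_apply R S T]
  have h10 : p ≤ q.comap (algebraMap S T) := hqp.ge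
  have h11 := Ideal.pow_right_mono h10 (c * m) hf
  exact Ideal.le_comap_pow _ _ h11

/-! ### Order of growth of the Samuel function of an affine domain at a rational point. -/

section Growth

variable {k S : Type*} [Field k] [CommRing S] [Algebra k S]

/-- Modulo generators at which `ε` vanishes, every element is congruent to the constant `ε` of it.
-/
theorem span_range_eq_ker {s : ℕ} (x : Fin s → S) (ε : S →ₐ[k] k)
    (hx : Function.Surjective (MvPolynomial.aeval (R := k) x)) (hε : ∀ i, ε (x i) = 0) :
    Ideal.span (Set.range x) = RingHom.ker ε := by
  apply le_antisymm
  · rw [Ideal.span_le]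
    rintro _ ⟨i, rfl⟩
    exact hε i
  · have key : ∀ p : MvPolynomial (Fin s) k, MvPolynomial.aeval x p -
        algebraMap k S (ε (MvPolynomial.aeval x p)) ∈ Ideal.span (Set.range x) := by
      intro p
      induction p using MvPolynomial.induction_on with
      | C a => simp
      | add p q hp hq =>
        simp only [map_add]
        convert add_mem hp hq using 1
        ring
      | mul_X p i _ =>
        simp only [map_mul, MvPolynomial.aeval_X, hε, mul_zero, map_zero, sub_zero]
        exact Ideal.mul_mem_left _ _ (Ideal.subset_span ⟨i, rfl⟩)
    intro b hb
    obtain ⟨p, rfl⟩ := hx b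
    have := key p
    rwa [(RingHom.mem_ker).1 hb, map_zero, sub_zero] at this

theorem exists_generators_ker [Algebra.FiniteType k S] (ε : S →ₐ[k] k) :
    ∃ (s : ℕ) (x : Fin s → S), Function.Surjective (MvPolynomial.aeval (R := k) x) ∧
      Ideal.span (Set.range x) = RingHom.ker ε := by
  obtain ⟨s, f, hf⟩ := Algebra.FiniteType.iff_quotient_mvPolynomial''.1 ‹Algebra.FiniteType k S›
  set x : Fin s → S := fun i => f (MvPolynomial.X i) - algebraMap k S (ε (f (MvPolynomial.X i)))
    with hx
  have hsurj : Function.Surjective (MvPolynomial.aeval (R := k) x) := by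
    intro b
    obtain ⟨p, rfl⟩ := hf b
    refine ⟨MvPolynomial.aeval (fun i => MvPolynomial.X i +
      MvPolynomial.C (ε (f (MvPolynomial.X i)))) p, ?_⟩
    have : (MvPolynomial.aeval (R := k) x).comp (MvPolynomial.aeval (fun i => MvPolynomial.X i +
      MvPolynomial.C (ε (f (MvPolynomial.X i))))) = f := by
      refine MvPolynomial.algHom_ext fun i => ?_
      simp [hx, ← MvPolynomial.algebraMap_eq]
    exact DFunLike.congr_fun this p
  exact ⟨s, x, hsurj, span_range_eq_ker x ε hsurj fun i => by simp [hx]⟩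

theorem finite_quotient_ker_pow [Algebra.FiniteType k S] (ε : S →ₐ[k] k) (t : ℕ) :
    Module.Finite k (S ⧸ RingHom.ker ε ^ t) := by
  obtain ⟨s, x, hx, h⟩ := exists_generators_ker ε
  rw [← h]
  exact finite_quotient_pow x hx t

theorem eventuallyPolynomial_finrank_quotient_ker_pow [Algebra.FiniteType k S] (ε : S →ₐ[k] k) :
    EventuallyPolynomial (fun t => Module.finrank k (S ⧸ RingHom.ker ε ^ t)) := by
  obtain ⟨s, x, hx, h⟩ := exists_generators_ker ε
  rw [← h]
  exact eventuallyPolynomial_finrank_quotient_pow x hx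

variable (k) in
-- In a polynomial ring distinct monomials are independent, so every exponent is standard.
theorem finrank_quotient_idealOfVars_pow (d t : ℕ) :
    Module.finrank k (MvPolynomial (Fin d) k ⧸ MvPolynomial.idealOfVars (Fin d) k ^ t) =
      Nat.card {α : Fin d →₀ ℕ // α.degree < t} := by
  have hX : Function.Surjective (MvPolynomial.aeval (R := k)
      (MvPolynomial.X : Fin d → MvPolynomial (Fin d) k)) := fun p => ⟨p, by simp⟩
  have h1 := finrank_quotient_pow_eq_card _ hX t
  have h2 : leadingExponents k (MvPolynomial.X : Fin d → MvPolynomial (Fin d) k) = ∅ := by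
    rw [Set.eq_empty_iff_forall_notMem]
    intro α hα
    have h3 : ∀ p ∈ Submodule.span k (monomialAt (MvPolynomial.X : Fin d → MvPolynomial (Fin d) k)
        '' {β | MonomialOrder.degLex.toSyn α < MonomialOrder.degLex.toSyn β}),
        p.coeff α = 0 := by
      intro p hp
      induction hp using Submodule.span_induction with
      | zero => simp
      | add p q _ _ hp hq => simp [hp, hq]
      | smul a p _ hp => simp [hp]
      | mem p hp =>
        obtain ⟨β, hβ, rfl⟩ := hp
        rw [Set.mem_ofPred_eq] at hβ
        rw [← aeval_monomial_one (k := k), MvPolynomial.aeval_X_left_apply,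
          MvPolynomial.coeff_monomial, if_neg]
        rintro rfl
        exact lt_irrefl _ hβ
    have h4 := h3 _ hα
    rw [← aeval_monomial_one (k := k), MvPolynomial.aeval_X_left_apply,
      MvPolynomial.coeff_monomial, if_pos rfl] at h4
    exact one_ne_zero h4
  rw [MvPolynomial.idealOfVars, h1]
  refine Nat.card_congr (Equiv.subtypeEquivRight fun α => ?_)
  simp [h2]

theorem card_degree_lt_le (d t : ℕ) :
    Nat.card {α : Fin d →₀ ℕ // α.degree < t} ≤ t ^ d := by
  have : Nat.card (Fin d → Fin t) = t ^ d := by simp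
  rw [← this]
  refine Nat.card_le_card_of_injective (fun α i => ⟨α.1 i, ?_⟩) ?_
  · exact (Finsupp.le_degree i α.1).trans_lt α.2
  · intro α β h
    ext i
    exact congrArg Fin.val (congrFun h i)

/-- The cube of exponents with all entries at most `t / (d + 1)` fits inside, since `d` such entries
add up to less than `t`. -/
theorem le_card_degree_lt (d t : ℕ) (ht : 1 ≤ t) :
    (t / (d + 1) + 1) ^ d ≤ Nat.card {α : Fin d →₀ ℕ // α.degree < t} := by
  have : Nat.card (Fin d → Fin (t / (d + 1) + 1)) = (t / (d + 1) + 1) ^ d := by simp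
  rw [← this]
  have hfin : Finite {α : Fin d →₀ ℕ // α.degree < t} :=
    Set.Finite.to_subtype (Set.Finite.subset (Finsupp.finite_of_degree_le t)
      (fun α hα => Nat.le_of_lt hα))
  refine Nat.card_le_card_of_injective
    (fun α => ⟨Finsupp.equivFunOnFinite.symm fun i => (α i : ℕ), ?_⟩) ?_
  · rw [Finsupp.degree_eq_sum]
    calc ∑ i, (Finsupp.equivFunOnFinite.symm fun i => (α i : ℕ)) i
        ≤ ∑ _i : Fin d, t / (d + 1) := Finset.sum_le_sum fun i _ => Nat.lt_succ_iff.1 (α i).2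
      _ = d * (t / (d + 1)) := by simp
      _ < t := by
        have h1 := Nat.div_mul_le_self t (d + 1)
        rcases Nat.eq_zero_or_pos (t / (d + 1)) with h | h
        · rw [h]; omega
        · nlinarith
  · intro α β h
    ext i
    have := DFunLike.congr_fun (congrArg Subtype.val h) i
    simpa using this

end Growth

theorem finrank_quotient_le_of_le {k S : Type*} [Field k] [CommRing S] [Algebra k S]
    {I J : Ideal S} (h : I ≤ J) [Module.Finite k (S ⧸ I)] :
    Module.finrank k (S ⧸ J) ≤ Module.finrank k (S ⧸ I) :=
  LinearMap.finrank_le_finrank_of_surjective (f := (Ideal.Quotient.factorₐ k h).toLinearMap)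
    (Ideal.Quotient.factor_surjective h)

/-- A module with `r` generators on which `I` acts as zero is a quotient of `r` copies of `A ⧸ I`.
-/
theorem finrank_quotient_le_mul {k A N : Type*} [Field k] [CommRing A] [Algebra k A]
    [AddCommGroup N] [Module k N] [Module A N] [IsScalarTower k A N] {r : ℕ}
    (φ : (Fin r → A) →ₗ[A] N) (hφ : Function.Surjective φ) (I : Ideal A)
    [Module.Finite k (A ⧸ I)] (W : Submodule A N) (hW : I • (⊤ : Submodule A N) ≤ W) :
    Module.Finite k (N ⧸ W) ∧ Module.finrank k (N ⧸ W) ≤ r * Module.finrank k (A ⧸ I) := by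
  classical
  let f : Fin r → (A ⧸ I) →ₗ[A] (N ⧸ W) := fun i =>
    Submodule.liftQ I (LinearMap.toSpanSingleton A (N ⧸ W) (W.mkQ (φ (Pi.single i 1)))) (by
      intro a ha
      rw [LinearMap.mem_ker, LinearMap.toSpanSingleton_apply, ← map_smul, Submodule.mkQ_apply,
        Submodule.Quotient.mk_eq_zero]
      exact hW (Submodule.smul_mem_smul ha trivial))
  let ψ : (Fin r → A ⧸ I) →ₗ[A] (N ⧸ W) := ∑ i, (f i).comp (LinearMap.proj i)
  have hψ : Function.Surjective ψ := by
    intro n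
    obtain ⟨n, rfl⟩ := W.mkQ_surjective n
    obtain ⟨v, rfl⟩ := hφ n
    refine ⟨fun i => Ideal.Quotient.mk I (v i), ?_⟩
    have h1 : v = ∑ i, v i • (Pi.single i 1 : Fin r → A) := by
      ext j
      simp [Finset.sum_apply, Pi.single_apply]
    conv_rhs => rw [h1]
    simp only [ψ, LinearMap.sum_apply, LinearMap.comp_apply, LinearMap.proj_apply, map_sum,
      map_smul]
    rfl
  have h2 : Function.Surjective (ψ.restrictScalars k) := hψ
  refine ⟨Module.Finite.of_surjective _ h2, ?_⟩
  refine (LinearMap.finrank_le_finrank_of_surjective h2).trans ?_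
  rw [Module.finrank_pi_fintype]
  simp

theorem trdeg_eq_of_finite {k S : Type u} [Field k] [CommRing S] [IsDomain S] [Algebra k S] {d : ℕ}
    (g : MvPolynomial (Fin d) k →ₐ[k] S) (hg : Function.Injective g) (hfin : g.Finite) :
    Algebra.trdeg k S = d := by
  let := g.toRingHom.toAlgebra
  have : IsScalarTower k (MvPolynomial (Fin d) k) S :=
    IsScalarTower.of_algebraMap_eq fun r => (g.commutes r).symm
  have : FaithfulSMul (MvPolynomial (Fin d) k) S :=
    (faithfulSMul_iff_algebraMap_injective _ _).2 hg
  have : Module.Finite (MvPolynomial (Fin d) k) S := hfin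
  have h := trdeg_add_eq k (MvPolynomial (Fin d) k) (A := S)
  rw [MvPolynomial.trdeg_of_isDomain, trdeg_eq_zero] at h
  rw [← h]
  simp

/-- The Samuel function at a rational point of an affine domain grows like the power given by the
transcendence degree. -/
theorem samuel_growth {k S : Type u} [Field k] [CharZero k] [CommRing S] [IsDomain S] [Algebra k S]
    [Algebra.FiniteType k S] (ε : S →ₐ[k] k) {d : ℕ} (hd : Algebra.trdeg k S = d) :
    ∃ c C : ℝ, 0 < c ∧ ∀ᶠ t : ℕ in atTop,
      c * t ^ d ≤ Module.finrank k (S ⧸ RingHom.ker ε ^ t) ∧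
      Module.finrank k (S ⧸ RingHom.ker ε ^ t) ≤ C * t ^ d := by
  obtain ⟨e, g₀, hg₀, hfin₀⟩ := exists_finite_inj_algHom_of_fg k S
  have hed : e = d := by
    have := trdeg_eq_of_finite g₀ hg₀ hfin₀
    rw [hd] at this
    exact_mod_cast this.symm
  subst hed
  -- The Noether normalization is translated so that the origin lies under the point `ε`; then the
  -- ideal of the variables is the contraction of `RingHom.ker ε`.
  let τ : (MvPolynomial (Fin e) k) →ₐ[k] (MvPolynomial (Fin e) k) := MvPolynomial.aeval (fun i => MvPolynomial.X i -
      algebraMap k _ (ε (g₀ (MvPolynomial.X i))))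
  let τ' : (MvPolynomial (Fin e) k) →ₐ[k] (MvPolynomial (Fin e) k) := MvPolynomial.aeval (fun i => MvPolynomial.X i +
      algebraMap k _ (ε (g₀ (MvPolynomial.X i))))
  have hτ : τ.comp τ' = AlgHom.id k (MvPolynomial (Fin e) k) := by
    refine MvPolynomial.algHom_ext fun i => ?_
    simp [τ, τ']
  have hτ' : τ'.comp τ = AlgHom.id k (MvPolynomial (Fin e) k) := by
    refine MvPolynomial.algHom_ext fun i => ?_
    simp [τ, τ']
  have hτsurj : Function.Surjective τ := fun p => ⟨τ' p, DFunLike.congr_fun hτ p⟩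
  have hτinj : Function.Injective τ :=
    Function.LeftInverse.injective (g := τ') fun p => DFunLike.congr_fun hτ' p
  set g : (MvPolynomial (Fin e) k) →ₐ[k] S := g₀.comp τ
  have hg : Function.Injective g := hg₀.comp hτinj
  have hfin : g.Finite := hfin₀.comp (AlgHom.Finite.of_surjective _ hτsurj)
  have hε : ∀ i, (ε.comp g) (MvPolynomial.X i) = 0 := by
    intro i
    simp [g, τ]
  have hker : MvPolynomial.idealOfVars (Fin e) k = RingHom.ker (ε.comp g) :=
    span_range_eq_ker _ _ (fun p => ⟨p, by simp⟩) hε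
  let := g.toRingHom.toAlgebra
  have hst : IsScalarTower k (MvPolynomial (Fin e) k) S :=
    IsScalarTower.of_algebraMap_eq fun r => (g.commutes r).symm
  have hfaith : FaithfulSMul (MvPolynomial (Fin e) k) S :=
    (faithfulSMul_iff_algebraMap_injective _ _).2 hg
  have hfinite : Module.Finite (MvPolynomial (Fin e) k) S := hfin
  have : (RingHom.ker ε).IsMaximal :=
    RingHom.ker_isMaximal_of_surjective _ (fun r => ⟨algebraMap k S r, by simp⟩)
  have hunder : (RingHom.ker ε).under (MvPolynomial (Fin e) k) = MvPolynomial.idealOfVars (Fin e) k := hker.symm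
  let : Algebra ℚ (MvPolynomial (Fin e) k) := ((algebraMap k (MvPolynomial (Fin e) k)).comp (algebraMap ℚ k)).toAlgebra
  obtain ⟨c, hc, hcomap⟩ := Ideal.exists_comap_pow_le (R := (MvPolynomial (Fin e) k)) (RingHom.ker ε)
  rw [hunder] at hcomap
  have hfinP : ∀ t, Module.Finite k ((MvPolynomial (Fin e) k) ⧸ MvPolynomial.idealOfVars (Fin e) k ^ t) :=
    fun t => finite_quotient_pow _ (fun p => ⟨p, by simp⟩) t
  have hfinS := finite_quotient_ker_pow ε
  -- Lower bound: the contraction of `RingHom.ker ε ^ t` lies in the power `t / c` of the ideal of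
  -- the variables, and the quotient by the contraction embeds in `S ⧸ RingHom.ker ε ^ t`.
  have hlow : ∀ t, Module.finrank k ((MvPolynomial (Fin e) k) ⧸ MvPolynomial.idealOfVars (Fin e) k ^ (t / c)) ≤
      Module.finrank k (S ⧸ RingHom.ker ε ^ t) := by
    intro t
    set J := (RingHom.ker ε ^ t).comap (algebraMap (MvPolynomial (Fin e) k) S) with hJ
    have hle : J ≤ MvPolynomial.idealOfVars (Fin e) k ^ (t / c) :=
      (Ideal.comap_mono (Ideal.pow_le_pow_right (Nat.mul_div_le t c))).trans (hcomap _)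
    let f : ((MvPolynomial (Fin e) k) ⧸ J) →ₐ[k] (S ⧸ RingHom.ker ε ^ t) :=
      Ideal.quotientMapₐ _ (IsScalarTower.toAlgHom k (MvPolynomial (Fin e) k) S) le_rfl
    have hf : Function.Injective f := Ideal.quotientMap_injective
    have : Module.Finite k ((MvPolynomial (Fin e) k) ⧸ J) := Module.Finite.of_injective f.toLinearMap hf
    exact (finrank_quotient_le_of_le hle).trans
      (LinearMap.finrank_le_finrank_of_injective (f := f.toLinearMap) hf)
  obtain ⟨r, φ, hφ⟩ := Module.Finite.exists_fin' (MvPolynomial (Fin e) k) S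
  have hup : ∀ t, Module.finrank k (S ⧸ RingHom.ker ε ^ t) ≤
      r * Module.finrank k (MvPolynomial (Fin e) k ⧸ MvPolynomial.idealOfVars (Fin e) k ^ t) := by
    intro t
    refine (finrank_quotient_le_mul φ hφ (MvPolynomial.idealOfVars (Fin e) k ^ t)
      ((RingHom.ker ε ^ t).restrictScalars (MvPolynomial (Fin e) k)) ?_).2
    rw [Submodule.smul_le]
    intro a ha s _
    rw [Algebra.smul_def]
    refine Ideal.mul_mem_right _ (RingHom.ker ε ^ t) ?_
    exact Ideal.le_comap_pow _ _ (Ideal.pow_right_mono hunder.ge t ha)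
  -- The cube count gives `(t / c / (e + 1) + 1) ^ e` with rounded division, and `t < c (e + 1) (t /
  -- c / (e + 1) + 1)`; the factor 2 is slack.
  refine ⟨((2 * c * (e + 1) : ℝ) ^ e)⁻¹, r, by positivity, ?_⟩
  filter_upwards [eventually_ge_atTop c] with t ht
  constructor
  · have h1 := hlow t
    have h2 : 1 ≤ t / c := (Nat.one_le_div_iff hc).2 ht
    rw [finrank_quotient_idealOfVars_pow] at h1
    have h3 := (le_card_degree_lt e (t / c) h2).trans h1
    have h4 : (((t / c / (e + 1) + 1) ^ e : ℕ) : ℝ) ≤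
        Module.finrank k (S ⧸ RingHom.ker ε ^ t) := by exact_mod_cast h3
    refine le_trans ?_ h4
    rw [← inv_pow, ← mul_pow]
    push_cast
    refine pow_le_pow_left₀ (by positivity) ?_ _
    have h5 : (t : ℝ) < c * (e + 1) * ((t / c / (e + 1) : ℕ) + 1) := by
      rw [Nat.div_div_eq_div_mul]
      have := Nat.lt_mul_div_succ t (b := c * (e + 1)) (by positivity)
      exact_mod_cast this
    have hc' : (0 : ℝ) < c := by exact_mod_cast hc
    rw [inv_mul_le_iff₀ (by positivity)]
    have h6 : (0 : ℝ) ≤ c * (e + 1) * ((t / c / (e + 1) : ℕ) + 1) := by positivity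
    linarith
  · have h1 := hup t
    rw [finrank_quotient_idealOfVars_pow] at h1
    have h2 := h1.trans (Nat.mul_le_mul_left r (card_degree_lt_le e t))
    exact_mod_cast h2

/-! ### Dimension inequalities from nearly exact sequences, and reading off a leading coefficient.
-/

section LinearAlgebra

variable {k T U V W : Type*} [Field k] [AddCommGroup T] [AddCommGroup U] [AddCommGroup V]
  [AddCommGroup W] [Module k T] [Module k U] [Module k V] [Module k W]

theorem finrank_le_add_of_ker_le_range [Module.Finite k U] [Module.Finite k V] [Module.Finite k W]
    (f : U →ₗ[k] V) (g : V →ₗ[k] W) (h : LinearMap.ker g ≤ LinearMap.range f) :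
    Module.finrank k V ≤ Module.finrank k U + Module.finrank k W := by
  rw [← LinearMap.finrank_range_add_finrank_ker g, add_comm]
  exact add_le_add ((Submodule.finrank_mono h).trans (LinearMap.finrank_range_le f))
    (Submodule.finrank_le _)

/-- The image of `e` lies in the kernel of `g` and maps onto `U`, so the kernel has dimension at
least that of `U`. All lower bounds for colengths below come from this count. -/
theorem finrank_add_le_of_ker_le [Module.Finite k V] (e : T →ₗ[k] V) (g : V →ₗ[k] W)
    (p : T →ₗ[k] U) (hg : Function.Surjective g) (hp : Function.Surjective p)
    (hge : ∀ x, g (e x) = 0) (hep : ∀ x, e x = 0 → p x = 0) :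
    Module.finrank k U + Module.finrank k W ≤ Module.finrank k V := by
  have h1 : Module.finrank k U ≤ Module.finrank k (LinearMap.range e) := by
    rw [← (e.quotKerEquivRange).finrank_eq]
    have : Module.Finite k (T ⧸ LinearMap.ker e) :=
      Module.Finite.equiv e.quotKerEquivRange.symm
    refine LinearMap.finrank_le_finrank_of_surjective
      (f := (LinearMap.ker e).liftQ p fun x hx => hep x (LinearMap.mem_ker.1 hx)) ?_
    intro u
    obtain ⟨x, rfl⟩ := hp u
    exact ⟨Submodule.Quotient.mk x, rfl⟩
  rw [← LinearMap.finrank_range_add_finrank_ker g, LinearMap.range_eq_top.2 hg, finrank_top,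
    add_comm]
  refine Nat.add_le_add_left (h1.trans (Submodule.finrank_mono ?_)) _
  rintro _ ⟨x, rfl⟩
  exact hge x

end LinearAlgebra

/-- The quotient by `t ^ d` would tend to zero if the degree were smaller and be unbounded if it
were larger; in equal degree it tends to the leading coefficient. The bound `0 < c` excludes the
first case. -/
theorem Polynomial.tendsto_eval_div_pow {P : Polynomial ℚ} {f : ℕ → ℕ} {d : ℕ} {c C : ℝ}
    (hc : 0 < c) (hP : ∀ᶠ t : ℕ in atTop, (f t : ℚ) = P.eval (t : ℚ))
    (hf : ∀ᶠ t : ℕ in atTop, c * t ^ d ≤ f t ∧ f t ≤ C * t ^ d) :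
    P.natDegree = d ∧ Tendsto (fun t : ℕ => (f t : ℝ) / t ^ d) atTop (𝓝 (P.leadingCoeff : ℝ)) := by
  set R := P.map (algebraMap ℚ ℝ) with hR
  have hPR : ∀ᶠ t : ℕ in atTop, (f t : ℝ) = R.eval (t : ℝ) := by
    filter_upwards [hP] with t ht
    have : (f t : ℝ) = ((f t : ℚ) : ℝ) := by simp
    rw [this, ht, hR, Polynomial.eval_map, ← Polynomial.aeval_def]
    have := Polynomial.aeval_algebraMap_apply ℝ (t : ℚ) P
    simp at this
    exact this.symm
  have hcast : Tendsto (fun t : ℕ => (t : ℝ)) atTop atTop := tendsto_natCast_atTop_atTop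
  have hfR : ∀ᶠ t : ℕ in atTop, c ≤ (fun x : ℝ => R.eval x / (Polynomial.X ^ d).eval x) t ∧
      (fun x : ℝ => R.eval x / (Polynomial.X ^ d).eval x) t ≤ C := by
    filter_upwards [hPR, hf, eventually_gt_atTop 0] with t h1 h2 h3
    have h4 : (0 : ℝ) < (t : ℝ) ^ d := by positivity
    simp only [Polynomial.eval_pow, Polynomial.eval_X, ← h1]
    rw [le_div_iff₀ h4, div_le_iff₀ h4]
    exact h2
  have hdeg : R.degree = (Polynomial.X ^ d : Polynomial ℝ).degree := by
    rcases lt_trichotomy R.degree (Polynomial.X ^ d : Polynomial ℝ).degree with h | h | h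
    · have h1 := (Polynomial.div_tendsto_atTop_zero_of_degree_lt R _ h).comp hcast
      exact absurd (ge_of_tendsto h1 (hfR.mono fun t ht => ht.1)) (not_le.2 hc)
    · exact h
    · have h1 := (Polynomial.abs_div_tendsto_atTop_atTop_of_degree_gt R _ h
        (pow_ne_zero _ Polynomial.X_ne_zero)).comp hcast
      obtain ⟨t, ht1, ht2⟩ := ((h1.eventually_gt_atTop C).and hfR).exists
      rw [Function.comp_apply, abs_of_nonneg (hc.le.trans ht2.1)] at ht1
      exact absurd ht2.2 (not_le.2 ht1)
  have hlead : R.leadingCoeff = (P.leadingCoeff : ℝ) := by simp [hR]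
  refine ⟨?_, ?_⟩
  · rw [← Polynomial.natDegree_map (algebraMap ℚ ℝ), ← hR,
      Polynomial.natDegree_eq_of_degree_eq hdeg, Polynomial.natDegree_X_pow]
  · have h2 := Polynomial.div_tendsto_atTop_leadingCoeff_div_of_degree_eq R _ hdeg
    simp only [Polynomial.leadingCoeff_X_pow, div_one, Polynomial.eval_pow,
      Polynomial.eval_X] at h2
    rw [← hlead]
    refine (h2.comp hcast).congr' ?_
    filter_upwards [hPR] with t ht
    simp [ht]

/-! ### Colengths in a domain and in a finite extension with nonzero conductor. -/

section Comparison

variable {k : Type u} {A B : Type u} [Field k] [CommRing A] [CommRing B] [Algebra k A]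
  [Algebra k B] [Algebra A B] [IsScalarTower k A B]

/-- Artin–Rees bound for the quotient by a nonzero element. -/
theorem exists_finrank_quotient_sup_add_le [IsDomain A] [Algebra.FiniteType k A] (ε : A →ₐ[k] k)
    {h : A} (hh : h ≠ 0) :
    ∃ c, ∀ t, c ≤ t →
      Module.finrank k (A ⧸ RingHom.ker ε ^ (t - c)) +
        Module.finrank k (A ⧸ (Ideal.span {h} ⊔ RingHom.ker ε ^ t)) ≤
      Module.finrank k (A ⧸ RingHom.ker ε ^ t) := by
  have hnoeth : IsNoetherianRing A := Algebra.FiniteType.isNoetherianRing k A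
  -- Artin–Rees for the ideal of `h`: if `h x` is in the `t`-th power, then `x` is in the power `t -
  -- c`. So multiplication by `h` followed by reduction has kernel inside that power.
  obtain ⟨c, hc⟩ := Ideal.exists_pow_inf_eq_pow_smul (RingHom.ker ε) (Ideal.span {h})
  refine ⟨c, fun t ht => ?_⟩
  have := finite_quotient_ker_pow ε t
  refine finrank_add_le_of_ker_le
    ((Ideal.Quotient.mkₐ k (RingHom.ker ε ^ t)).toLinearMap.comp (LinearMap.mulLeft k h))
    (Ideal.Quotient.factorₐ k (le_sup_right : RingHom.ker ε ^ t ≤ Ideal.span {h} ⊔ _)).toLinearMap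
    (Ideal.Quotient.mkₐ k (RingHom.ker ε ^ (t - c))).toLinearMap
    (Ideal.Quotient.factor_surjective le_sup_right) (Ideal.Quotient.mk_surjective) ?_ ?_
  · intro x
    change Ideal.Quotient.mk _ (h * x) = 0
    rw [Ideal.Quotient.eq_zero_iff_mem]
    exact Ideal.mem_sup_left (Ideal.mul_mem_right _ _ (Ideal.mem_span_singleton_self h))
  · intro x hx
    replace hx : Ideal.Quotient.mk _ (h * x) = 0 := hx
    change Ideal.Quotient.mk _ x = 0
    rw [Ideal.Quotient.eq_zero_iff_mem] at hx ⊢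
    have h1 : h * x ∈ RingHom.ker ε ^ t • (⊤ : Submodule A A) ⊓ Ideal.span {h} :=
      ⟨by simpa using hx, Ideal.mul_mem_right _ _ (Ideal.mem_span_singleton_self h)⟩
    rw [hc t ht] at h1
    have h2 := Submodule.smul_mono (le_refl (RingHom.ker ε ^ (t - c))) inf_le_right h1
    rw [smul_eq_mul, Ideal.mem_mul_span_singleton] at h2
    obtain ⟨z, hz, hz'⟩ := h2
    have : z = x := mul_left_cancel₀ hh (by rw [← hz', mul_comm])
    rwa [← this]

/-- The cokernel of `A ⧸ n → B ⧸ nB` is killed by `n` and, as `h B ⊆ A`, also by `h`; having `r`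
generators, it is bounded by `r` copies of `A ⧸ (h, n)`. -/
theorem finrank_map_pow_le {r : ℕ} (φ : (Fin r → A) →ₗ[A] B) (hφ : Function.Surjective φ)
    (n : Ideal A) [Module.Finite k (A ⧸ n)] {h : A}
    (hh : ∀ b : B, ∃ a : A, algebraMap A B a = h • b) :
    Module.Finite k (B ⧸ n.map (algebraMap A B)) ∧
    Module.finrank k (B ⧸ n.map (algebraMap A B)) ≤
      Module.finrank k (A ⧸ n) + r * Module.finrank k (A ⧸ (Ideal.span {h} ⊔ n)) := by
  have hW₁ : n • (⊤ : Submodule A B) ≤ (n.map (algebraMap A B)).restrictScalars A := by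
    rw [Submodule.smul_le]
    intro a ha b _
    rw [Algebra.smul_def]
    exact Ideal.mul_mem_right _ (n.map (algebraMap A B)) (Ideal.mem_map_of_mem _ ha)
  have hfin₁ : Module.Finite k (B ⧸ n.map (algebraMap A B)) :=
    (finrank_quotient_le_mul (k := k) φ hφ n _ hW₁).1
  refine ⟨hfin₁, ?_⟩
  have : Module.Finite k (A ⧸ (Ideal.span {h} ⊔ n)) :=
    Module.Finite.of_surjective
      (Ideal.Quotient.factorₐ k (le_sup_right : n ≤ Ideal.span {h} ⊔ n)).toLinearMap
      (Ideal.Quotient.factor_surjective le_sup_right)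
  set W : Submodule A B := LinearMap.range (Algebra.linearMap A B) ⊔
    (n.map (algebraMap A B)).restrictScalars A with hW
  have hle : (Ideal.span {h} ⊔ n) • (⊤ : Submodule A B) ≤ W := by
    rw [Submodule.sup_smul]
    refine sup_le ?_ (hW₁.trans le_sup_right)
    rw [Submodule.smul_le]
    intro a ha b _
    obtain ⟨a, rfl⟩ := Ideal.mem_span_singleton'.1 ha
    obtain ⟨a', ha'⟩ := hh b
    refine Submodule.mem_sup_left ⟨a * a', ?_⟩
    rw [Algebra.linearMap_apply, map_mul, ha', mul_smul, Algebra.smul_def a]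
  obtain ⟨h1, h2⟩ := finrank_quotient_le_mul (k := k) φ hφ _ W hle
  refine (finrank_le_add_of_ker_le_range (k := k) (W := B ⧸ W)
    (Ideal.quotientMapₐ (n.map (algebraMap A B)) (IsScalarTower.toAlgHom k A B)
      Ideal.le_comap_map).toLinearMap
    ((Submodule.mapQ ((n.map (algebraMap A B)).restrictScalars A) W LinearMap.id
      le_sup_right).restrictScalars k) ?_).trans (Nat.add_le_add_left h2 _)
  intro x hx
  obtain ⟨b, rfl⟩ := Ideal.Quotient.mk_surjective x
  replace hx : Submodule.Quotient.mk (p := W) b = 0 := hx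
  rw [Submodule.Quotient.mk_eq_zero, Submodule.mem_sup] at hx
  obtain ⟨_, ⟨a, rfl⟩, c, hc, rfl⟩ := hx
  refine ⟨Ideal.Quotient.mk _ a, ?_⟩
  change Ideal.Quotient.mk _ (algebraMap A B a) = _
  rw [eq_comm, Ideal.Quotient.eq, Algebra.linearMap_apply, add_sub_cancel_left]
  exact hc

/-- Multiplication by `h` carries `B` into `A` and `nB` into `n`. The induced map `B ⧸ nB → A ⧸ n`
has an image containing all multiples of `h`, so its cokernel is at most `A ⧸ (h, n)`. -/
theorem finrank_le_map_pow [FaithfulSMul A B] (n : Ideal A) [Module.Finite k (A ⧸ n)]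
    [Module.Finite k (B ⧸ n.map (algebraMap A B))] {h : A}
    (hh : ∀ b : B, ∃ a : A, algebraMap A B a = h • b) :
    Module.finrank k (A ⧸ n) ≤ Module.finrank k (B ⧸ n.map (algebraMap A B)) +
      Module.finrank k (A ⧸ (Ideal.span {h} ⊔ n)) := by
  have hinj := FaithfulSMul.algebraMap_injective A B
  choose m hm using hh
  let μ : B →ₗ[A] A :=
    { toFun := m
      map_add' := fun a b => hinj (by simp [hm])
      map_smul' := fun a b => hinj (by simp [hm, Algebra.smul_def a]) }
  have : Module.Finite k (A ⧸ (Ideal.span {h} ⊔ n)) :=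
    Module.Finite.of_surjective
      (Ideal.Quotient.factorₐ k (le_sup_right : n ≤ Ideal.span {h} ⊔ n)).toLinearMap
      (Ideal.Quotient.factor_surjective le_sup_right)
  have hμ : (n.map (algebraMap A B)).restrictScalars A ≤ Submodule.comap μ n := by
    rw [← Ideal.smul_top_eq_map, Submodule.smul_le]
    intro a ha b _
    rw [Submodule.mem_comap, map_smul]
    exact Ideal.mul_mem_right _ _ ha
  refine finrank_le_add_of_ker_le_range (k := k)
    ((Submodule.mapQ ((n.map (algebraMap A B)).restrictScalars A) n μ hμ).restrictScalars k)
    (Ideal.Quotient.factorₐ k (le_sup_right : n ≤ Ideal.span {h} ⊔ n)).toLinearMap ?_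
  intro x hx
  obtain ⟨a, rfl⟩ := Ideal.Quotient.mk_surjective x
  replace hx : Ideal.Quotient.mk (Ideal.span {h} ⊔ n) a = 0 := hx
  rw [Ideal.Quotient.eq_zero_iff_mem, Submodule.mem_sup] at hx
  obtain ⟨b, hb, c, hc, rfl⟩ := hx
  obtain ⟨b, rfl⟩ := Ideal.mem_span_singleton'.1 hb
  refine ⟨Submodule.Quotient.mk (algebraMap A B b), ?_⟩
  change Ideal.Quotient.mk n (m (algebraMap A B b)) = _
  have : m (algebraMap A B b) = b * h := hinj (by rw [hm, map_mul, Algebra.smul_def, mul_comm])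
  rw [this, eq_comm, Ideal.Quotient.eq, add_sub_cancel_left]
  exact hc

end Comparison

/-! ### The contribution of a second point over the same image. -/

section Points

variable {k : Type u} {B : Type u} [Field k] [CommRing B] [Algebra k B]

/-- Two distinct rational points contribute independently to the colength of an ideal. -/
theorem finrank_add_le_of_ne {ε ε' : B →ₐ[k] k} (hne : ε' ≠ ε) {I : Ideal B} {t : ℕ}
    [Module.Finite k (B ⧸ I)] (h : I ≤ RingHom.ker ε ^ t) (h' : I ≤ RingHom.ker ε' ^ t) :
    Module.finrank k (B ⧸ RingHom.ker ε' ^ t) + Module.finrank k (B ⧸ RingHom.ker ε ^ t) ≤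
      Module.finrank k (B ⧸ I) := by
  have hmax : ∀ η : B →ₐ[k] k, (RingHom.ker η).IsMaximal := fun η =>
    RingHom.ker_isMaximal_of_surjective _ (fun r => ⟨algebraMap k B r, by simp⟩)
  have := hmax ε
  have := hmax ε'
  have hker : RingHom.ker ε ≠ RingHom.ker ε' := by
    intro hker
    apply hne
    ext b
    have h1 : b - algebraMap k B (ε b) ∈ RingHom.ker ε := by simp [RingHom.mem_ker]
    rw [hker, RingHom.mem_ker] at h1
    simpa [sub_eq_zero] using h1
  have hcop : RingHom.ker ε ^ t ⊔ RingHom.ker ε' ^ t = ⊤ :=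
    Ideal.isCoprime_iff_sup_eq.1 (Ideal.isCoprime_of_isMaximal hker).pow
  -- The kernel of `B ⧸ I → B ⧸ RingHom.ker ε ^ t` is the image of `RingHom.ker ε ^ t`; by
  -- comaximality this power maps onto the quotient at the other point.
  refine finrank_add_le_of_ker_le
    ((Ideal.Quotient.mkₐ k I).toLinearMap.comp
      ((RingHom.ker ε ^ t).restrictScalars k).subtype)
    (Ideal.Quotient.factorₐ k h).toLinearMap
    ((Ideal.Quotient.mkₐ k (RingHom.ker ε' ^ t)).toLinearMap.comp
      ((RingHom.ker ε ^ t).restrictScalars k).subtype)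
    (Ideal.Quotient.factor_surjective h) ?_ ?_ ?_
  · intro b
    obtain ⟨b, rfl⟩ := Ideal.Quotient.mk_surjective b
    obtain ⟨x, hx, y, hy, rfl⟩ := Submodule.mem_sup.1 (hcop.ge (Submodule.mem_top (x := b)))
    refine ⟨⟨x, hx⟩, ?_⟩
    change Ideal.Quotient.mk _ x = Ideal.Quotient.mk _ (x + y)
    rw [eq_comm, Ideal.Quotient.eq, add_sub_cancel_left]
    exact hy
  · rintro ⟨x, hx⟩
    exact Ideal.Quotient.eq_zero_iff_mem.2 hx
  · rintro ⟨x, hx⟩ hx'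
    exact Ideal.Quotient.eq_zero_iff_mem.2 (h' (Ideal.Quotient.eq_zero_iff_mem.1 hx'))

end Points

/-! ### The contribution of a point of the blowing-up. -/

section BlowUp

variable {k : Type u} {B : Type u} [Field k] [CommRing B] [IsDomain B] [Algebra k B]

theorem monomialAt_smul {R : Type*} [CommRing R] {s : ℕ} (y : R) (x : Fin s → R)
    (α : Fin s →₀ ℕ) :
    monomialAt (fun i => y * x i) α = y ^ α.degree * monomialAt x α := by
  simp only [monomialAt]
  rw [Finsupp.prod_fintype _ _ (by simp), Finsupp.prod_fintype _ _ (by simp),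
    Finsupp.degree_eq_sum, ← Finset.prod_pow_eq_pow_sum, ← Finset.prod_mul_distrib]
  simp [mul_pow]

theorem map_monomialAt {R R' : Type*} [CommRing R] [CommRing R'] (f : R →+* R') {s : ℕ}
    (x : Fin s → R) (α : Fin s →₀ ℕ) :
    f (monomialAt x α) = monomialAt (fun i => f (x i)) α := by
  simp [monomialAt]

set_option maxHeartbeats 1000000 in
/-- If `y` is a nonzero element of the ideal `M = I + (y)` of a rational point of an affine domain
and no power `y ^ (N + 1)` lies in `I M ^ N + M ^ (N + 2)`, then the colength of `I ^ t` exceeds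
that of `M ^ t` by at least the Samuel function of a rational point of another affine
model, a chart of the blowing-up of `M`. -/
theorem exists_point_blowUp {s : ℕ} (x : Fin s → B) (y : B) (ε : B →ₐ[k] k)
    (hgen : Function.Surjective (MvPolynomial.aeval (R := k)
      (Fin.cons y x : Fin (s + 1) → B)))
    (hx : ∀ i, ε (x i) = 0) (hy : ε y = 0)
    (hN : ∀ N : ℕ, y ^ (N + 1) ∉
      Ideal.span (Set.range x) * RingHom.ker ε ^ N ⊔ RingHom.ker ε ^ (N + 2)) :
    ∃ (S : Subalgebra k (FractionRing B)) (η : S →ₐ[k] k), Algebra.FiniteType k S ∧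
      (∀ b : B, algebraMap B (FractionRing B) b ∈ S) ∧
      ∀ t, Module.Finite k (B ⧸ Ideal.span (Set.range x) ^ t) →
        Module.finrank k (S ⧸ RingHom.ker η ^ t) + Module.finrank k (B ⧸ RingHom.ker ε ^ t) ≤
          Module.finrank k (B ⧸ Ideal.span (Set.range x) ^ t) := by
  set K := FractionRing B
  set M := RingHom.ker ε with hM
  set I := Ideal.span (Set.range x) with hI
  have hIM : I ≤ M := Ideal.span_le.2 (by rintro _ ⟨i, rfl⟩; exact hx i)
  have hyM : y ∈ M := hy
  have hy0 : y ≠ 0 := by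
    rintro rfl
    exact hN 0 (by simp)
  have hyK : algebraMap B K y ≠ 0 := by
    rwa [Ne, FaithfulSMul.algebraMap_eq_zero_iff]
  -- The chart of the blowing-up of `M` on which `y` generates the extension of `M`: its ring is
  -- generated by `y` and the quotients `x i / y`.
  set z : Fin (s + 1) → K := Fin.cons (algebraMap B K y)
    (fun i => algebraMap B K (x i) / algebraMap B K y) with hz
  set S : Subalgebra k K := (MvPolynomial.aeval (R := k) z).range with hS
  have hzS : ∀ i, z i ∈ S := fun i => ⟨MvPolynomial.X i, by simp⟩
  set w : Fin (s + 1) → S := fun i => ⟨z i, hzS i⟩ with hw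
  have hwsurj : Function.Surjective (MvPolynomial.aeval (R := k) w) := by
    rintro ⟨_, p, rfl⟩
    refine ⟨p, Subtype.ext ?_⟩
    change S.val (MvPolynomial.aeval w p) = MvPolynomial.aeval z p
    rw [← AlgHom.comp_apply]
    congr 1
    exact MvPolynomial.algHom_ext fun i => by simp [hw]
  have hft : Algebra.FiniteType k S := Algebra.FiniteType.of_surjective _ hwsurj
  have hzx : ∀ i : Fin s, z i.succ * algebraMap B K y = algebraMap B K (x i) := by
    intro i
    simp [hz, div_mul_cancel₀ _ hyK]
  have hBS : ∀ b : B, algebraMap B K b ∈ S := by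
    intro b
    obtain ⟨p, rfl⟩ := hgen b
    have h1 : algebraMap B K (MvPolynomial.aeval (Fin.cons y x : Fin (s + 1) → B) p) =
        MvPolynomial.aeval (fun i => algebraMap B K ((Fin.cons y x : Fin (s + 1) → B) i)) p :=
      (MvPolynomial.aeval_algebraMap_apply K _ p).symm
    rw [h1]
    refine Subalgebra.mvPolynomial_aeval_coe S (fun i => ⟨_, ?_⟩) p ▸ Subtype.mem _
    refine Fin.cases ?_ (fun i => ?_) i
    · exact hzS 0
    · rw [Fin.cons_succ, ← hzx]
      exact S.mul_mem (hzS _) (hzS 0)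
  have hgM : Ideal.span (Set.range (Fin.cons y x : Fin (s + 1) → B)) = M :=
    span_range_eq_ker _ ε hgen (Fin.cases hy hx)
  -- Multiplying the chart coordinates by `y` gives `y * y` and the `x i`, all in `M`; unused
  -- factors `y` fill the degree up to `t`.
  have hmon : ∀ (α : Fin (s + 1) →₀ ℕ) (t : ℕ), α.degree ≤ t → ∃ m ∈ M ^ t,
      algebraMap B K m = algebraMap B K y ^ t * monomialAt z α := by
    intro α t ht
    set u : Fin (s + 1) → B := Fin.cons (y * y) x with hu
    have huz : ∀ i, algebraMap B K (u i) = algebraMap B K y * z i := by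
      refine Fin.cases ?_ fun i => ?_
      · simp [hu, hz]
      · rw [mul_comm, hzx, hu, Fin.cons_succ]
    have huM : Ideal.span (Set.range u) ≤ M := by
      rw [Ideal.span_le]
      rintro _ ⟨i, rfl⟩
      refine Fin.cases ?_ (fun i => ?_) i
      · exact Ideal.mul_mem_left _ _ hyM
      · exact hx i
    refine ⟨y ^ (t - α.degree) * monomialAt u α, ?_, ?_⟩
    · have h1 := Ideal.mul_mem_mul (Ideal.pow_mem_pow hyM (t - α.degree))
        (Ideal.pow_right_mono huM _ (monomialAt_mem_pow u α _ le_rfl))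
      rwa [← pow_add, Nat.sub_add_cancel ht] at h1
    · rw [map_mul, map_monomialAt]
      simp only [huz]
      rw [monomialAt_smul, map_pow, ← mul_assoc, ← pow_add, Nat.sub_add_cancel ht]
  have hpow : ∀ p : S, ∃ N, ∃ m ∈ M ^ N, algebraMap B K m = algebraMap B K y ^ N * (p : K) := by
    rintro ⟨_, p, rfl⟩
    let F : Submodule k K := (((M ^ p.totalDegree).restrictScalars k).map
      (IsScalarTower.toAlgHom k B K).toLinearMap).comap
        (LinearMap.mulLeft k (algebraMap B K y ^ p.totalDegree))
    have h1 : MvPolynomial.aeval z p ∈ F := by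
      rw [aeval_eq_sum_monomialAt]
      refine Submodule.sum_mem _ fun α hα => Submodule.smul_mem _ _ ?_
      exact hmon α _ (MvPolynomial.le_totalDegree hα)
    exact ⟨_, h1⟩
  -- After clearing denominators, a multiple of the coordinate `y` lands in `M ^ (N + 2)` and a
  -- multiple of `x i / y` in `I * M ^ N`. Applied to 1 this would contradict `hN`, so the chart
  -- coordinates generate a proper ideal.
  have hproper : ∀ p : S, p ∈ Ideal.span (Set.range w) → ∃ N, ∃ m ∈ I * M ^ N ⊔ M ^ (N + 2),
      algebraMap B K m = algebraMap B K y ^ (N + 1) * (p : K) := by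
    have hD : ∀ (N j : ℕ) (m : B), m ∈ I * M ^ N ⊔ M ^ (N + 2) →
        m * y ^ j ∈ I * M ^ (N + j) ⊔ M ^ (N + j + 2) := by
      intro N j m hm
      have h1 := Ideal.mul_mem_mul hm (Ideal.pow_mem_pow hyM j)
      rw [Ideal.sup_mul, mul_assoc, ← pow_add, ← pow_add] at h1
      rwa [show N + j + 2 = N + 2 + j by ring]
    suffices h : ∀ p ∈ Ideal.span (Set.range w), ∀ a : S, ∃ N, ∃ m ∈ I * M ^ N ⊔ M ^ (N + 2),
        algebraMap B K m = algebraMap B K y ^ (N + 1) * ((a * p : S) : K) by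
      intro p hp
      simpa using h p hp 1
    intro p hp
    induction hp using Submodule.span_induction with
    | zero => exact fun a => ⟨0, 0, zero_mem _, by simp⟩
    | add p q _ _ hp hq =>
      intro a
      obtain ⟨N, m, hm, h1⟩ := hp a
      obtain ⟨N', m', hm', h1'⟩ := hq a
      refine ⟨N + N', m * y ^ N' + m' * y ^ N, add_mem (hD N N' m hm) ?_, ?_⟩
      · rw [add_comm N N']
        exact hD N' N m' hm'
      · rw [map_add, map_mul, map_mul, h1, h1']
        simp only [mul_add, map_pow, Subalgebra.coe_add, Subalgebra.coe_mul]
        ring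
    | smul b p _ hp =>
      intro a
      rw [smul_eq_mul, ← mul_assoc]
      exact hp _
    | mem p hp =>
      obtain ⟨i, rfl⟩ := hp
      intro a
      obtain ⟨N, m, hm, h1⟩ := hpow a
      refine ⟨N, ?_⟩
      refine Fin.cases ?_ (fun i => ?_) i
      · refine ⟨y ^ 2 * m, Ideal.mem_sup_right ?_, ?_⟩
        · rw [add_comm N 2, pow_add]
          exact Ideal.mul_mem_mul (Ideal.pow_mem_pow hyM 2) hm
        · rw [map_mul, h1, map_pow]
          simp only [hw, hz, Fin.cons_zero, Subalgebra.coe_mul]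
          ring
      · refine ⟨x i * m, Ideal.mem_sup_left (Ideal.mul_mem_mul (Ideal.subset_span ⟨i, rfl⟩) hm), ?_⟩
        rw [map_mul, h1, ← hzx]
        simp only [hw, Subalgebra.coe_mul]
        ring
  have hne : Ideal.span (Set.range w) ≠ ⊤ := by
    intro h
    obtain ⟨N, m, hm, hm'⟩ := hproper 1 (h ▸ trivial)
    apply hN N
    have : m = y ^ (N + 1) := by
      apply IsFractionRing.injective B K
      rw [hm', map_pow]
      simp
    rwa [← this]
  obtain ⟨η, hη⟩ : ∃ η : S →ₐ[k] k, ∀ i, η (w i) = 0 := by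
    set P := Ideal.span (Set.range w) with hP
    have : Nontrivial (S ⧸ P) := Ideal.Quotient.nontrivial_iff.2 hne
    have hwP : ∀ i, Ideal.Quotient.mk P (w i) = 0 := fun i =>
      Ideal.Quotient.eq_zero_iff_mem.2 (Ideal.subset_span ⟨i, rfl⟩)
    have hbij : Function.Bijective (Algebra.ofId k (S ⧸ P)) := by
      refine ⟨(algebraMap k (S ⧸ P)).injective, fun b => ?_⟩
      obtain ⟨b, rfl⟩ := Ideal.Quotient.mk_surjective b
      obtain ⟨q, rfl⟩ := hwsurj b
      refine ⟨MvPolynomial.aeval (fun _ => 0) q, ?_⟩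
      have : (Algebra.ofId k (S ⧸ P)).comp (MvPolynomial.aeval (fun _ => 0)) =
          (Ideal.Quotient.mkₐ k P).comp (MvPolynomial.aeval w) :=
        MvPolynomial.algHom_ext fun i => by simp [hwP]
      exact DFunLike.congr_fun this q
    refine ⟨(AlgEquiv.ofBijective _ hbij).symm.toAlgHom.comp
      (Ideal.Quotient.mkₐ k P), fun i => ?_⟩
    simp [hwP]
  have hker : Ideal.span (Set.range w) = RingHom.ker η := span_range_eq_ker w η hwsurj hη
  refine ⟨S, η, hft, hBS, fun t hfin => ?_⟩
  let φ : B →+* S := (algebraMap B K).codRestrict S.toSubring hBS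
  have hφ : ∀ b, (φ b : K) = algebraMap B K b := fun b => rfl
  -- Used twice: `M S ⊆ y S` shows that `M ^ t / y ^ t` lies in `S`, and `I S ⊆ y (w)` shows that `I
  -- ^ t / y ^ t` lies in the `t`-th power of the ideal of the new point.
  have hmap : ∀ (J : Ideal B) (P : Ideal S), J.map φ ≤ Ideal.span {w 0} * P →
      ∀ m ∈ J ^ t, ∃ q ∈ P ^ t, (q : K) = algebraMap B K m / algebraMap B K y ^ t := by
    intro J P hJ m hm
    have h1 := Ideal.pow_right_mono hJ t (Ideal.map_pow φ J t ▸ Ideal.mem_map_of_mem φ hm)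
    rw [mul_pow, Ideal.span_singleton_pow, Ideal.mem_span_singleton_mul] at h1
    obtain ⟨q, hq, hq'⟩ := h1
    refine ⟨q, hq, ?_⟩
    rw [eq_div_iff (pow_ne_zero _ hyK), ← hφ m, ← hq']
    simp [hw, hz, mul_comm]
  have hφy : φ y = w 0 := rfl
  have hφx : ∀ i : Fin s, φ (x i) = w 0 * w i.succ := fun i => Subtype.ext (by
    rw [hφ, ← hzx, mul_comm]
    rfl)
  have hdiv : ∀ m ∈ M ^ t, algebraMap B K m / algebraMap B K y ^ t ∈ S := by
    intro m hm
    obtain ⟨q, -, hq⟩ := hmap M ⊤ (by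
      rw [← hgM, Ideal.map_span, Ideal.mul_top, Ideal.span_le]
      rintro _ ⟨_, ⟨i, rfl⟩, rfl⟩
      rw [SetLike.mem_coe, Ideal.mem_span_singleton]
      refine Fin.cases ?_ (fun i => ?_) i
      · rw [Fin.cons_zero, hφy]
      · rw [Fin.cons_succ, hφx]
        exact dvd_mul_right _ _) m hm
    rw [← hq]
    exact q.2
  let p : (M ^ t).restrictScalars k →ₗ[k] S :=
    { toFun := fun m => ⟨_, hdiv m.1 m.2⟩
      map_add' := fun a b => Subtype.ext (by simp [add_div])
      map_smul' := fun a b => Subtype.ext (by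
        change algebraMap B K (a • b.1) / _ = a • (_ / _)
        rw [Algebra.smul_def, map_mul, ← IsScalarTower.algebraMap_apply, Algebra.smul_def,
          mul_div_assoc]) }
  -- Division by `y ^ t` makes the quotient of `S` by the `t`-th power of the ideal of the point an
  -- image of `M ^ t / I ^ t`. It is onto because monomials of degree at most `t` come from `M ^ t`
  -- and the others lie in that power.
  refine finrank_add_le_of_ker_le
    ((Ideal.Quotient.mkₐ k (I ^ t)).toLinearMap.comp ((M ^ t).restrictScalars k).subtype)
    (Ideal.Quotient.factorₐ k (Ideal.pow_right_mono hIM t)).toLinearMap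
    ((Ideal.Quotient.mkₐ k (RingHom.ker η ^ t)).toLinearMap.comp p)
    (Ideal.Quotient.factor_surjective (Ideal.pow_right_mono hIM t)) ?_ ?_ ?_
  · intro b
    obtain ⟨b, rfl⟩ := Ideal.Quotient.mk_surjective b
    have h1 : b ∈ LinearMap.range p ⊔ (RingHom.ker η ^ t).restrictScalars k := by
      obtain ⟨q, rfl⟩ := hwsurj b
      rw [aeval_eq_sum_monomialAt]
      refine Submodule.sum_mem _ fun α _ => Submodule.smul_mem _ _ ?_
      rcases le_total α.degree t with h | h
      · obtain ⟨m, hm, hm'⟩ := hmon α t h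
        refine Submodule.mem_sup_left ⟨⟨m, hm⟩, Subtype.ext ?_⟩
        change algebraMap B K m / _ = S.val (monomialAt w α)
        rw [hm', mul_div_cancel_left₀ _ (pow_ne_zero _ hyK)]
        exact (map_monomialAt S.val.toRingHom w α).symm
      · refine Submodule.mem_sup_right ?_
        rw [← hker]
        exact monomialAt_mem_pow w α t h
    obtain ⟨_, ⟨m, rfl⟩, q, hq, rfl⟩ := Submodule.mem_sup.1 h1
    refine ⟨m, ?_⟩
    change Ideal.Quotient.mk _ (p m) = Ideal.Quotient.mk _ (p m + q)
    rw [eq_comm, Ideal.Quotient.eq, add_sub_cancel_left]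
    exact hq
  · rintro ⟨x, hx⟩
    exact Ideal.Quotient.eq_zero_iff_mem.2 hx
  · rintro ⟨m, hm⟩ hm'
    replace hm' : m ∈ I ^ t := Ideal.Quotient.eq_zero_iff_mem.1 hm'
    obtain ⟨q, hq, hq'⟩ := hmap I (Ideal.span (Set.range w)) (by
      rw [hI, Ideal.map_span, Ideal.span_le]
      rintro _ ⟨_, ⟨i, rfl⟩, rfl⟩
      rw [hφx]
      exact Ideal.mul_mem_mul (Ideal.mem_span_singleton_self _) (Ideal.subset_span ⟨_, rfl⟩)) m hm'
    have hpq : p ⟨m, hm⟩ = q := Subtype.ext hq'.symm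
    change Ideal.Quotient.mk _ (p ⟨m, hm⟩) = 0
    rw [hpq, Ideal.Quotient.eq_zero_iff_mem, ← hker]
    exact hq

end BlowUp

/-! ### Dimension of the chart and limits of shifted Samuel functions. -/

/-- Needed for the blowing-up chart: its Samuel function must grow with the same power of `t` as
that of `B`. -/
theorem trdeg_eq_of_le_fractionRing {k B : Type u} [Field k] [CommRing B] [IsDomain B]
    [Algebra k B] (S : Subalgebra k (FractionRing B))
    (hS : ∀ b : B, algebraMap B (FractionRing B) b ∈ S) :
    Algebra.trdeg k S = Algebra.trdeg k B := by
  have h1 : Algebra.trdeg k B = Algebra.trdeg k (FractionRing B) := by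
    have : Algebra.IsAlgebraic B (FractionRing B) := IsLocalization.isAlgebraic _ (nonZeroDivisors B)
    rw [← trdeg_add_eq k B (A := FractionRing B), trdeg_eq_zero (R := B), add_zero]
  apply le_antisymm
  · rw [h1]
    exact trdeg_le_of_injective S.val Subtype.val_injective
  · refine trdeg_le_of_injective
      ((IsScalarTower.toAlgHom k B (FractionRing B)).codRestrict S hS) fun a b hab => ?_
    exact IsFractionRing.injective B (FractionRing B) (congrArg Subtype.val hab)

/-- The shift changes the denominator only by the factor `(1 + N / t) ^ d`, which tends to 1. -/
theorem tendsto_shift_add {f : ℕ → ℕ} {d : ℕ} {β : ℝ}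
    (h : Tendsto (fun t : ℕ => (f t : ℝ) / t ^ d) atTop (𝓝 β)) (N : ℕ) :
    Tendsto (fun t : ℕ => (f (t + N) : ℝ) / t ^ d) atTop (𝓝 β) := by
  have h1 := h.comp (tendsto_add_atTop_nat N)
  have h2 : Tendsto (fun t : ℕ => (1 + (N : ℝ) / t) ^ d) atTop (𝓝 1) := by
    have := ((tendsto_const_div_atTop_nhds_zero_nat (N : ℝ)).const_add 1).pow d
    simpa using this
  have h3 := h1.mul h2
  rw [mul_one] at h3
  refine h3.congr' ?_
  filter_upwards [eventually_gt_atTop 0] with t ht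
  have ht' : (0 : ℝ) < t := by exact_mod_cast ht
  simp only [Function.comp_apply]
  push_cast
  rw [one_add_div ht'.ne', div_pow]
  field_simp

theorem tendsto_shift_sub {f : ℕ → ℕ} {d : ℕ} {β : ℝ}
    (h : Tendsto (fun t : ℕ => (f t : ℝ) / t ^ d) atTop (𝓝 β)) (c : ℕ) :
    Tendsto (fun t : ℕ => (f (t - c) : ℝ) / t ^ d) atTop (𝓝 β) := by
  rw [← tendsto_add_atTop_iff_nat c]
  have h2 : Tendsto (fun t : ℕ => ((1 + (c : ℝ) / t) ^ d)⁻¹) atTop (𝓝 1) := by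
    have := (((tendsto_const_div_atTop_nhds_zero_nat (c : ℝ)).const_add 1).pow d).inv₀ (by simp)
    simpa using this
  have h3 := h.mul h2
  rw [mul_one] at h3
  refine h3.congr' ?_
  filter_upwards [eventually_gt_atTop 0] with t ht
  have ht' : (0 : ℝ) < t := by exact_mod_cast ht
  rw [Nat.add_sub_cancel]
  push_cast
  rw [one_add_div ht'.ne', div_pow]
  field_simp

/-! ### The algebraic criterion for equality of multiplicities. -/

section Core

variable {k A B : Type u} [Field k] [CommRing A] [CommRing B] [Algebra k A]
  [Algebra k B] [Algebra A B] [IsScalarTower k A B]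

/-- If only one rational point of a finite extension lies over the point `εA`, the maximal ideal
of this point is nilpotent modulo the maximal ideal of `εA`. -/
theorem exists_pow_mem_map [IsAlgClosed k] [Module.Finite A B] (εA : A →ₐ[k] k) (εB : B →ₐ[k] k)
    (h : ∀ ε' : B →ₐ[k] k, (∀ a, ε' (algebraMap A B a) = εA a) → ε' = εB) (y : B)
    (hy : εB y = 0) : ∃ N, y ^ N ∈ (RingHom.ker εA).map (algebraMap A B) := by
  suffices hrad : y ∈ ((RingHom.ker εA).map (algebraMap A B)).radical from hrad
  rw [Ideal.radical_eq_sInf, Submodule.mem_sInf]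
  rintro q ⟨hq, hqp⟩
  have hmax : (RingHom.ker εA).IsMaximal :=
    RingHom.ker_isMaximal_of_surjective _ (fun r => ⟨algebraMap k A r, by simp⟩)
  -- Since `q` contains the maximal ideal of `εA`, the ring `B ⧸ q` is integral over the
  -- algebraically closed field `k` and equals it. Thus `q` is the kernel of a rational point over
  -- `εA`, which is `εB`.
  have hint : Algebra.IsIntegral k (B ⧸ q) := by
    refine ⟨fun b => ?_⟩
    obtain ⟨b, rfl⟩ := Ideal.Quotient.mk_surjective b
    obtain ⟨p, hp, hp'⟩ := Algebra.IsIntegral.isIntegral (R := A) b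
    refine ⟨p.map εA.toRingHom, hp.map _, ?_⟩
    rw [Polynomial.eval₂_map]
    have h1 : (algebraMap k (B ⧸ q)).comp εA.toRingHom =
        (Ideal.Quotient.mk q).comp (algebraMap A B) := by
      ext a
      have h2 : a - algebraMap k A (εA a) ∈ RingHom.ker εA := by simp [RingHom.mem_ker]
      have h3 := hq (Ideal.mem_map_of_mem (algebraMap A B) h2)
      rw [map_sub, ← IsScalarTower.algebraMap_apply] at h3
      exact (Ideal.Quotient.eq.2 h3).symm
    rw [h1, ← Polynomial.hom_eval₂, hp', map_zero]
  have hbij : Function.Bijective (Algebra.ofId k (B ⧸ q)) :=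
    IsAlgClosed.algebraMap_bijective_of_isIntegral
  set ε' : B →ₐ[k] k := (AlgEquiv.ofBijective _ hbij).symm.toAlgHom.comp (Ideal.Quotient.mkₐ k q)
    with hε'
  have hker : ∀ b, ε' b = 0 ↔ b ∈ q := fun b => by
    simp [hε', Ideal.Quotient.eq_zero_iff_mem]
  have := h ε' fun a => by
    have h2 : a - algebraMap k A (εA a) ∈ RingHom.ker εA := by simp [RingHom.mem_ker]
    have h3 := (hker _).2 (hq (Ideal.mem_map_of_mem (algebraMap A B) h2))
    rw [map_sub, ← IsScalarTower.algebraMap_apply, map_sub, AlgHom.commutes] at h3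
    simpa [sub_eq_zero] using h3
  rw [← hker, this, hy]

/-- Nakayama-type iteration: the reduction relation in the associated graded ring, together with
nilpotency, bounds the powers of `M`. -/
theorem pow_add_le_of_mem {I M : Ideal B} {y : B} (hM : M = I ⊔ Ideal.span {y}) {a N : ℕ}
    (ha : y ^ a ∈ I) (hN : y ^ (N + 1) ∈ I * M ^ N ⊔ M ^ (N + 2)) (t : ℕ) :
    M ^ (t + N) ≤ I ^ t := by
  have hIM : I ≤ M := hM ▸ le_sup_left
  have hstep : ∀ j, M ^ (j + 1) ≤ I * M ^ j ⊔ Ideal.span {y ^ (j + 1)} := by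
    intro j
    induction j with
    | zero => simp [hM]
    | succ j ih =>
      have h1 : M ^ (j + 1 + 1) = M ^ (j + 1) * M := pow_succ _ _
      have h2 : M ^ (j + 1) * M ≤ M ^ (j + 1) * I ⊔ M ^ (j + 1) * Ideal.span {y} := by
        conv_lhs => rw [hM, Ideal.mul_sup, ← hM]
      rw [h1]
      refine h2.trans (sup_le ?_ ?_)
      · rw [mul_comm]
        exact le_sup_left
      · refine (Ideal.mul_mono_left ih).trans ?_
        rw [Ideal.sup_mul, Ideal.span_singleton_mul_span_singleton, ← pow_succ]
        refine sup_le_sup_right ?_ _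
        rw [mul_assoc, pow_succ]
        exact Ideal.mul_mono_right (Ideal.mul_mono_right (hM ▸ le_sup_right))
  have h1 : M ^ (N + 1) ≤ I * M ^ N ⊔ M ^ (N + 2) :=
    (hstep N).trans (sup_le le_sup_left ((Ideal.span_singleton_le_iff_mem _).2 hN))
  -- Feeding the relation `h1` into its own error term pushes the error to arbitrarily high powers
  -- of `M`; for `j = a` it is absorbed because `M ^ (a + 1) ≤ I`.
  have h2 : ∀ j, M ^ (N + 1) ≤ I * M ^ N ⊔ M ^ (N + 1 + j) := by
    intro j
    induction j with
    | zero => exact le_sup_right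
    | succ j ih =>
      refine ih.trans (sup_le le_sup_left ?_)
      rw [pow_add]
      refine (Ideal.mul_mono_left h1).trans ?_
      rw [Ideal.sup_mul, ← pow_add, show N + 2 + j = N + 1 + (j + 1) by ring]
      exact sup_le_sup_right Ideal.mul_le_left _
  have h3 : M ^ (a + 1) ≤ I := by
    refine (hstep a).trans (sup_le Ideal.mul_le_left ?_)
    rw [Ideal.span_singleton_le_iff_mem, pow_succ]
    exact Ideal.mul_mem_right _ _ ha
  have h4 : M ^ (N + 1) ≤ I * M ^ N := by
    refine (h2 a).trans (sup_le le_rfl ?_)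
    rw [show N + 1 + a = (a + 1) + N by ring, pow_add]
    exact Ideal.mul_mono_left h3
  have h5 : ∀ t, M ^ (t + N) ≤ I ^ t * M ^ N := by
    intro t
    induction t with
    | zero => simp
    | succ t ih =>
      rw [show t + 1 + N = 1 + (t + N) by ring, pow_add, pow_one, pow_succ, mul_assoc]
      refine (Ideal.mul_mono_right ih).trans ?_
      rw [mul_left_comm, ← pow_succ']
      exact Ideal.mul_mono_right h4
  exact (h5 t).trans Ideal.mul_le_left

theorem Polynomial.factorial_mul_leadingCoeff_eq_iff {P R : Polynomial ℚ}
    (h : P.natDegree = R.natDegree) :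
    (P.natDegree.factorial : ℚ) * P.leadingCoeff = (R.natDegree.factorial : ℚ) * R.leadingCoeff ↔
      (P.leadingCoeff : ℝ) = R.leadingCoeff := by
  rw [h, mul_right_inj' (by positivity)]
  exact Rat.cast_inj.symm

variable [IsDomain A] [FaithfulSMul A B] [Module.Finite A B] [Algebra.FiniteType k A]

/-- The Samuel function of a point of an affine domain and of its extension to a finite birational
extension have the same growth. -/
theorem tendsto_finrank_map_pow [CharZero k] (εA : A →ₐ[k] k) {h : A} (hh : h ≠ 0)
    (hB : ∀ b : B, ∃ a : A, algebraMap A B a = h • b) {d : ℕ} {α : ℝ}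
    (hα : Tendsto (fun t : ℕ => (Module.finrank k (A ⧸ RingHom.ker εA ^ t) : ℝ) / t ^ d) atTop
      (𝓝 α)) :
    (∀ t, Module.Finite k (B ⧸ (RingHom.ker εA).map (algebraMap A B) ^ t)) ∧
    Tendsto (fun t : ℕ => (Module.finrank k (B ⧸ (RingHom.ker εA).map (algebraMap A B) ^ t) : ℝ) /
      t ^ d) atTop (𝓝 α) := by
  obtain ⟨r, φ, hφ⟩ := Module.Finite.exists_fin' A B
  have hfinA := finite_quotient_ker_pow εA
  have hup : ∀ t, Module.Finite k (B ⧸ (RingHom.ker εA).map (algebraMap A B) ^ t) ∧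
      Module.finrank k (B ⧸ (RingHom.ker εA).map (algebraMap A B) ^ t) ≤
        Module.finrank k (A ⧸ RingHom.ker εA ^ t) +
        r * Module.finrank k (A ⧸ (Ideal.span {h} ⊔ RingHom.ker εA ^ t)) := by
    intro t
    rw [← Ideal.map_pow]
    exact finrank_map_pow_le (k := k) φ hφ (RingHom.ker εA ^ t) hB
  have hfin := fun t => (hup t).1
  refine ⟨hfin, ?_⟩
  have hlow : ∀ t, Module.finrank k (A ⧸ RingHom.ker εA ^ t) ≤
      Module.finrank k (B ⧸ (RingHom.ker εA).map (algebraMap A B) ^ t) +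
      Module.finrank k (A ⧸ (Ideal.span {h} ⊔ RingHom.ker εA ^ t)) := by
    intro t
    have h1 := hfin t
    rw [← Ideal.map_pow] at h1 ⊢
    exact finrank_le_map_pow (k := k) (RingHom.ker εA ^ t) hB
  obtain ⟨c, hc⟩ := exists_finrank_quotient_sup_add_le εA hh
  -- The Artin–Rees bound compares this colength with the difference of the Samuel function at `t`
  -- and `t - c`, whose leading terms cancel.
  have hq : Tendsto (fun t : ℕ => (Module.finrank k (A ⧸ (Ideal.span {h} ⊔ RingHom.ker εA ^ t)) : ℝ)
      / t ^ d) atTop (𝓝 0) := by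
    have h1 := hα.sub (tendsto_shift_sub hα c)
    rw [sub_self] at h1
    refine tendsto_of_tendsto_of_tendsto_of_le_of_le' tendsto_const_nhds h1
      (Eventually.of_forall fun t => by positivity) ?_
    filter_upwards [eventually_ge_atTop c] with t ht
    have h2 : ((Module.finrank k (A ⧸ RingHom.ker εA ^ (t - c)) : ℝ) +
        Module.finrank k (A ⧸ (Ideal.span {h} ⊔ RingHom.ker εA ^ t))) ≤
      Module.finrank k (A ⧸ RingHom.ker εA ^ t) := by exact_mod_cast hc t ht
    rw [← sub_div]
    gcongr
    linarith
  have h1 := hα.sub hq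
  have h2 := hα.add (hq.const_mul (r : ℝ))
  rw [sub_zero] at h1
  rw [mul_zero, add_zero] at h2
  refine tendsto_of_tendsto_of_tendsto_of_le_of_le h1 h2 (fun t => ?_) (fun t => ?_)
  · have h3 : (Module.finrank k (A ⧸ RingHom.ker εA ^ t) : ℝ) ≤
      Module.finrank k (B ⧸ (RingHom.ker εA).map (algebraMap A B) ^ t) +
      Module.finrank k (A ⧸ (Ideal.span {h} ⊔ RingHom.ker εA ^ t)) := by exact_mod_cast hlow t
    dsimp only
    rw [← sub_div]
    gcongr
    linarith
  · have h3 : (Module.finrank k (B ⧸ (RingHom.ker εA).map (algebraMap A B) ^ t) : ℝ) ≤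
      Module.finrank k (A ⧸ RingHom.ker εA ^ t) +
      r * Module.finrank k (A ⧸ (Ideal.span {h} ⊔ RingHom.ker εA ^ t)) := by
      exact_mod_cast (hup t).2
    dsimp only
    rw [← mul_div_assoc, ← add_div]
    gcongr

/-- Both polynomials have the transcendence degree as degree, and the leading coefficient of `P` is
also that of the colengths of `I ^ t`. Hence the statement compares the ideals `I ≤ M = I + (y)`: a
second point or a point of the blowing-up makes the former colength larger to leading order, and
otherwise `M ^ (t + N) ≤ I ^ t` gives equality. -/
theorem samuel_leadingCoeff_eq_iff [IsDomain B] [CharZero k] [IsAlgClosed k] (εA : A →ₐ[k] k) (εB : B →ₐ[k] k)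
    (hε : ∀ a, εB (algebraMap A B a) = εA a) (y : B) (hy : εB y = 0)
    (hadj : Algebra.adjoin A {y} = ⊤) {h : A} (hh : h ≠ 0)
    (hB : ∀ b : B, ∃ a : A, algebraMap A B a = h • b) {P R : Polynomial ℚ}
    (hP : ∀ᶠ t : ℕ in atTop, (Module.finrank k (A ⧸ RingHom.ker εA ^ t) : ℚ) = P.eval (t : ℚ))
    (hR : ∀ᶠ t : ℕ in atTop, (Module.finrank k (B ⧸ RingHom.ker εB ^ t) : ℚ) = R.eval (t : ℚ)) :
    (P.natDegree.factorial : ℚ) * P.leadingCoeff = (R.natDegree.factorial : ℚ) * R.leadingCoeff ↔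
      (∀ ε' : B →ₐ[k] k, (∀ a, ε' (algebraMap A B a) = εA a) → ε' = εB) ∧
      ∃ N, y ^ (N + 1) ∈ (RingHom.ker εA).map (algebraMap A B) * RingHom.ker εB ^ N ⊔
        RingHom.ker εB ^ (N + 2) := by
  obtain ⟨s, x, hx, hxA⟩ := exists_generators_ker εA
  set x' : Fin s → B := fun i => algebraMap A B (x i) with hx'
  set I := (RingHom.ker εA).map (algebraMap A B) with hI
  have hIx : I = Ideal.span (Set.range x') := by
    rw [hI, ← hxA, Ideal.map_span, ← Set.range_comp]
    rfl
  have hgen : Function.Surjective (MvPolynomial.aeval (R := k)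
      (Fin.cons y x' : Fin (s + 1) → B)) := by
    have hA : ∀ a : A, algebraMap A B a ∈ (MvPolynomial.aeval (R := k)
        (Fin.cons y x' : Fin (s + 1) → B)).range := by
      intro a
      obtain ⟨p, rfl⟩ := hx a
      refine ⟨MvPolynomial.rename Fin.succ p, ?_⟩
      change MvPolynomial.aeval _ _ = _
      rw [MvPolynomial.aeval_rename, ← MvPolynomial.aeval_algebraMap_apply]
      rfl
    intro b
    have hb : b ∈ Algebra.adjoin A {y} := hadj ▸ trivial
    change b ∈ (MvPolynomial.aeval (R := k) (Fin.cons y x' : Fin (s + 1) → B)).range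
    induction hb using Algebra.adjoin_induction with
    | mem b hb =>
      rw [Set.mem_singleton_iff.1 hb]
      exact ⟨MvPolynomial.X 0, by simp⟩
    | algebraMap a => exact hA a
    | add a b _ _ ha hb => exact add_mem ha hb
    | mul a b _ _ ha hb => exact mul_mem ha hb
  have hx'0 : ∀ i, εB (x' i) = 0 := by
    intro i
    rw [hx', hε, ← RingHom.mem_ker, ← hxA]
    exact Ideal.subset_span ⟨i, rfl⟩
  have hIM : I ≤ RingHom.ker εB := by
    rw [hIx, Ideal.span_le]
    rintro _ ⟨i, rfl⟩
    exact hx'0 i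
  have hM : RingHom.ker εB = I ⊔ Ideal.span {y} := by
    rw [← span_range_eq_ker _ εB hgen (Fin.cases hy hx'0), hIx, Fin.range_cons, Ideal.span_insert,
      sup_comm]
  have hft : Algebra.FiniteType k B := Algebra.FiniteType.of_surjective _ hgen
  obtain ⟨d, hd⟩ : ∃ d : ℕ, Algebra.trdeg k A = d :=
    Cardinal.lt_aleph0.1 trdeg_lt_aleph0_of_finiteType
  have hdB : Algebra.trdeg k B = d := by
    rw [← hd, ← trdeg_add_eq k A (A := B), trdeg_eq_zero (R := A), add_zero]
  obtain ⟨cA, CA, hcA, hgA⟩ := samuel_growth εA hd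
  obtain ⟨cB, CB, hcB, hgB⟩ := samuel_growth εB hdB
  obtain ⟨hPd, hPt⟩ := Polynomial.tendsto_eval_div_pow hcA hP hgA
  obtain ⟨hRd, hRt⟩ := Polynomial.tendsto_eval_div_pow hcB hR hgB
  rw [Polynomial.factorial_mul_leadingCoeff_eq_iff (hPd.trans hRd.symm)]
  obtain ⟨hfinB, hHt⟩ := tendsto_finrank_map_pow εA hh hB hPt
  rw [← hI] at hfinB hHt
  -- Any extra summand that is the Samuel function of a `d`-dimensional affine domain contributes at
  -- least `c t ^ d` with `c > 0`, hence separates the leading coefficients.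
  have hstrict : ∀ (S : Type u) [CommRing S] [IsDomain S] [Algebra k S] [Algebra.FiniteType k S]
      (η : S →ₐ[k] k), Algebra.trdeg k S = d →
      (∀ t, Module.finrank k (S ⧸ RingHom.ker η ^ t) +
        Module.finrank k (B ⧸ RingHom.ker εB ^ t) ≤ Module.finrank k (B ⧸ I ^ t)) →
      (P.leadingCoeff : ℝ) ≠ R.leadingCoeff := by
    intro S _ _ _ _ η hS hle
    obtain ⟨c, C, hc, hg⟩ := samuel_growth η hS
    refine ne_of_gt (lt_of_lt_of_le (lt_add_of_pos_left _ hc)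
      (le_of_tendsto_of_tendsto (hRt.const_add c) hHt ?_))
    filter_upwards [hg, eventually_gt_atTop 0] with t ht ht0
    have h1 : (0 : ℝ) < (t : ℝ) ^ d := by positivity
    rw [le_div_iff₀ h1, add_mul, div_mul_cancel₀ _ h1.ne']
    have h2 : ((Module.finrank k (S ⧸ RingHom.ker η ^ t) : ℝ) +
        Module.finrank k (B ⧸ RingHom.ker εB ^ t)) ≤ Module.finrank k (B ⧸ I ^ t) := by
      exact_mod_cast hle t
    linarith [ht.1]
  constructor
  · intro heq
    by_contra hcon
    rw [not_and_or] at hcon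
    rcases hcon with hcon | hcon
    · push Not at hcon
      obtain ⟨ε', hε', hne⟩ := hcon
      refine hstrict B ε' hdB (fun t => finrank_add_le_of_ne hne (Ideal.pow_right_mono hIM t)
        (Ideal.pow_right_mono ?_ t)) heq
      rw [hI, Ideal.map_le_iff_le_comap]
      intro a ha
      rw [Ideal.mem_comap, RingHom.mem_ker, hε']
      exact ha
    · push Not at hcon
      obtain ⟨S, η, hS, hBS, hle⟩ := exists_point_blowUp x' y εB hgen hx'0 hy (hIx ▸ hcon)
      rw [← hIx] at hle
      exact hstrict S η ((trdeg_eq_of_le_fractionRing S hBS).trans hdB)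
        (fun t => hle t (hfinB t)) heq
  · rintro ⟨h1, N, h2⟩
    obtain ⟨a, ha⟩ := exists_pow_mem_map εA εB h1 y hy
    have h3 := pow_add_le_of_mem hM ha h2
    have hfinM := finite_quotient_ker_pow εB
    apply le_antisymm
    · have h4 : Tendsto (fun t : ℕ => (Module.finrank k (B ⧸ RingHom.ker εB ^ (t + N)) : ℝ) /
          t ^ d) atTop (𝓝 R.leadingCoeff) :=
        tendsto_shift_add hRt N
      refine le_of_tendsto_of_tendsto hHt h4 (Eventually.of_forall fun t => ?_)
      have := finrank_quotient_le_of_le (k := k) (h3 t)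
      dsimp only
      gcongr
    · refine le_of_tendsto_of_tendsto hRt hHt (Eventually.of_forall fun t => ?_)
      have := finrank_quotient_le_of_le (k := k) (Ideal.pow_right_mono hIM t)
      dsimp only
      gcongr

end Core

/-! ### Length over a ring as dimension over the ground field. -/

/-- Elements of `D` act through their values under `ε`, so both rings have the same submodules. -/
theorem Module.length_eq_length_of_annihilated {k D : Type*} [Field k] [CommRing D] [Algebra k D]
    (ε : D →ₐ[k] k) (N : Type*) [AddCommGroup N] [Module D N] [Module k N] [IsScalarTower k D N]
    (h : ∀ d : D, ε d = 0 → ∀ x : N, d • x = 0) : Module.length D N = Module.length k N := by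
  let : Algebra D k := ε.toRingHom.toAlgebra
  have hsm (d : D) (x : N) : d • x = ε d • x := by
    have h0 := h (d - algebraMap k D (ε d)) (by simp) x
    rwa [sub_smul, algebraMap_smul, sub_eq_zero] at h0
  have : IsScalarTower D k N := ⟨fun d c x => by
    rw [hsm, Algebra.smul_def, mul_smul]
    rfl⟩
  exact Module.length_eq_of_surjective fun c => ⟨algebraMap k D c, by
    change ε (algebraMap k D c) = c
    simp⟩

/-- Induction on `t` along the filtration by powers of `RingHom.ker ε`: the top quotient is
annihilated by the kernel, and length is additive over both rings. -/
theorem Module.length_eq_length_of_pow_smul {k D : Type*} [Field k] [CommRing D] [Algebra k D]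
    (ε : D →ₐ[k] k) (t : ℕ) : ∀ (N : Type u) [AddCommGroup N] [Module D N] [Module k N]
    [IsScalarTower k D N], (RingHom.ker ε ^ t • (⊤ : Submodule D N) = ⊥) →
    Module.length D N = Module.length k N := by
  induction t with
  | zero =>
    intro N _ _ _ _ h
    have : Subsingleton N := by
      rw [← Submodule.subsingleton_iff D, ← subsingleton_iff_bot_eq_top]
      simpa using h.symm
    rw [Module.length_eq_zero, Module.length_eq_zero]
  | succ t ih =>
    intro N _ _ _ _ h
    set N' : Submodule D N := RingHom.ker ε • ⊤ with hN'
    have e1 := Module.length_eq_add_of_exact N'.subtype N'.mkQ N'.injective_subtype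
      N'.mkQ_surjective (LinearMap.exact_subtype_mkQ N')
    have e2 := Module.length_eq_add_of_exact (N'.subtype.restrictScalars k)
      (N'.mkQ.restrictScalars k) N'.injective_subtype
      N'.mkQ_surjective (LinearMap.exact_subtype_mkQ N')
    rw [e1, e2]
    congr 1
    · refine ih N' ?_
      apply Submodule.map_injective_of_injective N'.injective_subtype
      rw [Submodule.map_smul'', Submodule.map_top, Submodule.range_subtype, Submodule.map_bot,
        hN', ← mul_smul, ← pow_succ, h]
    · refine Module.length_eq_length_of_annihilated ε _ fun d hd x => ?_
      induction x using Submodule.Quotient.induction_on with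
      | _ x =>
        rw [← Submodule.Quotient.mk_smul, Submodule.Quotient.mk_eq_zero]
        exact Submodule.smul_mem_smul hd trivial

/-- The length of the quotient of a ring by the kernel of a surjection onto an algebra over a
field with nilpotent augmentation ideal is the dimension of the algebra. -/
theorem Module.length_quotient_eq_finrank {k L : Type*} {D : Type u} [Field k] [CommRing D]
    [Algebra k D] [CommRing L] [Module.Finite k D] (ε : D →ₐ[k] k) (t : ℕ)
    (ht : RingHom.ker ε ^ t = ⊥) (ψ : L →+* D) (hψ : Function.Surjective ψ) {I : Ideal L}
    (hI : RingHom.ker ψ = I) : Module.length L (L ⧸ I) = Module.finrank k D := by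
  let : Algebra L D := ψ.toAlgebra
  subst hI
  have e : (L ⧸ RingHom.ker ψ) ≃ₗ[L] D :=
    LinearMap.quotKerEquivOfSurjective (Algebra.linearMap L D) hψ
  rw [e.length_eq, Module.length_eq_of_surjective (R := D) hψ,
    Module.length_eq_length_of_pow_smul ε t D (by rw [ht, Submodule.bot_smul]),
    Module.length_eq_finrank]

/-! ### Homogeneous components and homogenization by a linear form. -/

theorem MvPolynomial.IsHomogeneous.aeval_mul_left {σ k S : Type*} [CommSemiring k] [CommSemiring S]
    [Algebra k S] {f : MvPolynomial σ k} {d : ℕ} (hf : f.IsHomogeneous d) (c : S) (x : σ → S) :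
    MvPolynomial.aeval (fun i => c * x i) f = c ^ d * MvPolynomial.aeval x f := by
  simp only [MvPolynomial.aeval_def, MvPolynomial.eval₂_eq, Finset.mul_sum]
  refine Finset.sum_congr rfl fun α hα => ?_
  rw [hf.degree_eq_sum_deg_support hα]
  simp only [mul_pow, Finset.prod_mul_distrib, Finset.prod_pow_eq_pow_sum]
  ring

theorem MvPolynomial.IsHomogeneous.eval_smul {σ k : Type*} [CommSemiring k]
    {f : MvPolynomial σ k} {d : ℕ} (hf : f.IsHomogeneous d) (c : k) (v : σ → k) :
    MvPolynomial.eval (c • v) f = c ^ d * MvPolynomial.eval v f :=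
  hf.aeval_mul_left c v

theorem MvPolynomial.homogeneousComponent_mul_of_isHomogeneous {σ k : Type*} [CommSemiring k]
    (f : MvPolynomial σ k) {g : MvPolynomial σ k} {d : ℕ} (hg : g.IsHomogeneous d) (j : ℕ) :
    MvPolynomial.homogeneousComponent (j + d) (f * g) =
      MvPolynomial.homogeneousComponent j f * g := by
  conv_lhs => rw [← MvPolynomial.sum_homogeneousComponent f]
  rw [Finset.sum_mul, map_sum]
  have h (i : ℕ) : MvPolynomial.homogeneousComponent (j + d)
      (MvPolynomial.homogeneousComponent i f * g) =
      if j = i then MvPolynomial.homogeneousComponent i f * g else 0 := by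
    rw [MvPolynomial.homogeneousComponent_of_mem
      ((MvPolynomial.homogeneousComponent_isHomogeneous i f).mul hg)]
    simp only [add_left_inj]
  simp only [h]
  rw [Finset.sum_ite_eq]
  split_ifs with hj
  · rfl
  · rw [MvPolynomial.homogeneousComponent_eq_zero, zero_mul]
    simpa using hj

/-- Homogenization: each component is multiplied by the missing power of `ℓ`, which is congruent to
1. -/
theorem MvPolynomial.exists_isHomogeneous_sub_mem {σ k : Type*} [CommRing k]
    {ℓ : MvPolynomial σ k} (hℓ : ℓ.IsHomogeneous 1) (f : MvPolynomial σ k) :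
    ∃ F, F.IsHomogeneous f.totalDegree ∧ F - f ∈ Ideal.span {ℓ - 1} := by
  refine ⟨∑ i ∈ Finset.range (f.totalDegree + 1),
    MvPolynomial.homogeneousComponent i f * ℓ ^ (f.totalDegree - i), ?_, ?_⟩
  · refine MvPolynomial.IsHomogeneous.sum _ _ _ fun i hi => ?_
    have := (MvPolynomial.homogeneousComponent_isHomogeneous i f).mul
      (hℓ.pow (f.totalDegree - i))
    rwa [one_mul, Nat.add_sub_cancel' (Nat.lt_succ_iff.mp (Finset.mem_range.mp hi))] at this
  · suffices h : (∑ i ∈ Finset.range (f.totalDegree + 1),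
        MvPolynomial.homogeneousComponent i f * ℓ ^ (f.totalDegree - i)) -
        ∑ i ∈ Finset.range (f.totalDegree + 1), MvPolynomial.homogeneousComponent i f ∈
        Ideal.span {ℓ - 1} by rwa [MvPolynomial.sum_homogeneousComponent] at h
    rw [← Finset.sum_sub_distrib]
    refine Ideal.sum_mem _ fun i _ => ?_
    rw [← mul_sub_one]
    exact Ideal.mul_mem_left _ _ (Ideal.mem_span_singleton.mpr (sub_one_dvd_pow_sub_one ℓ _))

/-- Along the line spanned by `v` the polynomial is a polynomial in `t` with the values of the
components as coefficients; it has infinitely many zeros. -/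
theorem MvPolynomial.eval_homogeneousComponent_eq_zero {σ k : Type*} [Field k] [Infinite k]
    {f : MvPolynomial σ k} {v : σ → k} (h : ∀ t : k, t ≠ 0 → MvPolynomial.eval (t • v) f = 0)
    (j : ℕ) : MvPolynomial.eval v (MvPolynomial.homogeneousComponent j f) = 0 := by
  by_cases hj : f.totalDegree < j
  · rw [MvPolynomial.homogeneousComponent_eq_zero _ _ hj, map_zero]
  let ρ : Polynomial k := ∑ i ∈ Finset.range (f.totalDegree + 1),
    Polynomial.monomial i (MvPolynomial.eval v (MvPolynomial.homogeneousComponent i f))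
  have key (t : k) : ρ.eval t = MvPolynomial.eval (t • v) f := by
    conv_rhs => rw [← MvPolynomial.sum_homogeneousComponent f, map_sum]
    rw [Polynomial.eval_finsetSum]
    refine Finset.sum_congr rfl fun i _ => ?_
    rw [(MvPolynomial.homogeneousComponent_isHomogeneous i f).eval_smul,
      Polynomial.eval_monomial, mul_comm]
  have hρ : ρ = 0 := by
    refine Polynomial.eq_zero_of_infinite_isRoot _ ?_
    refine Set.Infinite.mono (s := {t : k | t ≠ 0}) (fun t ht => ?_)
      (Set.finite_singleton (0 : k)).infinite_compl
    exact (key t).trans (h t ht)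
  have hc := congrArg (fun p => Polynomial.coeff p j) hρ
  simp only [ρ, Polynomial.finsetSum_coeff, Polynomial.coeff_monomial, Polynomial.coeff_zero,
    Finset.sum_ite_eq', Finset.mem_range] at hc
  rwa [if_pos (by omega)] at hc

/-! ### Affine charts of a projective set as slices of its cone. -/

namespace ProjMult

attribute [local instance] MvPolynomial.gradedAlgebra

variable {n : ℕ}

theorem mem_homIdeal {X : Set (PSpace n)} {f : Coord n} : f ∈ homIdeal X ↔
    ∀ v (h : v ≠ 0), Projectivization.mk ℂ v h ∈ X → MvPolynomial.eval v f = 0 := by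
  constructor
  · intro hf v h hv
    exact hf v ⟨h, hv⟩
  · rintro hf v ⟨h, hv⟩
    exact hf v h hv

theorem mk_smul_eq {v : Fin n → ℂ} (hv : v ≠ 0) {c : ℂ} (hc : c • v ≠ 0) :
    Projectivization.mk ℂ (c • v) hc = Projectivization.mk ℂ v hv := by
  rw [Projectivization.mk_eq_mk_iff']
  exact ⟨c, rfl⟩

theorem homogeneousComponent_mem_homIdeal {X : Set (PSpace n)} {f : Coord n}
    (hf : f ∈ homIdeal X) (j : ℕ) : MvPolynomial.homogeneousComponent j f ∈ homIdeal X := by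
  rw [mem_homIdeal] at hf ⊢
  intro v h hv
  refine MvPolynomial.eval_homogeneousComponent_eq_zero (fun t ht => ?_) j
  have ht' : t • v ≠ 0 := smul_ne_zero ht h
  exact hf _ ht' (by rwa [mk_smul_eq h ht'])

theorem mem_homIdeal_singleton_iff {v : Fin n → ℂ} (hv : v ≠ 0) {f : Coord n} {d : ℕ}
    (hf : f.IsHomogeneous d) :
    f ∈ homIdeal {Projectivization.mk ℂ v hv} ↔ MvPolynomial.eval v f = 0 := by
  rw [mem_homIdeal]
  constructor
  · intro h
    exact h v hv rfl
  · intro h w hw hwv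
    rw [Set.mem_singleton_iff, Projectivization.mk_eq_mk_iff'] at hwv
    obtain ⟨t, rfl⟩ := hwv
    rw [hf.eval_smul, h, mul_zero]

/-- The affine chart of the cone over `X` cut out by `ℓ = 1`. -/
def slice (X : Set (PSpace n)) (ℓ : Coord n) : Set (Fin n → ℂ) :=
  {v | MvPolynomial.eval v ℓ = 1 ∧ ∃ h : v ≠ 0, Projectivization.mk ℂ v h ∈ X}

/-- The ideal of the affine chart `ℓ = 1`. -/
noncomputable def sliceIdeal (X : Set (PSpace n)) (ℓ : Coord n) : Ideal (Coord n) :=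
  MvPolynomial.vanishingIdeal ℂ (slice X ℓ)

theorem mem_sliceIdeal {X : Set (PSpace n)} {ℓ f : Coord n} : f ∈ sliceIdeal X ℓ ↔
    ∀ v ∈ slice X ℓ, MvPolynomial.eval v f = 0 := Iff.rfl

theorem homIdeal_le_sliceIdeal (X : Set (PSpace n)) (ℓ : Coord n) :
    homIdeal X ≤ sliceIdeal X ℓ := fun _ hf v hv => hf v hv.2

theorem sub_one_mem_sliceIdeal (X : Set (PSpace n)) (ℓ : Coord n) : ℓ - 1 ∈ sliceIdeal X ℓ :=
  fun v hv => by
    change MvPolynomial.eval v (ℓ - 1) = 0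
    rw [map_sub, hv.1, map_one, sub_self]

theorem span_sub_one_le_sliceIdeal (X : Set (PSpace n)) (ℓ : Coord n) :
    Ideal.span {ℓ - 1} ≤ sliceIdeal X ℓ := by
  rw [Ideal.span_singleton_le_iff_mem]
  exact sub_one_mem_sliceIdeal X ℓ

/-- Where `ℓ` does not vanish, a point of the cone can be rescaled into the slice; the factor `ℓ`
takes care of the other points. -/
theorem mul_mem_homIdeal_of_mem_sliceIdeal {X : Set (PSpace n)} {ℓ F : Coord n} {d : ℕ}
    (hℓ : ℓ.IsHomogeneous 1) (hF : F.IsHomogeneous d) (h : F ∈ sliceIdeal X ℓ) :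
    ℓ * F ∈ homIdeal X := by
  rw [mem_homIdeal]
  intro v hv hvX
  rw [map_mul, mul_eq_zero, or_iff_not_imp_left]
  intro hℓv
  have hne : (MvPolynomial.eval v ℓ)⁻¹ • v ≠ 0 := smul_ne_zero (inv_ne_zero hℓv) hv
  have := h ((MvPolynomial.eval v ℓ)⁻¹ • v) ⟨by
    rw [hℓ.eval_smul, pow_one, inv_mul_cancel₀ hℓv], hne, by rwa [mk_smul_eq hv hne]⟩
  change MvPolynomial.eval _ F = 0 at this
  rw [hF.eval_smul] at this
  exact (mul_eq_zero.mp this).resolve_left (pow_ne_zero _ (inv_ne_zero hℓv))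

end ProjMult

/-! ### The local ring of projective space and its dehomogenization. -/

namespace ProjMult

attribute [local instance] MvPolynomial.gradedAlgebra

open HomogeneousLocalization

variable {n : ℕ}

/-- The numerators and denominators of elements of `AmbientLocalRing`. -/
abbrev Fraction (x : PSpace n) : Type :=
  NumDenSameDeg (MvPolynomial.homogeneousSubmodule (Fin n) ℂ) (homIdeal {x}).primeCompl

theorem eval_den_ne_zero {v : Fin n → ℂ} {hv : v ≠ 0}
    (c : Fraction (Projectivization.mk ℂ v hv)) : MvPolynomial.eval v (c.den : Coord n) ≠ 0 :=
  fun h => c.den_mem ((mem_homIdeal_singleton_iff hv c.den.2).mpr h)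

/-- Evaluation of fractions in an algebra in which the forms not vanishing at a given point
become invertible. -/
theorem exists_ringHom_ambientLocalRing {v : Fin n → ℂ} {hv : v ≠ 0} {D : Type*} [CommRing D]
    [Algebra ℂ D] (π : Coord n →ₐ[ℂ] D)
    (hπ : ∀ f, MvPolynomial.eval v f ≠ 0 → IsUnit (π f)) :
    ∃ ψ : AmbientLocalRing (Projectivization.mk ℂ v hv) →+* D,
      ∀ c : Fraction (Projectivization.mk ℂ v hv),
        ψ (HomogeneousLocalization.mk c) * π c.den = π c.num := by
  -- The definition uses a chosen numerator and denominator; `key` shows independence of the choice,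
  -- and the ring laws follow by cancelling the units `π c.den`.
  let ψ : AmbientLocalRing (Projectivization.mk ℂ v hv) → D :=
    fun z => π z.num * Ring.inverse (π z.den)
  have hu (c : Fraction (Projectivization.mk ℂ v hv)) : IsUnit (π (c.den : Coord n)) :=
    hπ _ (eval_den_ne_zero c)
  have key (c : Fraction (Projectivization.mk ℂ v hv)) :
      ψ (HomogeneousLocalization.mk c) * π c.den = π c.num := by
    have h1 := (HomogeneousLocalization.mk c).eq_num_div_den
    rw [HomogeneousLocalization.val_mk, Localization.mk_eq_mk_iff,
      Localization.r_iff_exists] at h1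
    obtain ⟨⟨u, hu'⟩, h1⟩ := h1
    have hu0 : u ≠ 0 := fun h => hu' (h ▸ Ideal.zero_mem _)
    have h2 := mul_left_cancel₀ hu0 h1
    have h3 := congrArg π h2
    simp only [map_mul] at h3
    have hd : IsUnit (π (HomogeneousLocalization.mk c).den) :=
      hu (Quotient.out (HomogeneousLocalization.mk c))
    change π _ * Ring.inverse (π _) * _ = _
    have hi := Ring.inverse_mul_cancel _ hd
    rw [← hd.mul_left_inj]
    linear_combination π (HomogeneousLocalization.mk c).num * π c.den * hi - h3
  refine ⟨⟨⟨⟨ψ, ?_⟩, ?_⟩, ?_, ?_⟩, key⟩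
  · have := key 1
    simpa using this
  · intro z w
    obtain ⟨c, rfl⟩ := HomogeneousLocalization.mk_surjective z
    obtain ⟨d, rfl⟩ := HomogeneousLocalization.mk_surjective w
    have h1 := key (c * d)
    rw [NumDenSameDeg.den_mul, NumDenSameDeg.num_mul, map_mul, map_mul] at h1
    change ψ (HomogeneousLocalization.mk (c * d)) = _
    rw [← (hu c).mul_left_inj, ← (hu d).mul_left_inj, mul_assoc, h1, ← key c, ← key d]
    ring
  · have := key 0
    simpa using this
  · intro z w
    obtain ⟨c, rfl⟩ := HomogeneousLocalization.mk_surjective z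
    obtain ⟨d, rfl⟩ := HomogeneousLocalization.mk_surjective w
    have h1 := key (c + d)
    rw [NumDenSameDeg.den_add, NumDenSameDeg.num_add, map_add, map_mul, map_mul, map_mul] at h1
    change ψ (HomogeneousLocalization.mk (c + d)) = ψ _ + ψ _
    rw [← (hu c).mul_left_inj, ← (hu d).mul_left_inj, mul_assoc, h1, ← key c, ← key d]
    ring

/-- Evaluation at `v` maps the local ring onto the field `ℂ`, so its kernel is the maximal ideal. -/
theorem mk_mem_maximalIdeal_iff {v : Fin n → ℂ} {hv : v ≠ 0}
    (c : Fraction (Projectivization.mk ℂ v hv)) :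
    (HomogeneousLocalization.mk c : AmbientLocalRing (Projectivization.mk ℂ v hv)) ∈
      IsLocalRing.maximalIdeal (AmbientLocalRing (Projectivization.mk ℂ v hv)) ↔
      MvPolynomial.eval v (c.num : Coord n) = 0 := by
  obtain ⟨ψ, hψ⟩ := exists_ringHom_ambientLocalRing (v := v) (hv := hv)
    (MvPolynomial.aeval v : Coord n →ₐ[ℂ] ℂ) (fun f hf => by
      rw [MvPolynomial.aeval_eq_eval]
      exact isUnit_iff_ne_zero.mpr hf)
  have hsurj : Function.Surjective ψ := fun z => ⟨HomogeneousLocalization.mk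
    ⟨0, ⟨MvPolynomial.C z, MvPolynomial.isHomogeneous_C _ _⟩,
      ⟨1, MvPolynomial.isHomogeneous_one _ _⟩, Submonoid.one_mem _⟩, by
    have := hψ ⟨0, ⟨MvPolynomial.C z, MvPolynomial.isHomogeneous_C _ _⟩,
      ⟨1, MvPolynomial.isHomogeneous_one _ _⟩, Submonoid.one_mem _⟩
    simpa using this⟩
  rw [← IsLocalRing.ker_eq_maximalIdeal ψ hsurj, RingHom.mem_ker]
  have h := hψ c
  have hd := eval_den_ne_zero c
  rw [MvPolynomial.aeval_eq_eval] at h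
  change _ * MvPolynomial.eval v (c.den : Coord n) = MvPolynomial.eval v (c.num : Coord n) at h
  rw [← h, mul_eq_zero, or_iff_left hd]

/-- Membership in the localized ideal provides a multiplier outside the prime of the point. One of
its homogeneous components is nonzero at `v`, and it serves as well since the numerator is a form
and the ideal of `X` is homogeneous. -/
theorem exists_mul_num_mem_of_mem_localIdeal {X : Set (PSpace n)} {v : Fin n → ℂ} {hv : v ≠ 0}
    {c : Fraction (Projectivization.mk ℂ v hv)}
    (hc : HomogeneousLocalization.mk c ∈ localIdeal X (Projectivization.mk ℂ v hv)) :
    ∃ s : Coord n, MvPolynomial.eval v s ≠ 0 ∧ s * c.num ∈ homIdeal X := by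
  rw [localIdeal, Ideal.mem_comap, HomogeneousLocalization.algebraMap_apply,
    HomogeneousLocalization.val_mk, Localization.mk_eq_mk'] at hc
  rw [IsLocalization.mk'_mem_map_algebraMap_iff] at hc
  obtain ⟨s, hs, hsc⟩ := hc
  have hs' : s ∉ homIdeal {Projectivization.mk ℂ v hv} := hs
  obtain ⟨j, hj⟩ : ∃ j, MvPolynomial.eval v (MvPolynomial.homogeneousComponent j s) ≠ 0 := by
    by_contra! hcon
    apply hs'
    rw [← MvPolynomial.sum_homogeneousComponent s]
    exact Ideal.sum_mem _ fun i _ => (mem_homIdeal_singleton_iff hv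
      (MvPolynomial.homogeneousComponent_isHomogeneous i s)).mpr (hcon i)
  refine ⟨_, hj, ?_⟩
  rw [← MvPolynomial.homogeneousComponent_mul_of_isHomogeneous s c.num.2]
  exact homogeneousComponent_mem_homIdeal hsc _


/-- Dehomogenization with respect to a linear form: a polynomial `f` is mapped to `f / ℓ ^ d`
when it is homogeneous of degree `d`. -/
theorem exists_dehomogenization {v : Fin n → ℂ} {hv : v ≠ 0} {ℓ : Coord n}
    (hℓ : ℓ.IsHomogeneous 1) (hℓv : MvPolynomial.eval v ℓ = 1) :
    ∃ θ : Coord n →+* AmbientLocalRing (Projectivization.mk ℂ v hv),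
      (∀ (f : Coord n) (d : ℕ), f.IsHomogeneous d →
        algebraMap (Coord n) (Localization.AtPrime (homIdeal {Projectivization.mk ℂ v hv})) ℓ ^ d *
          (θ f).val = algebraMap _ _ f) ∧
      ∀ (D : Type) [CommRing D] [Algebra ℂ D] (π : Coord n →ₐ[ℂ] D)
        (ψ : AmbientLocalRing (Projectivization.mk ℂ v hv) →+* D), π ℓ = 1 →
        (∀ c : Fraction (Projectivization.mk ℂ v hv),
          ψ (HomogeneousLocalization.mk c) * π c.den = π c.num) → ∀ f, ψ (θ f) = π f := by
  have hmem : ℓ ∈ (homIdeal {Projectivization.mk ℂ v hv}).primeCompl := fun h => by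
    have h' := (mem_homIdeal_singleton_iff hv hℓ).mp h
    rw [hℓv] at h'
    exact one_ne_zero h'
  let cst (z : ℂ) : Fraction (Projectivization.mk ℂ v hv) :=
    ⟨0, ⟨MvPolynomial.C z, MvPolynomial.isHomogeneous_C _ _⟩,
      ⟨1, MvPolynomial.isHomogeneous_one _ _⟩, Submonoid.one_mem _⟩
  let co (i : Fin n) : Fraction (Projectivization.mk ℂ v hv) :=
    ⟨1, ⟨MvPolynomial.X i, MvPolynomial.isHomogeneous_X _ _⟩, ⟨ℓ, hℓ⟩, hmem⟩
  let θ : Coord n →+* AmbientLocalRing (Projectivization.mk ℂ v hv) := MvPolynomial.eval₂Hom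
    ((HomogeneousLocalization.fromZeroRingHom
      (MvPolynomial.homogeneousSubmodule (Fin n) ℂ) _).comp (algebraMap ℂ _))
    (fun i => HomogeneousLocalization.mk (co i))
  have hθC (z : ℂ) : θ (MvPolynomial.C z) = HomogeneousLocalization.mk (cst z) :=
    MvPolynomial.eval₂Hom_C _ _ _
  have hθX (i : Fin n) : θ (MvPolynomial.X i) = HomogeneousLocalization.mk (co i) :=
    MvPolynomial.eval₂Hom_X' _ _ _
  refine ⟨θ, fun f d hf => ?_, fun D _ _ π ψ hπ hψ f => ?_⟩
  · let r := IsLocalization.mk' (Localization.AtPrime (homIdeal {Projectivization.mk ℂ v hv}))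
      (1 : Coord n) ⟨ℓ, hmem⟩
    have hr : algebraMap (Coord n) (Localization.AtPrime (homIdeal {Projectivization.mk ℂ v hv})) ℓ
        * r = 1 := by
      have := IsLocalization.mk'_spec' (Localization.AtPrime
        (homIdeal {Projectivization.mk ℂ v hv})) (1 : Coord n)
        (⟨ℓ, hmem⟩ : (homIdeal {Projectivization.mk ℂ v hv}).primeCompl)
      rwa [map_one] at this
    have hval : (θ f).val = MvPolynomial.aeval (fun i => r *
        algebraMap (Coord n) (Localization.AtPrime (homIdeal {Projectivization.mk ℂ v hv}))
          (MvPolynomial.X i)) f := by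
      refine DFunLike.congr_fun (f := (algebraMap (AmbientLocalRing _) _).comp θ)
        (g := (MvPolynomial.aeval _).toRingHom) (MvPolynomial.ringHom_ext ?_ ?_) f
      · intro z
        rw [RingHom.comp_apply, hθC, HomogeneousLocalization.algebraMap_apply,
          HomogeneousLocalization.val_mk]
        change _ = MvPolynomial.aeval _ (MvPolynomial.C z)
        rw [MvPolynomial.aeval_C]
        change Localization.mk (MvPolynomial.C z) 1 = _
        rw [Localization.mk_one_eq_algebraMap]
        rfl
      · intro i
        rw [RingHom.comp_apply, hθX, HomogeneousLocalization.algebraMap_apply,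
          HomogeneousLocalization.val_mk]
        change _ = MvPolynomial.aeval _ (MvPolynomial.X i)
        rw [MvPolynomial.aeval_X, Localization.mk_eq_mk', mul_comm,
          IsLocalization.mul_mk'_eq_mk'_of_mul, mul_one]
    rw [hval, hf.aeval_mul_left, ← mul_assoc, ← mul_pow, hr, one_pow, one_mul]
    have : MvPolynomial.aeval (fun i => algebraMap (Coord n)
        (Localization.AtPrime (homIdeal {Projectivization.mk ℂ v hv})) (MvPolynomial.X i)) f =
        algebraMap (Coord n) _ (MvPolynomial.aeval MvPolynomial.X f) :=
      MvPolynomial.aeval_algebraMap_apply _ _ _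
    rw [this, MvPolynomial.aeval_X_left_apply]
  · refine DFunLike.congr_fun (f := ψ.comp θ) (g := π.toRingHom)
      (MvPolynomial.ringHom_ext ?_ ?_) f
    · intro z
      have := hψ (cst z)
      change _ * π 1 = π (MvPolynomial.C z) at this
      rwa [map_one, mul_one, ← hθC] at this
    · intro i
      have := hψ (co i)
      change _ * π ℓ = π (MvPolynomial.X i) at this
      rwa [hπ, mul_one, ← hθX] at this

end ProjMult

/-! ### Multiplicity computed in an affine chart. -/

namespace ProjMult

attribute [local instance] MvPolynomial.gradedAlgebra

variable {n : ℕ}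

/-- The quotient of the local ring of projective space by the ideal of `X` and a power of the
maximal ideal is computed in an affine chart. -/
theorem exists_surjective_ambientLocalRing (X : Set (PSpace n)) {v : Fin n → ℂ} {hv : v ≠ 0}
    {ℓ : Coord n} (hℓ : ℓ.IsHomogeneous 1) (hℓv : MvPolynomial.eval v ℓ = 1) {D : Type}
    [CommRing D] [Algebra ℂ D] (π : Coord n →ₐ[ℂ] D) (hπ : Function.Surjective π) (t : ℕ)
    (hker : RingHom.ker π = sliceIdeal X ℓ ⊔ RingHom.ker (MvPolynomial.eval v) ^ t) :
    ∃ ψ : AmbientLocalRing (Projectivization.mk ℂ v hv) →+* D, Function.Surjective ψ ∧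
      RingHom.ker ψ = localIdeal X (Projectivization.mk ℂ v hv) ⊔
        IsLocalRing.maximalIdeal (AmbientLocalRing (Projectivization.mk ℂ v hv)) ^ t := by
  have hu (f : Coord n) (hf : MvPolynomial.eval v f ≠ 0) : IsUnit (π f) := by
    -- In `D` a polynomial is its value at `v` plus a nilpotent element, hence a unit when the value
    -- is nonzero; this lets `π` extend to the local ring.
    have hnil : IsNilpotent (π (f - MvPolynomial.C (MvPolynomial.eval v f))) := by
      refine ⟨t, ?_⟩
      rw [← map_pow, ← RingHom.mem_ker, hker]
      refine Ideal.mem_sup_right (Ideal.pow_mem_pow ?_ t)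
      rw [RingHom.mem_ker, map_sub, MvPolynomial.eval_C, sub_self]
    have hunit : IsUnit (π (MvPolynomial.C (MvPolynomial.eval v f))) :=
      ((isUnit_iff_ne_zero.mpr hf).map MvPolynomial.C).map π
    have := hnil.isUnit_add_left_of_commute hunit (Commute.all _ _)
    rwa [← map_add, add_sub_cancel] at this
  have hπℓ : π ℓ = 1 := by
    rw [← sub_eq_zero, ← map_one π, ← map_sub, ← RingHom.mem_ker, hker]
    exact Ideal.mem_sup_left (sub_one_mem_sliceIdeal X ℓ)
  obtain ⟨ψ, hψ⟩ := exists_ringHom_ambientLocalRing (hv := hv) π hu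
  obtain ⟨θ, hθ, hθψ⟩ := exists_dehomogenization (hv := hv) hℓ hℓv
  have hθD := hθψ D π ψ hπℓ hψ
  refine ⟨ψ, fun d => ?_, le_antisymm ?_ (sup_le ?_ ?_)⟩
  · obtain ⟨f, rfl⟩ := hπ d
    exact ⟨θ f, hθD f⟩
  · have hθ1 : (RingHom.ker (MvPolynomial.eval v)).map θ ≤
        IsLocalRing.maximalIdeal (AmbientLocalRing (Projectivization.mk ℂ v hv)) := by
      rw [Ideal.map_le_iff_le_comap]
      intro f hf
      rw [Ideal.mem_comap]
      obtain ⟨ψ₀, hψ₀⟩ := exists_ringHom_ambientLocalRing (v := v) (hv := hv)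
        (MvPolynomial.aeval v : Coord n →ₐ[ℂ] ℂ) (fun f hf => isUnit_iff_ne_zero.mpr hf)
      have h1 := hθψ ℂ (MvPolynomial.aeval v) ψ₀ hℓv hψ₀
      have hsurj : Function.Surjective ψ₀ := fun z => ⟨θ (MvPolynomial.C z), by
        rw [h1, MvPolynomial.aeval_C]
        rfl⟩
      rw [← IsLocalRing.ker_eq_maximalIdeal ψ₀ hsurj, RingHom.mem_ker, h1]
      exact hf
    -- Since `θ ℓ = 1`, an element of the chart ideal may be replaced by `ℓ` times its
    -- homogenization, which lies in the homogeneous ideal of `X`.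
    have hθ2 : (sliceIdeal X ℓ).map θ ≤ localIdeal X (Projectivization.mk ℂ v hv) := by
      rw [Ideal.map_le_iff_le_comap]
      intro f hf
      obtain ⟨F, hF, hFf⟩ := MvPolynomial.exists_isHomogeneous_sub_mem hℓ f
      have hθℓ : θ ℓ = 1 := by
        have hmem : ℓ ∈ (homIdeal {Projectivization.mk ℂ v hv}).primeCompl := fun h => by
          have h' := (mem_homIdeal_singleton_iff hv hℓ).mp h
          rw [hℓv] at h'
          exact one_ne_zero h'
        apply HomogeneousLocalization.val_injective
        have := hθ ℓ 1 hℓ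
        rw [pow_one] at this
        rw [HomogeneousLocalization.val_one]
        exact (IsLocalization.map_units (Localization.AtPrime
          (homIdeal {Projectivization.mk ℂ v hv}))
          (⟨ℓ, hmem⟩ : (homIdeal {Projectivization.mk ℂ v hv}).primeCompl)).mul_left_cancel
          (this.trans (mul_one _).symm)
      have hθF : θ f = θ (ℓ * F) := by
        rw [map_mul, hθℓ, one_mul, eq_comm, ← sub_eq_zero, ← map_sub]
        obtain ⟨g, hg⟩ := Ideal.mem_span_singleton.mp hFf
        rw [hg, map_mul, map_sub, hθℓ, map_one, sub_self, zero_mul]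
      have hFJ : F ∈ sliceIdeal X ℓ := by
        have := Ideal.add_mem _ (span_sub_one_le_sliceIdeal X ℓ hFf) hf
        rwa [sub_add_cancel] at this
      have hmemX := mul_mem_homIdeal_of_mem_sliceIdeal hℓ hF hFJ
      rw [Ideal.mem_comap, hθF, localIdeal, Ideal.mem_comap,
        HomogeneousLocalization.algebraMap_apply]
      have hunit : IsUnit (algebraMap (Coord n)
          (Localization.AtPrime (homIdeal {Projectivization.mk ℂ v hv})) ℓ ^
          (1 + f.totalDegree)) := by
        refine IsUnit.pow _ (IsLocalization.map_units (Localization.AtPrime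
          (homIdeal {Projectivization.mk ℂ v hv}))
          (⟨ℓ, fun h => ?_⟩ : (homIdeal {Projectivization.mk ℂ v hv}).primeCompl))
        have h' := (mem_homIdeal_singleton_iff hv hℓ).mp h
        rw [hℓv] at h'
        exact one_ne_zero h'
      rw [← Ideal.unit_mul_mem_iff_mem _ hunit, hθ _ _ (hℓ.mul hF)]
      exact Ideal.mem_map_of_mem _ hmemX
    intro z hz
    obtain ⟨c, rfl⟩ := HomogeneousLocalization.mk_surjective z
    have h0 : π c.num = 0 := by
      rw [← hψ c, (RingHom.mem_ker).mp hz, zero_mul]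
    rw [← RingHom.mem_ker, hker] at h0
    have h1 := Ideal.mem_map_of_mem θ h0
    rw [Ideal.map_sup, Ideal.map_pow] at h1
    have h2 := sup_le_sup hθ2 (Ideal.pow_right_mono hθ1 t) h1
    -- A fraction is `ℓ ^ deg / den` times the dehomogenization `num / ℓ ^ deg` of its numerator.
    have hmem : ∃ e : AmbientLocalRing (Projectivization.mk ℂ v hv),
        HomogeneousLocalization.mk c = e * θ c.num := by
      refine ⟨HomogeneousLocalization.mk ⟨c.deg, ⟨ℓ ^ c.deg, ?_⟩, c.den, c.den_mem⟩, ?_⟩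
      · have := hℓ.pow c.deg
        rwa [one_mul] at this
      · apply HomogeneousLocalization.val_injective
        rw [HomogeneousLocalization.val_mul, HomogeneousLocalization.val_mk,
          HomogeneousLocalization.val_mk, Localization.mk_eq_mk']
        have hgen (a b : Coord n) (s : (homIdeal {Projectivization.mk ℂ v hv}).primeCompl)
            (w : Localization.AtPrime (homIdeal {Projectivization.mk ℂ v hv}))
            (h : algebraMap _ _ b * w = algebraMap _ _ a) :
            IsLocalization.mk' (Localization.AtPrime (homIdeal {Projectivization.mk ℂ v hv})) a s =
              IsLocalization.mk' _ b s * w := by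
          rw [IsLocalization.mk'_eq_mul_mk'_one, ← h, mul_right_comm,
            ← IsLocalization.mk'_eq_mul_mk'_one]
        refine hgen _ _ _ _ ?_
        rw [← hθ _ _ c.num.2, map_pow]
    obtain ⟨e, he⟩ := hmem
    rw [he]
    exact Ideal.mul_mem_left _ _ h2
  · intro z hz
    obtain ⟨c, rfl⟩ := HomogeneousLocalization.mk_surjective z
    obtain ⟨s, hs, hsc⟩ := exists_mul_num_mem_of_mem_localIdeal hz
    have h1 : π (s * c.num) = 0 := by
      rw [← RingHom.mem_ker, hker]
      exact Ideal.mem_sup_left (homIdeal_le_sliceIdeal X ℓ hsc)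
    rw [map_mul, (hu s hs).mul_right_eq_zero] at h1
    have h2 := hψ c
    rw [h1, (hu _ (eval_den_ne_zero c)).mul_left_eq_zero] at h2
    exact h2
  · have hm : (IsLocalRing.maximalIdeal (AmbientLocalRing (Projectivization.mk ℂ v hv))).map ψ ≤
        (RingHom.ker (MvPolynomial.eval v)).map π := by
      rw [Ideal.map_le_iff_le_comap]
      intro z hz
      obtain ⟨c, rfl⟩ := HomogeneousLocalization.mk_surjective z
      rw [mk_mem_maximalIdeal_iff] at hz
      rw [Ideal.mem_comap, ← Ideal.mul_unit_mem_iff_mem _ (hu _ (eval_den_ne_zero c)), hψ]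
      exact Ideal.mem_map_of_mem π hz
    intro z hz
    have h1 := Ideal.mem_map_of_mem ψ hz
    rw [Ideal.map_pow] at h1
    have h2 := Ideal.pow_right_mono hm t h1
    rw [← Ideal.map_pow] at h2
    have h3 : (RingHom.ker (MvPolynomial.eval v) ^ t).map π = ⊥ := by
      rw [eq_bot_iff, Ideal.map_le_iff_le_comap]
      intro f hf
      have : f ∈ RingHom.ker π := by
        rw [hker]
        exact Ideal.mem_sup_right hf
      exact this
    rw [h3] at h2
    exact h2

theorem length_localRingAt_quotient (X : Set (PSpace n)) {v : Fin n → ℂ} {hv : v ≠ 0}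
    {ℓ : Coord n} (hℓ : ℓ.IsHomogeneous 1) (hℓv : MvPolynomial.eval v ℓ = 1) {D : Type}
    [CommRing D] [Algebra ℂ D] [Module.Finite ℂ D] (π : Coord n →ₐ[ℂ] D)
    (hπ : Function.Surjective π) (t : ℕ)
    (hker : RingHom.ker π = sliceIdeal X ℓ ⊔ RingHom.ker (MvPolynomial.eval v) ^ t)
    (ε : D →ₐ[ℂ] ℂ) (hε : RingHom.ker ε ^ t = ⊥) :
    Module.length (LocalRingAt X (Projectivization.mk ℂ v hv))
      (LocalRingAt X (Projectivization.mk ℂ v hv) ⧸ maxIdealAt X (Projectivization.mk ℂ v hv) ^ t) =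
      Module.finrank ℂ D := by
  obtain ⟨ψ, hψ, hψker⟩ := exists_surjective_ambientLocalRing X (hv := hv) hℓ hℓv π hπ t hker
  have hle : localIdeal X (Projectivization.mk ℂ v hv) ≤ RingHom.ker ψ := hψker ▸ le_sup_left
  let ψ' : LocalRingAt X (Projectivization.mk ℂ v hv) →+* D := Ideal.Quotient.lift _ ψ hle
  have hψ' : Function.Surjective ψ' := Ideal.Quotient.lift_surjective_of_surjective _ hle hψ
  have hψ'ker : RingHom.ker ψ' = maxIdealAt X (Projectivization.mk ℂ v hv) ^ t := by
    rw [Ideal.ker_quotient_lift, hψker, Ideal.map_sup, Ideal.map_pow, Ideal.map_quotient_self,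
      bot_sup_eq, maxIdealAt]
  exact Module.length_quotient_eq_finrank ε t hε ψ' hψ' hψ'ker

theorem _root_.Ideal.ker_liftₐ_pow_eq_bot {k B : Type*} [Field k] [CommRing B] [Algebra k B]
    (ε : B →ₐ[k] k) (t : ℕ) (h : ∀ b ∈ RingHom.ker ε ^ t, ε b = 0) :
    RingHom.ker (Ideal.Quotient.liftₐ (RingHom.ker ε ^ t) ε h) ^ t = ⊥ := by
  have : RingHom.ker (Ideal.Quotient.liftₐ (RingHom.ker ε ^ t) ε h) =
      (RingHom.ker ε).map (Ideal.Quotient.mk (RingHom.ker ε ^ t)) := by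
    apply le_antisymm
    · intro b hb
      obtain ⟨f, rfl⟩ := Ideal.Quotient.mk_surjective b
      exact Ideal.mem_map_of_mem _ hb
    · rw [Ideal.map_le_iff_le_comap]
      intro f hf
      exact hf
  rw [this, ← Ideal.map_pow, Ideal.map_quotient_self]

theorem _root_.MvPolynomial.ker_mkₐ_comp_mkₐ {σ k : Type*} [Field k]
    (J p : Ideal (MvPolynomial σ k)) (M : Ideal (MvPolynomial σ k ⧸ J)) (hM : M = p.map (Ideal.Quotient.mk J)) (t : ℕ) :
    RingHom.ker ((Ideal.Quotient.mkₐ k (M ^ t)).comp (Ideal.Quotient.mkₐ k J)) = J ⊔ p ^ t := by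
  have : RingHom.ker ((Ideal.Quotient.mkₐ k (M ^ t)).comp (Ideal.Quotient.mkₐ k J)) =
      (M ^ t).comap (Ideal.Quotient.mk J) := by
    ext f
    rw [RingHom.mem_ker, Ideal.mem_comap, ← Ideal.Quotient.eq_zero_iff_mem]
    rfl
  rw [this, hM, ← Ideal.map_pow, Ideal.comap_map_of_surjective _
    Ideal.Quotient.mk_surjective, ← RingHom.ker_eq_comap_bot, Ideal.mk_ker, sup_comm]

/-- The lengths defining the multiplicity are the dimensions of the quotients of the chart ring by
powers of the point's ideal, so `mult` becomes a statement on affine algebras. -/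
theorem mult_eq_of_eventually {X : Set (PSpace n)} {v : Fin n → ℂ} {hv : v ≠ 0}
    {ℓ : Coord n} (hℓ : ℓ.IsHomogeneous 1) (hℓv : MvPolynomial.eval v ℓ = 1)
    (ε : (Coord n ⧸ sliceIdeal X ℓ) →ₐ[ℂ] ℂ)
    (hε : ∀ f, ε (Ideal.Quotient.mk _ f) = MvPolynomial.eval v f) {P : Polynomial ℚ}
    (hP : ∀ᶠ t : ℕ in atTop, (Module.finrank ℂ ((Coord n ⧸ sliceIdeal X ℓ) ⧸
      RingHom.ker ε ^ t) : ℚ) = P.eval (t : ℚ)) :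
    mult X (Projectivization.mk ℂ v hv) = (P.natDegree.factorial : ℚ) * P.leadingCoeff := by
  have hkerε : RingHom.ker ε = (RingHom.ker (MvPolynomial.eval v)).map
      (Ideal.Quotient.mk (sliceIdeal X ℓ)) := by
    apply le_antisymm
    · intro b hb
      obtain ⟨f, rfl⟩ := Ideal.Quotient.mk_surjective b
      refine Ideal.mem_map_of_mem _ ?_
      rw [RingHom.mem_ker, ← hε]
      exact hb
    · rw [Ideal.map_le_iff_le_comap]
      intro f hf
      exact (hε f).trans hf
  have hlen (t : ℕ) (ht : t ≠ 0) : Module.length (LocalRingAt X (Projectivization.mk ℂ v hv))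
      (LocalRingAt X (Projectivization.mk ℂ v hv) ⧸ maxIdealAt X (Projectivization.mk ℂ v hv) ^ t) =
      Module.finrank ℂ ((Coord n ⧸ sliceIdeal X ℓ) ⧸ RingHom.ker ε ^ t) := by
    have := finite_quotient_ker_pow ε t
    have hk := MvPolynomial.ker_mkₐ_comp_mkₐ (k := ℂ) (sliceIdeal X ℓ) (RingHom.ker (MvPolynomial.eval v))
      (RingHom.ker ε) hkerε t
    have hs : Function.Surjective ((Ideal.Quotient.mkₐ ℂ (RingHom.ker ε ^ t)).comp
      (Ideal.Quotient.mkₐ ℂ (sliceIdeal X ℓ))) :=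
      (Ideal.Quotient.mkₐ_surjective ℂ _).comp (Ideal.Quotient.mkₐ_surjective ℂ _)
    have he := Ideal.ker_liftₐ_pow_eq_bot ε t (fun b hb => Ideal.pow_le_self ht hb)
    exact length_localRingAt_quotient X hℓ hℓv
      ((Ideal.Quotient.mkₐ ℂ (RingHom.ker ε ^ t)).comp (Ideal.Quotient.mkₐ ℂ (sliceIdeal X ℓ)))
      hs t hk _ he
  have hS : IsSamuelPolynomial (maxIdealAt X (Projectivization.mk ℂ v hv)) P := by
    filter_upwards [hP, eventually_ne_atTop 0] with t ht ht0
    exact ⟨_, hlen t ht0, ht⟩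
  have hex : ∃ P, IsSamuelPolynomial (maxIdealAt X (Projectivization.mk ℂ v hv)) P := ⟨P, hS⟩
  -- Two polynomials with the same values at all large integers coincide, so the choice in the
  -- definition of the multiplicity is harmless. The exponent `t = 0` is left out of `hlen`, since
  -- the augmentation does not factor through the zero ring.
  have huniq : hex.choose = P := by
    have hev := hex.choose_spec.and hS
    rw [eventually_atTop] at hev
    obtain ⟨N, hN⟩ := hev
    refine Polynomial.eq_of_infinite_eval_eq _ _ (Set.Infinite.mono ?_
      ((Set.Ici_infinite N).image (Nat.cast_injective (R := ℚ)).injOn))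
    rintro _ ⟨t, ht, rfl⟩
    obtain ⟨⟨l, h1, h2⟩, l', h1', h2'⟩ := hN t ht
    have : l = l' := by exact_mod_cast h1.symm.trans h1'
    change hex.choose.eval _ = P.eval _
    rw [← h2, ← h2', this]
  rw [mult, samuelMultiplicity, dif_pos hex, huniq]

end ProjMult

/-! ### Linear forms, irreducibility and primes, and the chart of a projection. -/

namespace ProjMult

attribute [local instance] MvPolynomial.gradedAlgebra

variable {n : ℕ}

/-- The linear form on `ℂ ^ n` given by a linear functional. -/
noncomputable def linForm (τ : (Fin n → ℂ) →ₗ[ℂ] ℂ) : Coord n :=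
  ∑ i, MvPolynomial.C (τ (Pi.single i 1)) * MvPolynomial.X i

theorem eval_linForm (τ : (Fin n → ℂ) →ₗ[ℂ] ℂ) (v : Fin n → ℂ) :
    MvPolynomial.eval v (linForm τ) = τ v := by
  rw [linForm, map_sum]
  conv_rhs => rw [pi_eq_sum_univ' v, map_sum]
  refine Finset.sum_congr rfl fun i _ => ?_
  rw [map_mul, MvPolynomial.eval_C, MvPolynomial.eval_X, map_smul, smul_eq_mul, mul_comm]

theorem isHomogeneous_linForm (τ : (Fin n → ℂ) →ₗ[ℂ] ℂ) : (linForm τ).IsHomogeneous 1 :=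
  MvPolynomial.IsHomogeneous.sum _ _ _ fun _ _ => MvPolynomial.isHomogeneous_C_mul_X _ _

theorem coord_ext {f g : Coord n} (h : ∀ v, MvPolynomial.eval v f = MvPolynomial.eval v g) :
    f = g := MvPolynomial.funext h

/-- The pullback of polynomials along a linear map. -/
noncomputable def pullback {m : ℕ} (φ : (Fin m → ℂ) →ₗ[ℂ] (Fin n → ℂ)) : Coord n →ₐ[ℂ] Coord m :=
  MvPolynomial.aeval fun j => linForm (LinearMap.proj j ∘ₗ φ)

theorem eval_aeval {m : ℕ} (p : Fin n → Coord m) (f : Coord n) (v : Fin m → ℂ) :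
    MvPolynomial.eval v (MvPolynomial.aeval p f) =
      MvPolynomial.eval (fun i => MvPolynomial.eval v (p i)) f := by
  change MvPolynomial.aeval v (MvPolynomial.aeval p f) = MvPolynomial.aeval _ f
  rw [← AlgHom.comp_apply, MvPolynomial.comp_aeval]
  rfl

theorem eval_pullback {m : ℕ} (φ : (Fin m → ℂ) →ₗ[ℂ] (Fin n → ℂ)) (f : Coord n) (v : Fin m → ℂ) :
    MvPolynomial.eval v (pullback φ f) = MvPolynomial.eval (φ v) f := by
  rw [pullback, eval_aeval]
  simp only [eval_linForm]
  rfl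

theorem isHomogeneous_pullback {m : ℕ} (φ : (Fin m → ℂ) →ₗ[ℂ] (Fin n → ℂ)) {f : Coord n} {d : ℕ}
    (hf : f.IsHomogeneous d) : (pullback φ f).IsHomogeneous d := by
  have := hf.aeval (n := 1) (fun j => linForm (LinearMap.proj j ∘ₗ φ))
    fun j => isHomogeneous_linForm _
  rwa [one_mul] at this

theorem isHomogeneous_homIdeal (X : Set (PSpace n)) :
    (homIdeal X).IsHomogeneous (MvPolynomial.homogeneousSubmodule (Fin n) ℂ) := by
  intro i f hf
  have := homogeneousComponent_mem_homIdeal hf i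
  rwa [← MvPolynomial.decomposition.decompose'_apply] at this

theorem isClosed_iff_exists_eq_zeros {X : Set (PSpace n)} : IsClosed X ↔
    ∃ S : Set (Coord n), (∀ f ∈ S, ∃ d : ℕ, f.IsHomogeneous d) ∧ X = zeros S := by
  rw [← isOpen_compl_iff]
  change Xᶜᶜ ∈ {Z | ∃ S : Set (Coord n), (∀ f ∈ S, ∃ d : ℕ, f.IsHomogeneous d) ∧ Z = zeros S} ↔ _
  rw [compl_compl]
  rfl

theorem isClosed_zeros {S : Set (Coord n)} (hS : ∀ f ∈ S, ∃ d : ℕ, f.IsHomogeneous d) :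
    IsClosed (zeros S) :=
  isClosed_iff_exists_eq_zeros.mpr ⟨S, hS, rfl⟩

theorem eval_rep_eq_zero_iff {f : Coord n} {d : ℕ} (hf : f.IsHomogeneous d) {v : Fin n → ℂ}
    (hv : v ≠ 0) : MvPolynomial.eval (Projectivization.mk ℂ v hv).rep f = 0 ↔
      MvPolynomial.eval v f = 0 := by
  obtain ⟨c, hc⟩ := Projectivization.exists_smul_eq_mk_rep ℂ v hv
  rw [← hc]
  change MvPolynomial.eval ((c : ℂ) • v) f = 0 ↔ _
  rw [hf.eval_smul, mul_eq_zero, or_iff_right (pow_ne_zero _ c.ne_zero)]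

theorem isHomogeneous_mem_homIdeal_iff {X : Set (PSpace n)} {f : Coord n} {d : ℕ}
    (hf : f.IsHomogeneous d) :
    f ∈ homIdeal X ↔ ∀ x ∈ X, MvPolynomial.eval x.rep f = 0 := by
  rw [mem_homIdeal]
  constructor
  · intro h x hx
    exact h x.rep x.rep_nonzero (by rwa [x.mk_rep])
  · intro h v hv hvX
    exact (eval_rep_eq_zero_iff hf hv).mp (h _ hvX)

theorem exists_eval_ne_zero_of_notMem {X : Set (PSpace n)} (hX : IsClosed X) {v : Fin n → ℂ}
    (hv : v ≠ 0) (h : Projectivization.mk ℂ v hv ∉ X) :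
    ∃ f ∈ homIdeal X, (∃ d : ℕ, f.IsHomogeneous d) ∧ MvPolynomial.eval v f ≠ 0 := by
  obtain ⟨S, hS, rfl⟩ := isClosed_iff_exists_eq_zeros.mp hX
  simp only [zeros, Set.mem_ofPred_eq, not_forall] at h
  obtain ⟨f, hf, hf0⟩ := h
  obtain ⟨d, hd⟩ := hS f hf
  refine ⟨f, ?_, ⟨d, hd⟩, fun h0 => hf0 ((eval_rep_eq_zero_iff hd hv).mpr h0)⟩
  rw [isHomogeneous_mem_homIdeal_iff hd]
  exact fun x hx => hx f hf

/-- For a homogeneous ideal primality is tested on forms; if a product of two forms vanishes on `X`,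
then `X` is covered by their two closed zero sets. -/
theorem isPrime_homIdeal {X : Set (PSpace n)} (hX : IsIrreducible X) : (homIdeal X).IsPrime := by
  refine Ideal.IsHomogeneous.isPrime_of_homogeneous_mem_or_mem (isHomogeneous_homIdeal X) ?_ ?_
  · rw [Ideal.ne_top_iff_one]
    intro h
    obtain ⟨x, hx⟩ := hX.1
    have := mem_homIdeal.mp h x.rep x.rep_nonzero (by rwa [x.mk_rep])
    rw [map_one] at this
    exact one_ne_zero this
  · rintro f g ⟨d, hf⟩ ⟨e, hg⟩ hfg
    have hf : f.IsHomogeneous d := hf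
    have hg : g.IsHomogeneous e := hg
    rw [isHomogeneous_mem_homIdeal_iff (hf.mul hg)] at hfg
    rw [isHomogeneous_mem_homIdeal_iff hf, isHomogeneous_mem_homIdeal_iff hg]
    have hsub : X ⊆ zeros {f} ∪ zeros {g} := by
      intro x hx
      have := hfg x hx
      rw [map_mul, mul_eq_zero] at this
      refine this.imp ?_ ?_
      · rintro h _ rfl
        exact h
      · rintro h _ rfl
        exact h
    rcases (isPreirreducible_iff_isClosed_union_isClosed.mp hX.2) _ _
      (isClosed_zeros (S := {f}) (by rintro _ rfl; exact ⟨d, hf⟩))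
      (isClosed_zeros (S := {g}) (by rintro _ rfl; exact ⟨e, hg⟩)) hsub with h | h
    · exact Or.inl fun x hx => h hx f rfl
    · exact Or.inr fun x hx => h hx g rfl

/-- Homogenization does not change the class modulo the chart ideal, so primality is inherited from
the homogeneous ideal, from which the factor `ℓ` can be cancelled. -/
theorem isPrime_sliceIdeal {X : Set (PSpace n)} (hX : IsIrreducible X) {ℓ : Coord n}
    (hℓ : ℓ.IsHomogeneous 1) (hℓX : ℓ ∉ homIdeal X) : (sliceIdeal X ℓ).IsPrime := by
  have hp := isPrime_homIdeal hX
  have key {f F : Coord n} (h : F - f ∈ Ideal.span {ℓ - 1}) :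
      F ∈ sliceIdeal X ℓ ↔ f ∈ sliceIdeal X ℓ := by
    have h' := span_sub_one_le_sliceIdeal X ℓ h
    exact ⟨fun hF => (Submodule.sub_mem_iff_right _ hF).mp h',
      fun hf => (Submodule.sub_mem_iff_left _ hf).mp h'⟩
  refine ⟨?_, ?_⟩
  · rw [Ideal.ne_top_iff_one]
    intro h
    have := mul_mem_homIdeal_of_mem_sliceIdeal hℓ (MvPolynomial.isHomogeneous_one _ _) h
    rw [mul_one] at this
    exact hℓX this
  · intro f g hfg
    obtain ⟨F, hF, hFf⟩ := MvPolynomial.exists_isHomogeneous_sub_mem hℓ f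
    obtain ⟨G, hG, hGg⟩ := MvPolynomial.exists_isHomogeneous_sub_mem hℓ g
    rw [← key hFf, ← key hGg]
    have hFG : F * G - f * g ∈ Ideal.span {ℓ - 1} := by
      have : F * G - f * g = F * (G - g) + g * (F - f) := by ring
      rw [this]
      exact Ideal.add_mem _ (Ideal.mul_mem_left _ _ hGg) (Ideal.mul_mem_left _ _ hFf)
    rw [← key hFG] at hfg
    have h1 := mul_mem_homIdeal_of_mem_sliceIdeal hℓ (hF.mul hG) hfg
    rcases hp.mem_or_mem ((hp.mem_or_mem h1).resolve_left hℓX) with h | h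
    · exact Or.inl (homIdeal_le_sliceIdeal X ℓ h)
    · exact Or.inr (homIdeal_le_sliceIdeal X ℓ h)

theorem mem_slice_iff {X : Set (PSpace n)} (hX : IsClosed X) {ℓ : Coord n}
    (hℓ : ℓ.IsHomogeneous 1) {v : Fin n → ℂ} :
    v ∈ slice X ℓ ↔ ∀ f ∈ sliceIdeal X ℓ, MvPolynomial.eval v f = 0 := by
  refine ⟨fun hv f hf => mem_sliceIdeal.mp hf v hv, fun h => ?_⟩
  have h1 := h _ (sub_one_mem_sliceIdeal X ℓ)
  rw [map_sub, map_one, sub_eq_zero] at h1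
  have hv : v ≠ 0 := by
    rintro rfl
    have := hℓ.eval_smul 0 (0 : Fin n → ℂ)
    rw [zero_smul, pow_one, zero_mul] at this
    exact one_ne_zero (h1.symm.trans this)
  refine ⟨h1, hv, ?_⟩
  by_contra hcon
  obtain ⟨f, hf, -, hfv⟩ := exists_eval_ne_zero_of_notMem hX hv hcon
  exact hfv (h f (homIdeal_le_sliceIdeal X ℓ hf))

variable {k : ℕ} {a : PSpace (k + 1)} {φ : (Fin (k + 1) → ℂ) →ₗ[ℂ] (Fin k → ℂ)}
  {Q : Set (PSpace (k + 1))}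

theorem map_ne_zero_of_mem (hφ : LinearMap.ker φ = a.submodule) (ha : a ∉ Q) {v : Fin (k + 1) → ℂ} (hv : v ≠ 0)
    (hvQ : Projectivization.mk ℂ v hv ∈ Q) : φ v ≠ 0 := by
  intro h
  have h1 : v ∈ LinearMap.ker φ := h
  rw [hφ, Projectivization.submodule_eq, Submodule.mem_span_singleton] at h1
  obtain ⟨t, ht⟩ := h1
  apply ha
  rw [← a.mk_rep]
  convert hvQ using 1
  rw [eq_comm, Projectivization.mk_eq_mk_iff']
  exact ⟨t, ht⟩

variable (hφ : LinearMap.ker φ = a.submodule) (ha : a ∉ Q)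

theorem projFrom_mk {v : Fin (k + 1) → ℂ} (hv : v ≠ 0) (hvQ : Projectivization.mk ℂ v hv ∈ Q) :
    projFrom a φ hφ Q ha ⟨_, hvQ⟩ =
      Projectivization.mk ℂ (φ v) (map_ne_zero_of_mem hφ ha hv hvQ) := by
  obtain ⟨c, hc⟩ := Projectivization.exists_smul_eq_mk_rep ℂ v hv
  rw [projFrom, Projectivization.mk_eq_mk_iff]
  refine ⟨c, ?_⟩
  rw [← hc]
  exact (φ.map_smul (c : ℂ) v).symm

theorem mk_mem_range_projFrom_iff {w : Fin k → ℂ} (hw : w ≠ 0) :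
    Projectivization.mk ℂ w hw ∈ Set.range (projFrom a φ hφ Q ha) ↔
      ∃ (v : Fin (k + 1) → ℂ) (hv : v ≠ 0), Projectivization.mk ℂ v hv ∈ Q ∧ φ v = w := by
  constructor
  · rintro ⟨x, hx⟩
    rw [projFrom, Projectivization.mk_eq_mk_iff] at hx
    obtain ⟨c, hc⟩ := hx
    have hne : (c⁻¹ : ℂˣ) • x.1.rep ≠ 0 := smul_ne_zero (c⁻¹ : ℂˣ).ne_zero x.1.rep_nonzero
    refine ⟨(c⁻¹ : ℂˣ) • x.1.rep, hne, ?_, ?_⟩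
    · have := mk_smul_eq (c := ((c⁻¹ : ℂˣ) : ℂ)) x.1.rep_nonzero hne
      change Projectivization.mk ℂ (((c⁻¹ : ℂˣ) : ℂ) • x.1.rep) hne ∈ Q
      rw [this, x.1.mk_rep]
      exact x.2
    · change φ (((c⁻¹ : ℂˣ) : ℂ) • x.1.rep) = w
      rw [map_smul, ← hc]
      change (c⁻¹ : ℂˣ) • c • w = w
      rw [inv_smul_smul]
  · rintro ⟨v, hv, hvQ, rfl⟩
    exact ⟨⟨_, hvQ⟩, projFrom_mk hφ ha hv hvQ⟩

theorem mem_slice_pullback_iff {ℓ : Coord k} {v : Fin (k + 1) → ℂ} {X : Set (PSpace (k + 1))} :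
    v ∈ slice X (pullback φ ℓ) ↔ MvPolynomial.eval (φ v) ℓ = 1 ∧
      ∃ h : v ≠ 0, Projectivization.mk ℂ v h ∈ X := by
  rw [slice, Set.mem_ofPred_eq, eval_pullback]

theorem slice_range_projFrom (ℓ : Coord k) :
    slice (Set.range (projFrom a φ hφ Q ha)) ℓ = φ '' slice Q (pullback φ ℓ) := by
  ext w
  constructor
  · rintro ⟨h1, hw, hwR⟩
    obtain ⟨v, hv, hvQ, rfl⟩ := (mk_mem_range_projFrom_iff hφ ha hw).mp hwR
    exact ⟨v, mem_slice_pullback_iff.mpr ⟨h1, hv, hvQ⟩, rfl⟩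
  · rintro ⟨v, hv, rfl⟩
    obtain ⟨h1, hv, hvQ⟩ := mem_slice_pullback_iff.mp hv
    exact ⟨h1, map_ne_zero_of_mem hφ ha hv hvQ,
      (mk_mem_range_projFrom_iff hφ ha _).mpr ⟨v, hv, hvQ, rfl⟩⟩

/-- The chart of the image is the image of the chart. Consequently the coordinate ring of the image
embeds in that of `Q`. -/
theorem sliceIdeal_range_projFrom (ℓ : Coord k) :
    sliceIdeal (Set.range (projFrom a φ hφ Q ha)) ℓ =
      (sliceIdeal Q (pullback φ ℓ)).comap (pullback φ) := by
  ext f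
  rw [Ideal.mem_comap, mem_sliceIdeal, mem_sliceIdeal, slice_range_projFrom]
  simp only [Set.forall_mem_image, eval_pullback]

end ProjMult

/-! ### Relations among `z i = u i + a i • y` and their leading term in `y`. -/

theorem monomialAt_single {R : Type*} [CommRing R] {s : ℕ} (x : Fin s → R) (i : Fin s) :
    monomialAt x (Finsupp.single i 1) = x i :=
  (Finsupp.prod_single_index (h := fun i e => x i ^ e) (pow_zero _)).trans (pow_one _)

/-- The leading term of a form in elements which are multiples of `y` up to lower order terms. -/
theorem aeval_sub_smul_pow_mem {k B : Type*} [Field k] [CommRing B] [Algebra k B]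
    (W : ℕ → Submodule k B) {s : ℕ} {z u : Fin s → B} {a : Fin s → k} {y : B}
    (hz : ∀ i, z i = u i + a i • y) (hW : ∀ m i, ∀ b ∈ W m, z i * b ∈ W (m + 1))
    (hu : ∀ m i, u i * y ^ m ∈ W (m + 1)) {f : MvPolynomial (Fin s) k} {m : ℕ}
    (hf : f.IsHomogeneous m) :
    MvPolynomial.aeval z f - MvPolynomial.eval a f • y ^ m ∈ W m := by
  have key (m : ℕ) : ∀ α : Fin s →₀ ℕ, α.degree = m →
      monomialAt z α - monomialAt a α • y ^ m ∈ W m := by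
    induction m with
    | zero =>
      intro α hα
      rw [Finsupp.degree_eq_zero_iff] at hα
      subst hα
      simp [monomialAt]
    | succ m ih =>
      intro α hα
      obtain ⟨i, hi⟩ : ∃ i, α i ≠ 0 := by
        by_contra! h
        have : α = 0 := Finsupp.ext h
        rw [this, map_zero] at hα
        omega
      obtain ⟨β, rfl⟩ : ∃ β, α = Finsupp.single i 1 + β := by
        refine exists_add_of_le ?_
        rw [Finsupp.single_le_iff]
        omega
      rw [map_add, Finsupp.degree_single] at hα
      have h1 := hW m i _ (ih β (by omega))
      have h2 := (W (m + 1)).smul_mem (monomialAt a β) (hu m i)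
      rw [monomialAt_add, monomialAt_add, monomialAt_single, monomialAt_single]
      convert (W (m + 1)).add_mem h1 h2 using 1
      rw [hz i]
      simp only [Algebra.smul_def, map_mul]
      ring
  have h1 : MvPolynomial.eval a f = ∑ α ∈ f.support, f.coeff α • monomialAt a α :=
    aeval_eq_sum_monomialAt (k := k) a f
  rw [aeval_eq_sum_monomialAt, h1, Finset.sum_smul, ← Finset.sum_sub_distrib]
  refine Submodule.sum_mem _ fun α hα => ?_
  rw [smul_eq_mul, mul_smul, ← smul_sub]
  refine Submodule.smul_mem _ _ (key m α ?_)
  by_contra hne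
  exact MvPolynomial.mem_support_iff.mp hα (hf.coeff_eq_zero hne)

/-- Expanded in powers of `y`, the form `f` at `z` has leading term `f(a) y ^ d`, and `f(a)` is a
nonzero scalar; thus `f(z) = 0` is a monic equation up to this scalar. -/
theorem isIntegral_of_aeval_eq_zero {k A B : Type*} [Field k] [CommRing A] [CommRing B]
    [Algebra k A] [Algebra k B] [Algebra A B] [IsScalarTower k A B] {s : ℕ} {z : Fin s → B}
    {u : Fin s → A} {a : Fin s → k} {y : B} (hz : ∀ i, z i = algebraMap A B (u i) + a i • y)
    {f : MvPolynomial (Fin s) k} {d : ℕ} (hf : f.IsHomogeneous d)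
    (hfa : MvPolynomial.eval a f ≠ 0) (h0 : MvPolynomial.aeval z f = 0) : IsIntegral A y := by
  nontriviality A
  -- Values at `y` of polynomials over `A` of degree less than `m`.
  let W (m : ℕ) : Submodule k B :=
    ((Polynomial.degreeLT A m).map (Polynomial.aeval (R := A) y).toLinearMap).restrictScalars k
  have hW (m : ℕ) (i : Fin s) (b : B) (hb : b ∈ W m) : z i * b ∈ W (m + 1) := by
    obtain ⟨p, hp, rfl⟩ := hb
    refine ⟨(Polynomial.C (u i) + Polynomial.C (algebraMap k A (a i)) * Polynomial.X) * p, ?_, ?_⟩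
    · have hp' := Polynomial.mem_degreeLT.mp hp
      refine Polynomial.mem_degreeLT.mpr ?_
      by_cases hp0 : p = 0
      · rw [hp0, mul_zero, Polynomial.degree_zero]
        exact WithBot.bot_lt_coe _
      · rw [← Polynomial.natDegree_lt_iff_degree_lt hp0] at hp'
        refine lt_of_le_of_lt Polynomial.degree_le_natDegree ?_
        have : (Polynomial.C (u i) + Polynomial.C (algebraMap k A (a i)) *
            Polynomial.X).natDegree ≤ 1 := by
          rw [add_comm]
          exact Polynomial.natDegree_linear_le
        have h2 := Polynomial.natDegree_mul_le (p := (Polynomial.C (u i) +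
          Polynomial.C (algebraMap k A (a i)) * Polynomial.X)) (q := p)
        exact_mod_cast (by omega : _ < m + 1)
    · change Polynomial.aeval y _ = z i * Polynomial.aeval y p
      rw [map_mul, map_add, map_mul, Polynomial.aeval_C, Polynomial.aeval_C, Polynomial.aeval_X,
        hz, ← IsScalarTower.algebraMap_apply, ← Algebra.smul_def]
  have hu (m : ℕ) (i : Fin s) : algebraMap A B (u i) * y ^ m ∈ W (m + 1) := by
    refine ⟨Polynomial.C (u i) * Polynomial.X ^ m, ?_, ?_⟩
    · refine Polynomial.mem_degreeLT.mpr (lt_of_le_of_lt (Polynomial.degree_C_mul_X_pow_le _ _) ?_)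
      exact_mod_cast Nat.lt_succ_self m
    · change Polynomial.aeval y _ = _
      rw [map_mul, Polynomial.aeval_C, map_pow, Polynomial.aeval_X]
  have h1 := aeval_sub_smul_pow_mem W hz hW hu hf
  rw [h0, zero_sub, neg_mem_iff] at h1
  have h2 := (W d).smul_mem (MvPolynomial.eval a f)⁻¹ h1
  rw [smul_smul, inv_mul_cancel₀ hfa, one_smul] at h2
  obtain ⟨p, hp, hpy⟩ := h2
  refine ⟨Polynomial.X ^ d - p, (Polynomial.monic_X_pow d).sub_of_left ?_, ?_⟩
  · rw [Polynomial.degree_X_pow]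
    exact Polynomial.mem_degreeLT.mp hp
  · change Polynomial.aeval y p = y ^ d at hpy
    change Polynomial.aeval y _ = 0
    rw [map_sub, map_pow, Polynomial.aeval_X, hpy, sub_self]

/-- Every element is a polynomial in `y`, so some power of `g` carries it into `A`; finitely many
module generators need only one power. -/
theorem exists_pow_smul_mem_range {A B : Type*} [CommRing A] [CommRing B] [Algebra A B]
    [Module.Finite A B] {y : B} (hadj : Algebra.adjoin A {y} = ⊤) {g : A}
    (hg : ∃ a, algebraMap A B a = g • y) :
    ∃ N, ∀ b : B, ∃ a, algebraMap A B a = g ^ N • b := by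
  have mono {b : B} {N M : ℕ} (hNM : N ≤ M) (h : ∃ a, algebraMap A B a = g ^ N • b) :
      ∃ a, algebraMap A B a = g ^ M • b := by
    obtain ⟨a, ha⟩ := h
    refine ⟨g ^ (M - N) * a, ?_⟩
    rw [map_mul, ha, ← Algebra.smul_def, smul_smul, ← pow_add, Nat.sub_add_cancel hNM]
  have h1 (b : B) : ∃ N, ∃ a, algebraMap A B a = g ^ N • b := by
    have hb : b ∈ Algebra.adjoin A {y} := hadj ▸ Algebra.mem_top
    induction hb using Algebra.adjoin_induction with
    | mem b hb =>
      rw [Set.mem_singleton_iff.mp hb]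
      obtain ⟨a, ha⟩ := hg
      exact ⟨1, a, by rw [ha, pow_one]⟩
    | algebraMap a => exact ⟨0, a, by rw [pow_zero, one_smul]⟩
    | add b c _ _ hb hc =>
      obtain ⟨N, hb⟩ := hb
      obtain ⟨M, hc⟩ := hc
      obtain ⟨a, ha⟩ := mono (le_max_left N M) hb
      obtain ⟨a', ha'⟩ := mono (le_max_right N M) hc
      exact ⟨max N M, a + a', by rw [map_add, ha, ha', smul_add]⟩
    | mul b c _ _ hb hc =>
      obtain ⟨N, a, ha⟩ := hb
      obtain ⟨M, a', ha'⟩ := hc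
      exact ⟨N + M, a * a', by rw [map_mul, ha, ha', pow_add, smul_mul_smul_comm]⟩
  choose N hN using h1
  obtain ⟨S, hS⟩ := (Module.Finite.fg_top : (⊤ : Submodule A B).FG)
  refine ⟨S.sup N, fun b => ?_⟩
  have hb : b ∈ Submodule.span A (S : Set B) := hS ▸ Submodule.mem_top
  induction hb using Submodule.span_induction with
  | mem b hb => exact mono (Finset.le_sup hb) (hN b)
  | zero => exact ⟨0, by rw [map_zero, smul_zero]⟩
  | add b c _ _ hb hc =>
    obtain ⟨a, ha⟩ := hb
    obtain ⟨a', ha'⟩ := hc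
    exact ⟨a + a', by rw [map_add, ha, ha', smul_add]⟩
  | smul r b _ hb =>
    obtain ⟨a, ha⟩ := hb
    exact ⟨r * a, by rw [map_mul, ha, ← Algebra.smul_def, smul_comm]⟩

namespace MvPolynomial

theorem homogeneousComponent_eq_zero_of_mem {σ k : Type*} [Field k] {E : MvPolynomial σ k}
    {m : ℕ} (hE : E ∈ idealOfVars σ k ^ m) {j : ℕ} (hj : j < m) :
    homogeneousComponent j E = 0 := by
  refine homogeneousComponent_eq_zero' _ _ fun α hα h => ?_
  have := mem_pow_idealOfVars_iff _ _ |>.mp hE α hα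
  omega

theorem IsHomogeneous.mem_pow_idealOfVars {σ k : Type*} [Field k] {E : MvPolynomial σ k}
    {m : ℕ} (hE : E.IsHomogeneous m) : E ∈ idealOfVars σ k ^ m := by
  rw [mem_pow_idealOfVars_iff]
  intro α hα
  by_contra hlt
  exact mem_support_iff.mp hα (hE.coeff_eq_zero (by omega))

theorem map_aeval_idealOfVars {σ k B : Type*} [Field k] [CommRing B] [Algebra k B] (z : σ → B) :
    (idealOfVars σ k).map (aeval (R := k) z) = Ideal.span (Set.range z) := by
  rw [idealOfVars, Ideal.map_span, ← Set.range_comp]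
  congr 2
  ext i
  simp

/-- A relation among elements with known leading form gives a relation for `y`. -/
theorem pow_mem_of_aeval_eq_zero {k B : Type*} [Field k] [CommRing B] [Algebra k B]
    {s : ℕ} {z u : Fin s → B} {a : Fin s → k} {y : B} {I M : Ideal B}
    (hz : ∀ i, z i = u i + a i • y) (hu : ∀ i, u i ∈ I) (hzM : ∀ i, z i ∈ M) (hy : y ∈ M)
    {F : MvPolynomial (Fin s) k} {m : ℕ} (hF : ∀ j < m + 1, homogeneousComponent j F = 0)
    (hFa : eval a (homogeneousComponent (m + 1) F) ≠ 0) (h0 : aeval z F = 0) :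
    y ^ (m + 1) ∈ I * M ^ m ⊔ M ^ (m + 2) := by
  have hW := aeval_sub_smul_pow_mem (fun j => (I * M ^ (j - 1)).restrictScalars k) hz
    (fun j i b hb => by
      change z i * b ∈ I * M ^ j
      replace hb : b ∈ I * M ^ (j - 1) := hb
      have h1 := Ideal.mul_mem_mul (hzM i) hb
      rw [mul_left_comm, ← pow_succ'] at h1
      exact Ideal.mul_mono_right (Ideal.pow_le_pow_right (by omega)) h1)
    (fun j i => Ideal.mul_mem_mul (hu i) (Ideal.pow_mem_pow hy j))
    (homogeneousComponent_isHomogeneous (m + 1) F)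
  replace hW : _ ∈ I * M ^ m := hW
  have hsum : aeval z F - aeval z (homogeneousComponent (m + 1) F) ∈ M ^ (m + 2) := by
    have hmap : (idealOfVars (Fin s) k).map (aeval (R := k) z) ≤ M := by
      rw [map_aeval_idealOfVars, Ideal.span_le]
      rintro _ ⟨i, rfl⟩
      exact hzM i
    refine Ideal.pow_right_mono hmap (m + 2) ?_
    rw [← Ideal.map_pow, ← map_sub]
    refine Ideal.mem_map_of_mem _ ((mem_pow_idealOfVars_iff _ _).mpr fun α hα => ?_)
    by_contra hlt
    apply mem_support_iff.mp hα
    rw [coeff_sub, coeff_homogeneousComponent]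
    split_ifs with h
    · rw [sub_self]
    · have := congrArg (coeff α) (hF α.degree (by omega))
      rw [coeff_homogeneousComponent, if_pos rfl, coeff_zero] at this
      rw [this, sub_zero]
  rw [h0, zero_sub, neg_mem_iff] at hsum
  have h1 := Submodule.sub_mem _ (Ideal.mem_sup_right (S := I * M ^ m) hsum)
    (Ideal.mem_sup_left (T := M ^ (m + 2)) hW)
  rw [sub_sub_cancel] at h1
  have h2 := Submodule.smul_of_tower_mem _ (eval a (homogeneousComponent (m + 1) F))⁻¹ h1
  rwa [smul_smul, inv_mul_cancel₀ hFa, one_smul] at h2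

/-- The membership lifts to the polynomial relation `T ^ (m + 1) - G₁ - G₂`. At `a` its component of
degree `m + 1` has value 1: `G₁` is a combination of linear forms vanishing at `a`, and `G₂` has
higher order. -/
theorem exists_aeval_eq_zero_of_pow_mem {k B : Type*} [Field k] [Infinite k] [CommRing B]
    [Algebra k B] {s r : ℕ} {z : Fin s → B} (hz : Function.Surjective (aeval (R := k) z))
    {a : Fin s → k} (L : Fin r → MvPolynomial (Fin s) k) (hL : ∀ j, (L j).IsHomogeneous 1)
    (hLa : ∀ j, eval a (L j) = 0) {T : MvPolynomial (Fin s) k} (hT : T.IsHomogeneous 1)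
    (hTa : eval a T = 1) {m : ℕ}
    (h : aeval z T ^ (m + 1) ∈ Ideal.span (Set.range fun j => aeval z (L j)) *
      Ideal.span (Set.range z) ^ m ⊔ Ideal.span (Set.range z) ^ (m + 2)) :
    ∃ E : MvPolynomial (Fin s) k, aeval z E = 0 ∧ E ∈ idealOfVars (Fin s) k ^ (m + 1) ∧
      eval a (homogeneousComponent (m + 1) E) = 1 := by
  have h1 : Ideal.span (Set.range fun j => aeval z (L j)) =
      (Ideal.span (Set.range L)).map (aeval (R := k) z) := by
    rw [Ideal.map_span, ← Set.range_comp]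
    rfl
  rw [h1, ← map_aeval_idealOfVars (k := k) z, ← Ideal.map_pow, ← Ideal.map_pow, ← Ideal.map_mul,
    ← Ideal.map_sup, Ideal.mem_map_iff_of_surjective _ hz] at h
  obtain ⟨G, hG, hGz⟩ := h
  obtain ⟨G₁, hG₁, G₂, hG₂, rfl⟩ := Submodule.mem_sup.mp hG
  have hLle : Ideal.span (Set.range L) ≤ idealOfVars (Fin s) k := by
    rw [Ideal.span_le]
    rintro _ ⟨j, rfl⟩
    have := (hL j).mem_pow_idealOfVars
    rwa [pow_one] at this
  have hG₁' : G₁ ∈ idealOfVars (Fin s) k ^ (m + 1) := by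
    rw [pow_succ']
    exact Ideal.mul_mono_left hLle hG₁
  have hT' := (hT.pow (m + 1)).mem_pow_idealOfVars
  rw [one_mul] at hT'
  refine ⟨T ^ (m + 1) - (G₁ + G₂), ?_, ?_, ?_⟩
  · rw [map_sub, hGz, map_pow, sub_self]
  · exact Ideal.sub_mem _ hT' (Ideal.add_mem _ hG₁' (Ideal.pow_le_pow_right (by omega) hG₂))
  · have e1 : eval a (homogeneousComponent (m + 1) G₁) = 0 := by
      refine eval_homogeneousComponent_eq_zero (fun t ht => ?_) _
      have : Ideal.span (Set.range L) ≤ RingHom.ker (eval (t • a)) := by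
        rw [Ideal.span_le]
        rintro _ ⟨j, rfl⟩
        change eval (t • a) (L j) = 0
        rw [(hL j).eval_smul, hLa, mul_zero]
      exact this (Ideal.mul_le_left hG₁)
    have e2 := hT.pow (m + 1)
    rw [one_mul] at e2
    rw [map_sub, map_add, homogeneousComponent_eq_zero_of_mem hG₂ (by omega),
      homogeneousComponent_eq_self e2, map_sub, map_add, e1, map_zero, map_pow, hTa]
    simp

end MvPolynomial

/-! ### Taylor expansion at a point, initial forms and homogenization of local relations. -/

namespace ProjMult

attribute [local instance] MvPolynomial.gradedAlgebra

variable {n : ℕ}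

/-- The polynomial `w ↦ f (v + w)`. -/
noncomputable def shift (v : Fin n → ℂ) (f : Coord n) : Coord n :=
  MvPolynomial.aeval (fun i => MvPolynomial.X i + MvPolynomial.C (v i)) f

theorem taylorPart_eq (q : PSpace n) (f : Coord n) (j : ℕ) :
    taylorPart q f j = MvPolynomial.homogeneousComponent j (shift q.rep f) := rfl

theorem eval_shift (v w : Fin n → ℂ) (f : Coord n) :
    MvPolynomial.eval w (shift v f) = MvPolynomial.eval (w + v) f := by
  rw [shift, eval_aeval]
  simp only [map_add, MvPolynomial.eval_X, MvPolynomial.eval_C]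
  rfl

theorem eval_shift_smul (v w : Fin n → ℂ) (f : Coord n) (t : ℂ) :
    ∑ j ∈ Finset.range ((shift v f).totalDegree + 1),
      MvPolynomial.eval w (MvPolynomial.homogeneousComponent j (shift v f)) * t ^ j =
      MvPolynomial.eval (t • w + v) f := by
  rw [← eval_shift]
  conv_rhs => rw [← MvPolynomial.sum_homogeneousComponent (shift v f), map_sum]
  refine Finset.sum_congr rfl fun j _ => ?_
  rw [(MvPolynomial.homogeneousComponent_isHomogeneous j _).eval_smul, mul_comm]

/-- The initial form of a form at `v` does not depend on the coordinate along `v`. -/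
theorem eval_initialForm_add_smul {v : Fin n → ℂ} {f : Coord n} {d m : ℕ} (hf : f.IsHomogeneous d)
    (hm : ∀ j < m, MvPolynomial.homogeneousComponent j (shift v f) = 0) (w : Fin n → ℂ) (s : ℂ) :
    MvPolynomial.eval (w + s • v) (MvPolynomial.homogeneousComponent m (shift v f)) =
      MvPolynomial.eval w (MvPolynomial.homogeneousComponent m (shift v f)) := by
  set N := (shift v f).totalDegree with hN
  by_cases hNm : N < m
  · rw [MvPolynomial.homogeneousComponent_eq_zero _ _ hNm, map_zero, map_zero]
  let c (w : Fin n → ℂ) (j : ℕ) : ℂ :=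
    MvPolynomial.eval w (MvPolynomial.homogeneousComponent j (shift v f))
  have hc (w : Fin n → ℂ) (j : ℕ) (hj : j < m) : c w j = 0 := by
    simp only [c]
    rw [hm j hj, map_zero]
  let u : Polynomial ℂ := 1 + Polynomial.C s * Polynomial.X
  -- `L` and `R` are the two sides of `f(v + t (w + s v)) = (1 + s t) ^ d f(v + t / (1 + s t) w)`,
  -- divided by `t ^ m` and multiplied by `(1 + s t) ^ N`. At `t = 0` they give the two values of
  -- the initial form. Truncation in `j - m` is harmless because the earlier coefficients vanish.
  let L : Polynomial ℂ := u ^ N * ∑ j ∈ Finset.range (N + 1),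
    Polynomial.C (c (w + s • v) j) * Polynomial.X ^ (j - m)
  let R : Polynomial ℂ := u ^ d * ∑ j ∈ Finset.range (N + 1),
    Polynomial.C (c w j) * Polynomial.X ^ (j - m) * u ^ (N - j)
  have hsum (w : Fin n → ℂ) (t : ℂ) (g : ℕ → ℂ) :
      t ^ m * ∑ j ∈ Finset.range (N + 1), c w j * t ^ (j - m) * g j =
        ∑ j ∈ Finset.range (N + 1), c w j * t ^ j * g j := by
    rw [Finset.mul_sum]
    refine Finset.sum_congr rfl fun j _ => ?_
    by_cases hj : j < m
    · rw [hc w j hj]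
      ring
    · have : t ^ j = t ^ m * t ^ (j - m) := by rw [← pow_add, Nat.add_sub_cancel' (by omega)]
      rw [this]
      ring
  have hLR : L = R := by
    refine Polynomial.eq_of_infinite_eval_eq _ _ (Set.Infinite.mono (s := {t : ℂ | t ≠ 0 ∧
      1 + s * t ≠ 0}) ?_ ?_)
    · rintro t ⟨ht, hst⟩
      have e1 := hsum (w + s • v) t fun _ => 1
      simp only [mul_one] at e1
      have e2 := hsum w t fun j => (1 + s * t) ^ (N - j)
      have e3 : t • (w + s • v) + v = (1 + s * t) • ((t / (1 + s * t)) • w + v) := by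
        rw [smul_add, smul_add, smul_smul, smul_smul, mul_div_cancel₀ _ hst, add_smul, one_smul,
          mul_comm s t]
        abel
      have e4 := eval_shift_smul v (w + s • v) f t
      rw [e3, hf.eval_smul, ← eval_shift_smul v w f] at e4
      simp only [Set.mem_ofPred_eq, L, R, u, Polynomial.eval_mul, Polynomial.eval_pow,
        Polynomial.eval_add, Polynomial.eval_one, Polynomial.eval_C, Polynomial.eval_X,
        Polynomial.eval_finsetSum]
      apply mul_left_cancel₀ (pow_ne_zero m ht)
      rw [mul_left_comm, e1, mul_left_comm (t ^ m), e2]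
      change (1 + s * t) ^ N * (∑ j ∈ Finset.range (N + 1), c (w + s • v) j * t ^ j) = _
      change (∑ j ∈ Finset.range (N + 1), c (w + s • v) j * t ^ j) =
        (1 + s * t) ^ d * (∑ j ∈ Finset.range (N + 1), c w j * (t / (1 + s * t)) ^ j) at e4
      rw [e4, mul_left_comm, Finset.mul_sum]
      congr 1
      refine Finset.sum_congr rfl fun j hj => ?_
      have hj' : j ≤ N := Nat.lt_succ_iff.mp (Finset.mem_range.mp hj)
      have : (1 + s * t) ^ N = (1 + s * t) ^ j * (1 + s * t) ^ (N - j) := by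
        rw [← pow_add, Nat.add_sub_cancel' hj']
      rw [this, div_pow]
      field_simp
    · have : {t : ℂ | t ≠ 0 ∧ 1 + s * t ≠ 0} = ({0, -s⁻¹} ∩ {t | t = 0 ∨ 1 + s * t = 0} : Set ℂ)ᶜ := by
        ext t
        simp only [Set.mem_ofPred_eq, Set.mem_compl_iff, Set.mem_inter_iff, Set.mem_insert_iff,
          Set.mem_singleton_iff]
        constructor
        · rintro ⟨h1, h2⟩ ⟨-, h3 | h3⟩
          · exact h1 h3
          · exact h2 h3
        · intro h
          refine ⟨fun h0 => h ⟨Or.inl h0, Or.inl h0⟩, fun h0 => h ⟨Or.inr ?_, Or.inr h0⟩⟩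
          have hs : s ≠ 0 := by
            rintro rfl
            simp at h0
          field_simp
          linear_combination h0
      rw [this]
      exact ((Set.toFinite _).inter_of_left _).infinite_compl
  have h0 := congrArg (Polynomial.eval 0) hLR
  have hmN : m ∈ Finset.range (N + 1) := Finset.mem_range.mpr (by omega)
  simp only [L, R, u, Polynomial.eval_mul, Polynomial.eval_pow,
    Polynomial.eval_add, Polynomial.eval_one, Polynomial.eval_C, Polynomial.eval_X,
    Polynomial.eval_finsetSum, mul_zero, add_zero, one_pow, one_mul, mul_one] at h0
  have hsingle (w : Fin n → ℂ) : ∑ j ∈ Finset.range (N + 1), c w j * 0 ^ (j - m) = c w m := by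
    rw [Finset.sum_eq_single m]
    · simp
    · intro j _ hj
      rcases lt_or_gt_of_ne hj with h | h
      · rw [hc w j h, zero_mul]
      · rw [zero_pow (by omega), mul_zero]
    · exact fun h => absurd hmN h
  rwa [hsingle, hsingle] at h0

/-- A polynomial relation in the chart `ℓ = 1` is the dehomogenization of a form, with the same
initial form in directions along which `ℓ` vanishes. -/
theorem exists_form_of_relation {X : Set (PSpace n)} {ℓ : Coord n} {τ : (Fin n → ℂ) →ₗ[ℂ] ℂ}
    (hℓ : ℓ.IsHomogeneous 1) (hτ : ∀ w, MvPolynomial.eval w ℓ = τ w) {v a : Fin n → ℂ}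
    (hv : τ v = 1) (ha : τ a = 0) {E : Coord n} {m : ℕ}
    (hE : E ∈ MvPolynomial.idealOfVars (Fin n) ℂ ^ m)
    (hEX : ∀ w ∈ slice X ℓ, MvPolynomial.eval (w - v) E = 0) :
    ∃ f ∈ homIdeal X, (∃ d : ℕ, f.IsHomogeneous d) ∧
      (∀ j < m, MvPolynomial.homogeneousComponent j (shift v f) = 0) ∧
      MvPolynomial.eval a (MvPolynomial.homogeneousComponent m (shift v f)) =
        MvPolynomial.eval a (MvPolynomial.homogeneousComponent m E) := by
  -- The linear map `w ↦ w - τ w • v` agrees with `w ↦ w - v` on the slice and kills `v`.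
  let lam : Fin n → Coord n := fun i => MvPolynomial.X i - MvPolynomial.C (v i) * ℓ
  have hlam (i : Fin n) : (lam i).IsHomogeneous 1 :=
    (MvPolynomial.isHomogeneous_X _ _).sub (hℓ.C_mul _)
  have hlamev (w : Fin n → ℂ) : (fun i => MvPolynomial.eval w (lam i)) = w - τ w • v := by
    funext i
    simp only [lam, map_sub, map_mul, MvPolynomial.eval_X, MvPolynomial.eval_C, hτ, Pi.sub_apply,
      Pi.smul_apply, smul_eq_mul, mul_comm]
  let H : ℕ → Coord n := fun j =>
    MvPolynomial.aeval lam (MvPolynomial.homogeneousComponent j E)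
  have hH (j : ℕ) : (H j).IsHomogeneous j := by
    have := (MvPolynomial.homogeneousComponent_isHomogeneous j E).aeval (n := 1) lam hlam
    rwa [one_mul] at this
  have hHev (j : ℕ) (w : Fin n → ℂ) : MvPolynomial.eval w (H j) =
      MvPolynomial.eval (w - τ w • v) (MvPolynomial.homogeneousComponent j E) := by
    simp only [H]
    rw [eval_aeval, hlamev]
  have hH0 (j : ℕ) (hj : j < m) : H j = 0 := by
    simp only [H]
    rw [MvPolynomial.homogeneousComponent_eq_zero_of_mem hE hj, map_zero]
  set N := E.totalDegree with hN
  -- The homogenization by `ℓ` of `w ↦ E (w - v)`. The extra factor `ℓ` in `ℓ * F` below makes it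
  -- vanish on the whole cone and not just where `ℓ ≠ 0`.
  let F : Coord n := ∑ j ∈ Finset.range (N + 1), H j * ℓ ^ (N - j)
  have hF : F.IsHomogeneous N := by
    refine MvPolynomial.IsHomogeneous.sum _ _ _ fun j hj => ?_
    have := (hH j).mul (hℓ.pow (N - j))
    rwa [one_mul, Nat.add_sub_cancel' (Nat.lt_succ_iff.mp (Finset.mem_range.mp hj))] at this
  have hFX : F ∈ sliceIdeal X ℓ := by
    rw [mem_sliceIdeal]
    intro w hw
    have hw1 : τ w = 1 := by rw [← hτ, hw.1]
    rw [← hEX w hw]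
    conv_rhs => rw [← MvPolynomial.sum_homogeneousComponent E, map_sum]
    simp only [F, map_sum, map_mul, map_pow, hτ, hw1, one_pow, mul_one, hHev, one_smul]
    rfl
  -- Moving by `v` leaves each `H j` unchanged and turns `ℓ` into `1 + ℓ`, so the lowest terms are
  -- those of the `H j`. Along `a`, where `ℓ` vanishes, the expansion is exactly that of `E`.
  have hshift : shift v (ℓ * F) =
      ∑ j ∈ Finset.range (N + 1), H j * (1 + ℓ) ^ (N - j + 1) := by
    apply coord_ext
    intro w
    rw [eval_shift]
    simp only [F, map_mul, map_sum, map_pow, map_add, map_one, hτ, hHev, hv, add_smul, one_smul,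
      Finset.mul_sum]
    refine Finset.sum_congr rfl fun j _ => ?_
    rw [show w + v - (τ w • v + v) = w - τ w • v by abel]
    ring
  have hmem : shift v (ℓ * F) ∈ MvPolynomial.idealOfVars (Fin n) ℂ ^ m := by
    rw [hshift]
    refine Ideal.sum_mem _ fun j _ => ?_
    by_cases hj : j < m
    · rw [hH0 j hj, zero_mul]
      exact Ideal.zero_mem _
    · exact Ideal.mul_mem_right _ _ (Ideal.pow_le_pow_right (by omega)
        (hH j).mem_pow_idealOfVars)
  refine ⟨ℓ * F, mul_mem_homIdeal_of_mem_sliceIdeal hℓ hF hFX, ⟨_, hℓ.mul hF⟩,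
    fun j hj => MvPolynomial.homogeneousComponent_eq_zero_of_mem hmem hj, ?_⟩
  rw [← sub_eq_zero, ← map_sub, ← map_sub]
  refine MvPolynomial.eval_homogeneousComponent_eq_zero (fun t _ => ?_) m
  rw [hshift, map_sub, sub_eq_zero]
  conv_rhs => rw [← MvPolynomial.sum_homogeneousComponent E, map_sum]
  rw [map_sum]
  refine Finset.sum_congr rfl fun j _ => ?_
  rw [map_mul, hHev, map_pow, map_add, map_one, hτ, map_smul, ha, smul_zero, zero_smul, sub_zero,
    add_zero, one_pow, mul_one]

end ProjMult

/-! ### The chart of a projection: generation by one element, finiteness and conductor. -/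

namespace ProjMult

attribute [local instance] MvPolynomial.gradedAlgebra

/-- Linear algebra attached to a projection with kernel spanned by `a` and a vector `v` outside
the kernel: a functional `τ` on the target, and coordinates on the source along `a`. -/
theorem exists_projection_coordinates {k : ℕ} {φ : (Fin (k + 1) → ℂ) →ₗ[ℂ] (Fin k → ℂ)}
    {a v : Fin (k + 1) → ℂ} (ha : a ≠ 0) (hφ : ∀ w, φ w = 0 ↔ ∃ c : ℂ, c • a = w)
    (hv : φ v ≠ 0) :
    ∃ (τ : (Fin k → ℂ) →ₗ[ℂ] ℂ) (T : (Fin (k + 1) → ℂ) →ₗ[ℂ] ℂ)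
      (σ : (Fin k → ℂ) →ₗ[ℂ] (Fin (k + 1) → ℂ)),
      τ (φ v) = 1 ∧ T a = 1 ∧ T v = 0 ∧ ∀ w, w = σ (φ w) + T w • a := by
  have hφa : φ a = 0 := (hφ a).mpr ⟨1, one_smul _ _⟩
  have hex {m : ℕ} {w : Fin m → ℂ} (hw : w ≠ 0) : ∃ θ : (Fin m → ℂ) →ₗ[ℂ] ℂ, θ w = 1 := by
    obtain ⟨i, hi⟩ := Function.ne_iff.mp hw
    exact ⟨(w i)⁻¹ • LinearMap.proj i, inv_mul_cancel₀ hi⟩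
  obtain ⟨τ, hτ⟩ := hex hv
  obtain ⟨T₀, hT₀⟩ := hex ha
  -- The correction centres the coordinate at `v` and keeps its value 1 at `a`, since `φ a = 0`.
  let T : (Fin (k + 1) → ℂ) →ₗ[ℂ] ℂ := T₀ - T₀ v • (τ ∘ₗ φ)
  have hTa : T a = 1 := by
    simp [T, hT₀, hφa]
  have hTv : T v = 0 := by
    simp [T, hτ]
  have hker : LinearMap.ker (φ.prod T) = ⊥ := by
    rw [LinearMap.ker_eq_bot']
    intro w hw
    have h1 : φ w = 0 := congrArg Prod.fst hw
    have h2 : T w = 0 := congrArg Prod.snd hw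
    obtain ⟨c, rfl⟩ := (hφ w).mp h1
    rw [map_smul, hTa, smul_eq_mul, mul_one] at h2
    rw [h2, zero_smul]
  obtain ⟨g, hg⟩ := LinearMap.exists_leftInverse_of_injective _ hker
  have hg' (w : Fin (k + 1) → ℂ) : g (φ w, T w) = w := LinearMap.congr_fun hg w
  refine ⟨τ, T, g ∘ₗ LinearMap.inl ℂ _ _, hτ, hTa, hTv, fun w => ?_⟩
  have h1 := hg' a
  rw [hφa, hTa] at h1
  calc w = g (φ w, T w) := (hg' w).symm
    _ = g ((φ w, 0) + T w • (0, 1)) := by simp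
    _ = g (φ w, 0) + T w • a := by rw [map_add, map_smul, h1]

section Chart

variable {k : ℕ} {φ : (Fin (k + 1) → ℂ) →ₗ[ℂ] (Fin k → ℂ)} {a : PSpace (k + 1)}
  {Q : Set (PSpace (k + 1))} {ℓ : Coord (k + 1)}
  {τ : (Fin k → ℂ) →ₗ[ℂ] ℂ} {T : (Fin (k + 1) → ℂ) →ₗ[ℂ] ℂ}
  {σ : (Fin k → ℂ) →ₗ[ℂ] (Fin (k + 1) → ℂ)}
  {A B : Type} [CommRing A] [CommRing B] [Algebra ℂ A] [Algebra ℂ B] [Algebra A B]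
  [IsScalarTower ℂ A B] {πA : Coord k →ₐ[ℂ] A} {πB : Coord (k + 1) →ₐ[ℂ] B}

theorem X_eq_of_coordinates {a : Fin (k + 1) → ℂ} (hσ : ∀ w, w = σ (φ w) + T w • a)
    (i : Fin (k + 1)) :
    (MvPolynomial.X i : Coord (k + 1)) = pullback φ (linForm (LinearMap.proj i ∘ₗ σ)) +
      MvPolynomial.C (a i) * linForm T := by
  apply coord_ext
  intro w
  rw [map_add, map_mul, eval_pullback, eval_linForm, eval_linForm, MvPolynomial.eval_C,
    MvPolynomial.eval_X, mul_comm]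
  exact congrFun (hσ w) i

theorem adjoin_chart_eq_top {a : Fin (k + 1) → ℂ} (hσ : ∀ w, w = σ (φ w) + T w • a)
    (hπB : Function.Surjective πB)
    (hAB : ∀ f, algebraMap A B (πA f) = πB (pullback φ f)) :
    Algebra.adjoin A {πB (linForm T)} = ⊤ := by
  rw [eq_top_iff]
  rintro b -
  obtain ⟨f, rfl⟩ := hπB b
  induction f using MvPolynomial.induction_on with
  | C c =>
    have : πB (MvPolynomial.C c) = algebraMap A B (algebraMap ℂ A c) := by
      rw [← IsScalarTower.algebraMap_apply]
      exact πB.commutes c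
    rw [this]
    exact Subalgebra.algebraMap_mem _ _
  | add f g hf hg =>
    rw [map_add]
    exact Subalgebra.add_mem _ hf hg
  | mul_X f i hf =>
    rw [map_mul]
    refine Subalgebra.mul_mem _ hf ?_
    rw [X_eq_of_coordinates hσ, map_add, map_mul, ← hAB]
    refine Subalgebra.add_mem _ (Subalgebra.algebraMap_mem _ _) (Subalgebra.mul_mem _ ?_
      (Algebra.subset_adjoin rfl))
    have : πB (MvPolynomial.C (a i)) = algebraMap A B (algebraMap ℂ A (a i)) := by
      rw [← IsScalarTower.algebraMap_apply]
      exact πB.commutes (a i)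
    rw [this]
    exact Subalgebra.algebraMap_mem _ _

theorem aeval_comp_eq {m : ℕ} {s : ℕ} (π : Coord m →ₐ[ℂ] B) (p : Fin s → Coord m) (f : Coord s) :
    MvPolynomial.aeval (fun i => π (p i)) f = π (MvPolynomial.aeval p f) := by
  rw [← AlgHom.comp_apply, MvPolynomial.comp_aeval]

/-- As `a` is outside the closed set `Q`, a form of the ideal of `Q` is nonzero at `a`; it provides
an integral equation for the coordinate along `a`, which generates the chart algebra. -/
theorem finite_chart (hclosed : IsClosed Q) (ha : a ∉ Q)
    (hσ : ∀ w, w = σ (φ w) + T w • a.rep) (hπB : Function.Surjective πB)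
    (hB : ∀ f, πB f = 0 ↔ f ∈ sliceIdeal Q ℓ)
    (hAB : ∀ f, algebraMap A B (πA f) = πB (pullback φ f)) : Module.Finite A B := by
  obtain ⟨f, hf, ⟨d, hd⟩, hfa⟩ := exists_eval_ne_zero_of_notMem hclosed a.rep_nonzero
    (by rwa [a.mk_rep])
  have hint : IsIntegral A (πB (linForm T)) := by
    refine isIntegral_of_aeval_eq_zero (k := ℂ) (z := fun i => πB (MvPolynomial.X i))
      (u := fun i => πA (linForm (LinearMap.proj i ∘ₗ σ))) (a := a.rep) (fun i => ?_) hd hfa ?_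
    · rw [X_eq_of_coordinates hσ i, map_add, map_mul, hAB, Algebra.smul_def]
      congr 2
      exact πB.commutes _
    · rw [aeval_comp_eq, MvPolynomial.aeval_X_left_apply, hB]
      exact homIdeal_le_sliceIdeal Q ℓ hf
  have h1 := hint.fg_adjoin_singleton
  rw [adjoin_chart_eq_top hσ hπB hAB] at h1
  exact ⟨h1⟩

/-- On the chart the inverse rational map returns `g • v` at the image of `v`, with a factor `g` in
`A`. Taking the coordinate along `a` gives `g • y ∈ A`, and a power of `g` is then a conductor
element. -/
theorem exists_conductor_of_isBirational [IsDomain A] [Module.Finite A B] (hirr : IsIrreducible Q)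
    {hφ : LinearMap.ker φ = a.submodule} {ha : a ∉ Q}
    (hbir : IsBirationalOntoImage (projFrom a φ hφ Q ha))
    (hℓ : ℓ.IsHomogeneous 1) (hτ : ∀ w, MvPolynomial.eval w ℓ = τ (φ w)) (hℓQ : ℓ ∉ homIdeal Q)
    (hσ : ∀ w, w = σ (φ w) + T w • a.rep) (hπB : Function.Surjective πB)
    (hB : ∀ f, πB f = 0 ↔ f ∈ sliceIdeal Q ℓ)
    (hA : ∀ f, πA f = 0 ↔ pullback φ f ∈ sliceIdeal Q ℓ)
    (hAB : ∀ f, algebraMap A B (πA f) = πB (pullback φ f)) :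
    ∃ h : A, h ≠ 0 ∧ ∀ b : B, ∃ a : A, algebraMap A B a = h • b := by
  obtain ⟨d, G, hG, ⟨x, hx⟩, hrat⟩ := hbir
  let ev (v : Fin (k + 1) → ℂ) : Fin (k + 1) → ℂ := fun i => MvPolynomial.eval (φ v) (G i)
  let comb (θ : (Fin (k + 1) → ℂ) →ₗ[ℂ] ℂ) : Coord k :=
    ∑ i, MvPolynomial.C (θ (Pi.single i 1)) * G i
  have hcomb (θ : (Fin (k + 1) → ℂ) →ₗ[ℂ] ℂ) (v : Fin (k + 1) → ℂ) :
      MvPolynomial.eval (φ v) (comb θ) = θ (ev v) := by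
    rw [← eval_linForm]
    simp only [comb, linForm, map_sum, map_mul, MvPolynomial.eval_C, MvPolynomial.eval_X, ev]
  -- The factor of proportionality is found by applying `τ ∘ φ`, which is 1 on the slice.
  have hev (v : Fin (k + 1) → ℂ) (hv : v ∈ slice Q ℓ) : ev v = τ (φ (ev v)) • v := by
    obtain ⟨hv1, hv0, hvQ⟩ := hv
    by_cases h0 : ev v = 0
    · rw [h0, map_zero, map_zero, zero_smul]
    · have hpr := projFrom_mk hφ ha hv0 hvQ
      obtain ⟨c, hc⟩ := Projectivization.exists_smul_eq_mk_rep ℂ (φ v)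
        (map_ne_zero_of_mem hφ ha hv0 hvQ)
      have hrep : (fun i => MvPolynomial.eval (projFrom a φ hφ Q ha ⟨_, hvQ⟩).rep (G i)) =
          (c : ℂ) ^ d • ev v := by
        funext i
        rw [hpr, ← hc]
        exact (hG i).eval_smul (c : ℂ) (φ v)
      have hne : (fun i => MvPolynomial.eval (projFrom a φ hφ Q ha ⟨_, hvQ⟩).rep (G i)) ≠ 0 := by
        rw [hrep]
        exact smul_ne_zero (pow_ne_zero _ c.ne_zero) h0
      have h1 := hrat ⟨_, hvQ⟩ hne
      rw [Projectivization.mk_eq_mk_iff'] at h1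
      obtain ⟨e, he⟩ := h1
      rw [hrep] at he
      have h2 : ev v = (e / (c : ℂ) ^ d) • v := by
        rw [div_eq_inv_mul, mul_smul, he, smul_smul, inv_mul_cancel₀ (pow_ne_zero _ c.ne_zero),
          one_smul]
      rw [hτ] at hv1
      rw [h2, map_smul, map_smul, hv1, smul_eq_mul, mul_one]
  let g : A := πA (comb (τ ∘ₗ φ))
  -- If the factor vanished on the slice, all components of the inverse would vanish there; as `ℓ`
  -- is not in the prime ideal of `Q`, they would vanish on all of `Q`.
  have hg0 : g ≠ 0 := by
    intro h
    rw [hA, mem_sliceIdeal] at h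
    apply hx
    funext j
    have h1 : pullback φ (G j) ∈ sliceIdeal Q ℓ := by
      rw [mem_sliceIdeal]
      intro v hv
      have h2 := h v hv
      rw [eval_pullback, hcomb] at h2
      have h3 := hev v hv
      rw [show τ (φ (ev v)) = 0 from h2, zero_smul] at h3
      rw [eval_pullback]
      exact congrFun h3 j
    have h2 := (isPrime_homIdeal hirr).mem_or_mem
      (mul_mem_homIdeal_of_mem_sliceIdeal hℓ (isHomogeneous_pullback φ (hG j)) h1)
    have h3 := mem_homIdeal.mp (h2.resolve_left hℓQ) x.1.rep x.1.rep_nonzero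
      (by rw [x.1.mk_rep]; exact x.2)
    rw [eval_pullback] at h3
    exact (eval_rep_eq_zero_iff (hG j) _).mpr h3
  obtain ⟨N, hN⟩ := exists_pow_smul_mem_range (adjoin_chart_eq_top hσ hπB hAB) (g := g)
    ⟨πA (comb T), by
      rw [hAB, Algebra.smul_def, hAB, ← map_mul, ← sub_eq_zero, ← map_sub, hB, mem_sliceIdeal]
      intro v hv
      rw [map_sub, map_mul, eval_pullback, eval_pullback, hcomb, hcomb, eval_linForm, sub_eq_zero]
      conv_lhs => rw [hev v hv, map_smul, smul_eq_mul]
      rfl⟩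
  exact ⟨g ^ N, pow_ne_zero N hg0, hN⟩

end Chart

end ProjMult

/-! ### The two geometric conditions expressed in the chart. -/

namespace ProjMult

attribute [local instance] MvPolynomial.gradedAlgebra

theorem rep_mem_submodule {n : ℕ} (x : PSpace n) : x.rep ∈ x.submodule := by
  rw [Projectivization.submodule_eq]
  exact Submodule.mem_span_singleton_self _

theorem mk_mem_lineThrough_iff {n : ℕ} {a q : PSpace n} {v : Fin n → ℂ} (hv : v ≠ 0) :
    Projectivization.mk ℂ v hv ∈ lineThrough a q ↔ ∃ s t : ℂ, s • a.rep + t • q.rep = v := by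
  rw [lineThrough, Set.mem_ofPred_eq, Projectivization.submodule_mk, Submodule.span_singleton_le_iff_mem,
    Projectivization.submodule_eq, Projectivization.submodule_eq, Submodule.mem_sup]
  constructor
  · rintro ⟨_, hx, _, hy, rfl⟩
    obtain ⟨s, rfl⟩ := Submodule.mem_span_singleton.mp hx
    obtain ⟨t, rfl⟩ := Submodule.mem_span_singleton.mp hy
    exact ⟨s, t, rfl⟩
  · rintro ⟨s, t, rfl⟩
    exact ⟨_, Submodule.smul_mem _ _ (Submodule.mem_span_singleton_self _), _,
      Submodule.smul_mem _ _ (Submodule.mem_span_singleton_self _), rfl⟩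

section Chart

variable {k : ℕ} {φ : (Fin (k + 1) → ℂ) →ₗ[ℂ] (Fin k → ℂ)} {a q : PSpace (k + 1)}
  {Q : Set (PSpace (k + 1))} {ℓ : Coord (k + 1)}
  {τ : (Fin k → ℂ) →ₗ[ℂ] ℂ} {T : (Fin (k + 1) → ℂ) →ₗ[ℂ] ℂ}
  {σ : (Fin k → ℂ) →ₗ[ℂ] (Fin (k + 1) → ℂ)}
  {A B : Type} [CommRing A] [CommRing B] [Algebra ℂ A] [Algebra ℂ B] [Algebra A B]
  {πA : Coord k →ₐ[ℂ] A} {πB : Coord (k + 1) →ₐ[ℂ] B}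

/-- The line joining `a` and `q` meets `Q` only in `q` if and only if there is a unique point of
the chart over the projection of `q`. -/
theorem lineThrough_inter_eq_singleton_iff (hclosed : IsClosed Q) (hq : q ∈ Q) (ha : a ∉ Q)
    (hφ : LinearMap.ker φ = a.submodule) (hℓ : ℓ.IsHomogeneous 1)
    (hτ : ∀ w, MvPolynomial.eval w ℓ = τ (φ w)) (hτq : τ (φ q.rep) = 1)
    (hπA : Function.Surjective πA) (hπB : Function.Surjective πB)
    (hB : ∀ f, πB f = 0 ↔ f ∈ sliceIdeal Q ℓ)
    (hAB : ∀ f, algebraMap A B (πA f) = πB (pullback φ f))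
    {εA : A →ₐ[ℂ] ℂ} {εB : B →ₐ[ℂ] ℂ} (hεA : ∀ f, εA (πA f) = MvPolynomial.eval (φ q.rep) f)
    (hεB : ∀ f, εB (πB f) = MvPolynomial.eval q.rep f) :
    lineThrough a q ∩ Q = {q} ↔
      ∀ ε' : B →ₐ[ℂ] ℂ, (∀ x, ε' (algebraMap A B x) = εA x) → ε' = εB := by
  have hφ' (w : Fin (k + 1) → ℂ) : φ w = 0 ↔ ∃ c : ℂ, c • a.rep = w := by
    rw [← LinearMap.mem_ker, hφ, Projectivization.submodule_eq, Submodule.mem_span_singleton]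
  have hφa : φ a.rep = 0 := (hφ' _).mpr ⟨1, one_smul _ _⟩
  have hφq : φ q.rep ≠ 0 := map_ne_zero_of_mem hφ ha q.rep_nonzero (by rwa [q.mk_rep])
  have hslice (v : Fin (k + 1) → ℂ) (hv : v ∈ slice Q ℓ) :
      ∃ ε' : B →ₐ[ℂ] ℂ, ∀ f, ε' (πB f) = MvPolynomial.eval v f := by
    refine ⟨AlgHom.liftOfSurjective πB hπB (MvPolynomial.aeval v) fun f hf => ?_, fun f => ?_⟩
    · exact mem_sliceIdeal.mp ((hB f).mp hf) v hv
    · exact AlgHom.liftOfSurjective_apply _ _ _ _ _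
  constructor
  · intro h ε' hε'
    -- A homomorphism to `ℂ` is evaluation at a point of the slice. Lying over `εA` means having the
    -- same image as `q.rep`, that is, differing from it by a multiple of `a.rep`.
    set v : Fin (k + 1) → ℂ := fun i => ε' (πB (MvPolynomial.X i)) with hvdef
    have hε'v (f : Coord (k + 1)) : ε' (πB f) = MvPolynomial.eval v f := by
      change (ε'.comp πB) f = MvPolynomial.aeval v f
      rw [MvPolynomial.aeval_unique (ε'.comp πB)]
      rfl
    have hv : v ∈ slice Q ℓ := by
      rw [mem_slice_iff hclosed hℓ]
      intro f hf
      rw [← hε'v, (hB f).mpr hf, map_zero]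
    have hφv : φ v = φ q.rep := by
      funext j
      have h1 := hε' (πA (MvPolynomial.X j))
      rwa [hAB, hε'v, hεA, eval_pullback, MvPolynomial.eval_X, MvPolynomial.eval_X] at h1
    obtain ⟨hv1, hv0, hvQ⟩ := hv
    obtain ⟨c, hc⟩ := (hφ' (v - q.rep)).mp (by rw [map_sub, hφv, sub_self])
    have hline : Projectivization.mk ℂ v hv0 ∈ lineThrough a q :=
      (mk_mem_lineThrough_iff hv0).mpr ⟨c, 1, by rw [hc, one_smul, sub_add_cancel]⟩
    have hmem : Projectivization.mk ℂ v hv0 ∈ ({q} : Set (PSpace (k + 1))) := h ▸ ⟨hline, hvQ⟩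
    rw [Set.mem_singleton_iff, ← q.mk_rep, Projectivization.mk_eq_mk_iff'] at hmem
    obtain ⟨e, he⟩ := hmem
    have he1 : e = 1 := by
      have h1 := congrArg (fun w => τ (φ w)) he
      simp only [map_smul, hφv, hτq, smul_eq_mul, mul_one] at h1
      exact h1
    rw [he1, one_smul] at he
    apply AlgHom.ext
    intro b
    obtain ⟨f, rfl⟩ := hπB b
    rw [hε'v, hεB, he]
  · intro h
    apply le_antisymm
    · rintro x ⟨hx1, hx2⟩
      rw [← x.mk_rep] at hx1 hx2
      obtain ⟨s, t, hst⟩ := (mk_mem_lineThrough_iff x.rep_nonzero).mp hx1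
      have hφx : φ x.rep = t • φ q.rep := by
        rw [← hst, map_add, map_smul, map_smul, hφa, smul_zero, zero_add]
      have ht : t ≠ 0 := by
        rintro rfl
        rw [zero_smul] at hφx
        exact map_ne_zero_of_mem hφ ha x.rep_nonzero hx2 hφx
      have hne : t⁻¹ • x.rep ≠ 0 := smul_ne_zero (inv_ne_zero ht) x.rep_nonzero
      have hφt : φ (t⁻¹ • x.rep) = φ q.rep := by
        rw [map_smul, hφx, smul_smul, inv_mul_cancel₀ ht, one_smul]
      obtain ⟨ε', hε'⟩ := hslice (t⁻¹ • x.rep) ⟨by rw [hτ, hφt, hτq], hne, by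
        rwa [mk_smul_eq x.rep_nonzero hne]⟩
      have heq := h ε' fun y => by
        obtain ⟨f, rfl⟩ := hπA y
        rw [hAB, hε', hεA, eval_pullback, hφt]
      have hxq : t⁻¹ • x.rep = q.rep := by
        funext i
        have h1 := hε' (MvPolynomial.X i)
        rw [heq, hεB, MvPolynomial.eval_X, MvPolynomial.eval_X] at h1
        exact h1.symm
      rw [Set.mem_singleton_iff, ← x.mk_rep, ← mk_smul_eq x.rep_nonzero hne]
      conv_rhs => rw [← q.mk_rep]
      congr 1
    · rintro x hx
      rw [Set.mem_singleton_iff.mp hx]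
      refine ⟨?_, hq⟩
      have := (mk_mem_lineThrough_iff (a := a) (q := q) q.rep_nonzero).mpr
        ⟨0, 1, by rw [zero_smul, one_smul, zero_add]⟩
      rwa [q.mk_rep] at this

/-- The line joining `a` and `q` is not tangent to `Q` if and only if the coordinate along `a`
satisfies a relation with nonzero initial form along `a`. -/
theorem not_lineThrough_subset_tangentCone_iff (hq : q ∈ Q)
    (hφ : LinearMap.ker φ = a.submodule) (hℓ : ℓ.IsHomogeneous 1)
    (hτ : ∀ w, MvPolynomial.eval w ℓ = τ (φ w)) (hτq : τ (φ q.rep) = 1)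
    (hTa : T a.rep = 1) (hTq : T q.rep = 0) (hσ : ∀ w, w = σ (φ w) + T w • a.rep)
    (hπA : Function.Surjective πA) (hπB : Function.Surjective πB)
    (hB : ∀ f, πB f = 0 ↔ f ∈ sliceIdeal Q ℓ)
    (hAB : ∀ f, algebraMap A B (πA f) = πB (pullback φ f))
    {εA : A →ₐ[ℂ] ℂ} {εB : B →ₐ[ℂ] ℂ} (hεA : ∀ f, εA (πA f) = MvPolynomial.eval (φ q.rep) f)
    (hεB : ∀ f, εB (πB f) = MvPolynomial.eval q.rep f) :
    ¬ lineThrough a q ⊆ tangentCone Q q ↔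
      ∃ N, πB (linForm T) ^ (N + 1) ∈
        (RingHom.ker εA).map (algebraMap A B) * RingHom.ker εB ^ N ⊔ RingHom.ker εB ^ (N + 2) := by
  have hφa : φ a.rep = 0 := by
    rw [← LinearMap.mem_ker, hφ]
    exact rep_mem_submodule a
  have hB' {f g : Coord (k + 1)} : πB f = πB g ↔
      ∀ v ∈ slice Q ℓ, MvPolynomial.eval v f = MvPolynomial.eval v g := by
    rw [← sub_eq_zero, ← map_sub, hB, mem_sliceIdeal]
    simp only [map_sub, sub_eq_zero]
  let p : Fin (k + 1) → Coord (k + 1) := fun i => MvPolynomial.X i - MvPolynomial.C (q.rep i)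
  let z : Fin (k + 1) → B := fun i => πB (p i)
  have hzp (f : Coord (k + 1)) : MvPolynomial.aeval z f = πB (MvPolynomial.aeval p f) :=
    aeval_comp_eq πB p f
  have hpev (f : Coord (k + 1)) (v : Fin (k + 1) → ℂ) :
      MvPolynomial.eval v (MvPolynomial.aeval p f) = MvPolynomial.eval (v - q.rep) f := by
    rw [eval_aeval]
    simp only [p, map_sub, MvPolynomial.eval_X, MvPolynomial.eval_C]
    rfl
  have hz_shift (f : Coord (k + 1)) : MvPolynomial.aeval z (shift q.rep f) = πB f := by
    rw [hzp]
    congr 1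
    apply coord_ext
    intro v
    rw [hpev, eval_shift, sub_add_cancel]
  have hzsurj : Function.Surjective (MvPolynomial.aeval (R := ℂ) z) := by
    intro b
    obtain ⟨f, rfl⟩ := hπB b
    exact ⟨_, hz_shift f⟩
  have hzε (i : Fin (k + 1)) : εB (z i) = 0 := by
    simp only [z, p]
    rw [hεB, map_sub, MvPolynomial.eval_X, MvPolynomial.eval_C, sub_self]
  have hzM := span_range_eq_ker z εB hzsurj hzε
  let u : Fin (k + 1) → A := fun i => πA (linForm (LinearMap.proj i ∘ₗ σ) -
    MvPolynomial.C (σ (φ q.rep) i))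
  have huε (i : Fin (k + 1)) : εA (u i) = 0 := by
    simp only [u]
    rw [hεA, map_sub, eval_linForm, MvPolynomial.eval_C]
    exact sub_self _
  have hyM : πB (linForm T) ∈ RingHom.ker εB := by
    rw [RingHom.mem_ker, hεB, eval_linForm, hTq]
  have hzu (i : Fin (k + 1)) : z i = algebraMap A B (u i) + a.rep i • πB (linForm T) := by
    simp only [z, u, p]
    rw [hAB, ← map_smul, ← map_add, hB']
    intro v _
    have h1 := congrFun (hσ v) i
    have h2 := congrFun (hσ q.rep) i
    rw [hTq, zero_smul, add_zero] at h2
    simp only [Pi.add_apply, Pi.smul_apply, smul_eq_mul] at h1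
    simp only [map_sub, map_add, MvPolynomial.smul_eval, MvPolynomial.eval_X, MvPolynomial.eval_C,
      eval_pullback, eval_linForm]
    change v i - q.rep i = σ (φ v) i - σ (φ q.rep) i + a.rep i * T v
    rw [← h2]
    linear_combination h1
  constructor
  · intro h
    obtain ⟨x, hx, hxT⟩ := Set.not_subset.mp h
    simp only [tangentCone, Set.mem_ofPred_eq, not_forall] at hxT
    obtain ⟨f, hf, ⟨d, hd⟩, m, hm, hne⟩ := hxT
    simp only [taylorPart_eq] at hm hne
    rw [← x.mk_rep] at hx
    obtain ⟨s, t, hst⟩ := (mk_mem_lineThrough_iff x.rep_nonzero).mp hx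
    -- The initial form ignores the summand along `q` and is homogeneous, so its value at a point of
    -- the line is a multiple of its value at `a`.
    rw [← hst, eval_initialForm_add_smul hd hm,
      (MvPolynomial.homogeneousComponent_isHomogeneous m _).eval_smul] at hne
    have hne' := right_ne_zero_of_mul hne
    have hfq : MvPolynomial.eval q.rep f = 0 :=
      mem_homIdeal.mp hf q.rep q.rep_nonzero (by rwa [q.mk_rep])
    obtain ⟨N, rfl⟩ : ∃ N, m = N + 1 := by
      refine Nat.exists_eq_succ_of_ne_zero ?_
      rintro rfl
      apply hne'
      rw [MvPolynomial.homogeneousComponent_zero, MvPolynomial.eval_C,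
        ← MvPolynomial.constantCoeff_eq, ← MvPolynomial.eval_zero, eval_shift, zero_add, hfq]
    refine ⟨N, MvPolynomial.pow_mem_of_aeval_eq_zero (k := ℂ) hzu
      (fun i => Ideal.mem_map_of_mem _ (huε i)) hzε hyM hm hne' ?_⟩
    rw [hz_shift, hB]
    exact homIdeal_le_sliceIdeal Q ℓ hf
  · rintro ⟨N, hN⟩
    let w : Fin k → A := fun j => πA (MvPolynomial.X j - MvPolynomial.C (φ q.rep j))
    have hwsurj : Function.Surjective (MvPolynomial.aeval (R := ℂ) w) := by
      intro b
      obtain ⟨f, rfl⟩ := hπA b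
      refine ⟨shift (φ q.rep) f, ?_⟩
      simp only [w]
      rw [aeval_comp_eq]
      congr 1
      apply coord_ext
      intro v
      rw [eval_aeval, eval_shift]
      congr 1
      congr 1
      funext j
      simp
    have hwε (j : Fin k) : εA (w j) = 0 := by
      simp only [w]
      rw [hεA, map_sub, MvPolynomial.eval_X, MvPolynomial.eval_C, sub_self]
    have hwM := span_range_eq_ker w εA hwsurj hwε
    let L : Fin k → Coord (k + 1) := fun j => pullback φ (MvPolynomial.X j)
    have hLw (j : Fin k) : algebraMap A B (w j) = MvPolynomial.aeval z (L j) := by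
      simp only [w, L]
      rw [hAB, hzp, hB']
      intro v _
      rw [hpev, eval_pullback, eval_pullback, map_sub, MvPolynomial.eval_X, MvPolynomial.eval_C,
        MvPolynomial.eval_X, map_sub]
      rfl
    have hTz : πB (linForm T) = MvPolynomial.aeval z (linForm T) := by
      rw [hzp, hB']
      intro v _
      rw [hpev, eval_linForm, eval_linForm, map_sub, hTq, sub_zero]
    have hmap : (RingHom.ker εA).map (algebraMap A B) =
        Ideal.span (Set.range fun j => MvPolynomial.aeval z (L j)) := by
      rw [← hwM, Ideal.map_span, ← Set.range_comp]
      congr 2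
      funext j
      exact hLw j
    rw [hmap, hTz, ← hzM] at hN
    -- The ideal of the image point is generated by the linear forms `L j`, which factor through `φ`
    -- and so vanish at `a`. The resulting relation is homogenized to a form whose initial form is 1
    -- at `a`, so already the point `a` of the line is outside the tangent cone.
    obtain ⟨E, hE0, hEm, hEa⟩ := MvPolynomial.exists_aeval_eq_zero_of_pow_mem (a := a.rep) hzsurj L
      (fun j => isHomogeneous_pullback φ (MvPolynomial.isHomogeneous_X _ _))
      (fun j => by
        simp only [L]
        rw [eval_pullback, hφa, MvPolynomial.eval_X]
        rfl)
      (isHomogeneous_linForm T) (by rw [eval_linForm, hTa]) hN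
    obtain ⟨f, hf, hd, hf0, hfa⟩ := exists_form_of_relation (X := Q) (τ := τ ∘ₗ φ) hℓ hτ
      (v := q.rep) (a := a.rep) hτq (by rw [LinearMap.comp_apply, hφa, map_zero]) hEm
      (fun v hv => by
        rw [hzp, hB] at hE0
        have := mem_sliceIdeal.mp hE0 v hv
        rwa [hpev] at this)
    intro hsub
    have hal : a ∈ lineThrough a q := by
      have := (mk_mem_lineThrough_iff (a := a) (q := q) a.rep_nonzero).mpr
        ⟨1, 0, by rw [zero_smul, one_smul, add_zero]⟩
      rwa [a.mk_rep] at this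
    have h1 := hsub hal f hf hd (N + 1) hf0
    rw [taylorPart_eq, hfa, hEa] at h1
    exact one_ne_zero h1

end Chart

end ProjMult

/-! ### The multiplicity criterion for a birational projection. -/

namespace ProjMult

attribute [local instance] MvPolynomial.gradedAlgebra

/-- The criterion for equality of multiplicities, with the chart algebras as parameters. -/
theorem leadingCoeff_eq_iff_of_chart {k : ℕ} {φ : (Fin (k + 1) → ℂ) →ₗ[ℂ] (Fin k → ℂ)}
    {a q : PSpace (k + 1)} {Q : Set (PSpace (k + 1))} {ℓ : Coord (k + 1)}
    {τ : (Fin k → ℂ) →ₗ[ℂ] ℂ} {T : (Fin (k + 1) → ℂ) →ₗ[ℂ] ℂ}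
    {σ : (Fin k → ℂ) →ₗ[ℂ] (Fin (k + 1) → ℂ)}
    {A B : Type} [CommRing A] [CommRing B] [Algebra ℂ A] [Algebra ℂ B]
    {πA : Coord k →ₐ[ℂ] A} {πB : Coord (k + 1) →ₐ[ℂ] B}
    (hclosed : IsClosed Q) (hirr : IsIrreducible Q) (hq : q ∈ Q) (ha : a ∉ Q)
    (hφ : LinearMap.ker φ = a.submodule)
    (hbir : IsBirationalOntoImage (projFrom a φ hφ Q ha)) (hℓ : ℓ.IsHomogeneous 1)
    (hτ : ∀ w, MvPolynomial.eval w ℓ = τ (φ w)) (hτq : τ (φ q.rep) = 1)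
    (hTa : T a.rep = 1) (hTq : T q.rep = 0) (hσ : ∀ w, w = σ (φ w) + T w • a.rep)
    (hπA : Function.Surjective πA) (hπB : Function.Surjective πB)
    (hB : ∀ f, πB f = 0 ↔ f ∈ sliceIdeal Q ℓ)
    (hA : ∀ f, πA f = 0 ↔ pullback φ f ∈ sliceIdeal Q ℓ)
    {εA : A →ₐ[ℂ] ℂ} {εB : B →ₐ[ℂ] ℂ} (hεA : ∀ f, εA (πA f) = MvPolynomial.eval (φ q.rep) f)
    (hεB : ∀ f, εB (πB f) = MvPolynomial.eval q.rep f) {P R : Polynomial ℚ}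
    (hP : ∀ᶠ t : ℕ in atTop, (Module.finrank ℂ (A ⧸ RingHom.ker εA ^ t) : ℚ) = P.eval (t : ℚ))
    (hR : ∀ᶠ t : ℕ in atTop, (Module.finrank ℂ (B ⧸ RingHom.ker εB ^ t) : ℚ) = R.eval (t : ℚ)) :
    (P.natDegree.factorial : ℚ) * P.leadingCoeff = (R.natDegree.factorial : ℚ) * R.leadingCoeff ↔
      lineThrough a q ∩ Q = {q} ∧ ¬ lineThrough a q ⊆ tangentCone Q q := by
  have hℓQ : ℓ ∉ homIdeal Q := fun h => by
    have := mem_homIdeal.mp h q.rep q.rep_nonzero (by rwa [q.mk_rep])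
    rw [hτ, hτq] at this
    exact one_ne_zero this
  have hprime := isPrime_sliceIdeal hirr hℓ hℓQ
  have hkerB : RingHom.ker πB = sliceIdeal Q ℓ := by
    ext f
    rw [RingHom.mem_ker, hB]
  have : IsDomain B := by
    have hp : (RingHom.ker πB).IsPrime := hkerB ▸ hprime
    have hd : IsDomain (Coord (k + 1) ⧸ RingHom.ker πB) := (Ideal.Quotient.isDomain_iff_prime _).mpr hp
    exact (Ideal.quotientKerAlgEquivOfSurjective hπB).symm.toMulEquiv.isDomain _
  let f : A →ₐ[ℂ] B := AlgHom.liftOfSurjective πA hπA (πB.comp (pullback φ)) fun g hg => by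
    exact (hB _).mpr ((hA g).mp hg)
  have hf (g : Coord k) : f (πA g) = πB (pullback φ g) :=
    AlgHom.liftOfSurjective_apply _ _ _ _ _
  have hinj : Function.Injective f := by
    rw [injective_iff_map_eq_zero]
    intro x hx
    obtain ⟨g, rfl⟩ := hπA x
    rw [hf, hB] at hx
    exact (hA g).mpr hx
  have : IsDomain A := hinj.isDomain f.toRingHom
  let : Algebra A B := f.toRingHom.toAlgebra
  have : IsScalarTower ℂ A B := IsScalarTower.of_algebraMap_eq fun c => (f.commutes c).symm
  have : FaithfulSMul A B := (faithfulSMul_iff_algebraMap_injective A B).mpr hinj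
  have hAB (g : Coord k) : algebraMap A B (πA g) = πB (pullback φ g) := hf g
  have := finite_chart hclosed ha hσ hπB hB hAB
  have : Algebra.FiniteType ℂ A := Algebra.FiniteType.of_surjective πA hπA
  obtain ⟨h, hh, hcond⟩ := exists_conductor_of_isBirational hirr hbir hℓ hτ hℓQ hσ hπB hB hA hAB
  have hε (x : A) : εB (algebraMap A B x) = εA x := by
    obtain ⟨g, rfl⟩ := hπA x
    rw [hAB, hεB, hεA, eval_pullback]
  rw [samuel_leadingCoeff_eq_iff εA εB hε (πB (linForm T)) (by rw [hεB, eval_linForm, hTq])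
    (adjoin_chart_eq_top hσ hπB hAB) hh hcond hP hR,
    lineThrough_inter_eq_singleton_iff hclosed hq ha hφ hℓ hτ hτq hπA hπB hB hAB hεA hεB,
    not_lineThrough_subset_tangentCone_iff hq hφ hℓ hτ hτq hTa hTq hσ hπA hπB hB hAB hεA hεB]

/-- A single functional `τ`, normalized at the image of `q.rep`, gives charts of the image and of
`Q` in which both multiplicities are leading coefficients of Samuel polynomials; the rest is the
comparison of these charts. -/
theorem mult_projFrom_eq_iff {k : ℕ} {Q : Set (PSpace (k + 1))} (hclosed : IsClosed Q)
    (hirr : IsIrreducible Q) {a : PSpace (k + 1)} (ha : a ∉ Q)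
    {φ : (Fin (k + 1) → ℂ) →ₗ[ℂ] (Fin k → ℂ)} (hφ : LinearMap.ker φ = a.submodule)
    (hbir : IsBirationalOntoImage (projFrom a φ hφ Q ha)) (q : Q) :
    mult (Set.range (projFrom a φ hφ Q ha)) (projFrom a φ hφ Q ha q) = mult Q q.1 ↔
      lineThrough a q.1 ∩ Q = {q.1} ∧ ¬ lineThrough a q.1 ⊆ tangentCone Q q.1 := by
  have hφ' (w : Fin (k + 1) → ℂ) : φ w = 0 ↔ ∃ c : ℂ, c • a.rep = w := by
    rw [← LinearMap.mem_ker, hφ, Projectivization.submodule_eq, Submodule.mem_span_singleton]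
  have hφq : φ q.1.rep ≠ 0 := map_rep_ne_zero hφ (fun h => ha (h ▸ q.2))
  obtain ⟨τ, T, σ, hτq, hTa, hTq, hσ⟩ := exists_projection_coordinates a.rep_nonzero hφ' hφq
  have hℓ' := isHomogeneous_linForm τ
  have hℓ := isHomogeneous_pullback φ hℓ'
  have hqs : q.1.rep ∈ slice Q (pullback φ (linForm τ)) :=
    mem_slice_pullback_iff.mpr ⟨by rw [eval_linForm, hτq], q.1.rep_nonzero, by
      rw [q.1.mk_rep]; exact q.2⟩
  have hA (f : Coord k) : f ∈ sliceIdeal (Set.range (projFrom a φ hφ Q ha)) (linForm τ) ↔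
      pullback φ f ∈ sliceIdeal Q (pullback φ (linForm τ)) := by
    rw [sliceIdeal_range_projFrom, Ideal.mem_comap]
  let εA : (Coord k ⧸ sliceIdeal (Set.range (projFrom a φ hφ Q ha)) (linForm τ)) →ₐ[ℂ] ℂ :=
    Ideal.Quotient.liftₐ _ (MvPolynomial.aeval (φ q.1.rep)) fun f hf => by
      have := mem_sliceIdeal.mp ((hA f).mp hf) _ hqs
      rwa [eval_pullback] at this
  let εB : (Coord (k + 1) ⧸ sliceIdeal Q (pullback φ (linForm τ))) →ₐ[ℂ] ℂ :=
    Ideal.Quotient.liftₐ _ (MvPolynomial.aeval q.1.rep) fun f hf => mem_sliceIdeal.mp hf _ hqs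
  have hεA (f : Coord k) : εA (Ideal.Quotient.mk _ f) = MvPolynomial.eval (φ q.1.rep) f := rfl
  have hεB (f : Coord (k + 1)) : εB (Ideal.Quotient.mk _ f) = MvPolynomial.eval q.1.rep f := rfl
  obtain ⟨P, hP⟩ := eventuallyPolynomial_finrank_quotient_ker_pow εA
  obtain ⟨R, hR⟩ := eventuallyPolynomial_finrank_quotient_ker_pow εB
  have h1 := mult_eq_of_eventually (hv := hφq) hℓ' (by rw [eval_linForm, hτq]) εA hεA hP
  have h2 := mult_eq_of_eventually (hv := q.1.rep_nonzero) hℓ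
    (by rw [eval_pullback, eval_linForm, hτq]) εB hεB hR
  rw [q.1.mk_rep] at h2
  change mult _ (Projectivization.mk ℂ (φ q.1.rep) hφq) = _ ↔ _
  rw [h1, h2]
  exact leadingCoeff_eq_iff_of_chart (πA := Ideal.Quotient.mkₐ ℂ _)
    (πB := Ideal.Quotient.mkₐ ℂ _) hclosed hirr q.2 ha hφ hbir hℓ
    (fun w => by rw [eval_pullback, eval_linForm]) hτq hTa hTq hσ
    (Ideal.Quotient.mkₐ_surjective ℂ _) (Ideal.Quotient.mkₐ_surjective ℂ _)
    (fun f => Ideal.Quotient.eq_zero_iff_mem)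
    (fun f => Ideal.Quotient.eq_zero_iff_mem.trans (hA f)) hεA hεB hP hR

end ProjMult

/-! ### Dimension of charts and cones containing `Q`. -/

/-- A domain which is integral over a polynomial subring in `s` variables has dimension at
least `s`. -/
theorem le_ringKrullDim_of_isIntegral {k S : Type*} [Field k] [CommRing S] [IsDomain S]
    [Algebra k S] {s : ℕ} (g : MvPolynomial (Fin s) k →ₐ[k] S) (hg : Function.Injective g)
    (hint : g.toRingHom.IsIntegral) : (s : WithBot ℕ∞) ≤ ringKrullDim S := by
  let : Algebra (MvPolynomial (Fin s) k) S := g.toRingHom.toAlgebra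
  have : Algebra.IsIntegral (MvPolynomial (Fin s) k) S := ⟨hint⟩
  have hle : (s : WithBot ℕ∞) ≤ ringKrullDim (MvPolynomial (Fin s) k) := by
    rw [MvPolynomial.ringKrullDim_of_isNoetherianRing, ringKrullDim_eq_zero_of_field]
    simp
  obtain ⟨l, hl⟩ := Order.le_krullDim_iff.mp hle
  obtain ⟨P, -, hP, hPl⟩ := Ideal.exists_ideal_over_prime_of_isIntegral
    (S := S) (RelSeries.head l).asIdeal (⊥ : Ideal S) (by
      rw [← RingHom.ker_eq_comap_bot, (RingHom.injective_iff_ker_eq_bot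
        (algebraMap (MvPolynomial (Fin s) k) S)).mp hg]
      exact bot_le)
  have : P.LiesOver (RelSeries.head l).asIdeal := ⟨hPl.symm⟩
  obtain ⟨L, hL, -⟩ := Ideal.exists_ltSeries_of_hasGoingUp l P
  exact Order.le_krullDim_iff.mpr ⟨L, hL.trans hl⟩

/-- More elements than the transcendence degree plus one satisfy a homogeneous relation. -/
theorem exists_isHomogeneous_aeval_eq_zero {k B : Type u} [Field k] [CommRing B] [IsDomain B]
    [Algebra k B] {s m : ℕ} (hs : Algebra.trdeg k B = s) (hsm : s + 1 < m) (b : Fin m → B) :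
    ∃ (G : MvPolynomial (Fin m) k) (d : ℕ), G.IsHomogeneous d ∧ G ≠ 0 ∧
      MvPolynomial.aeval b G = 0 := by
  -- The polynomial ring over `B` has transcendence degree `s + 1 < m`. The added variable records
  -- the degree, so each homogeneous component of a relation among the `X * b j` is itself a
  -- relation among the `b j`.
  have hdep : ¬ AlgebraicIndependent k (fun j => Polynomial.X * Polynomial.C (b j)) := by
    intro h
    have h1 := h.lift_cardinalMk_le_trdeg
    have h2 := trdeg_add_eq k B (A := Polynomial B)
    rw [hs, Polynomial.trdeg_of_isDomain] at h2
    rw [← h2, Cardinal.mk_fin] at h1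
    simp only [Cardinal.lift_natCast, Cardinal.lift_add, Cardinal.lift_one] at h1
    have h3 : m ≤ s + 1 := by exact_mod_cast h1
    omega
  rw [algebraicIndependent_iff] at hdep
  push Not at hdep
  obtain ⟨G, hG, hG0⟩ := hdep
  obtain ⟨i, hi⟩ : ∃ i, MvPolynomial.homogeneousComponent i G ≠ 0 := by
    by_contra! h
    apply hG0
    rw [← MvPolynomial.sum_homogeneousComponent G]
    exact Finset.sum_eq_zero fun i _ => h i
  refine ⟨_, i, MvPolynomial.homogeneousComponent_isHomogeneous i G, hi, ?_⟩
  have hterm (j : ℕ) : MvPolynomial.aeval (fun j => Polynomial.X * Polynomial.C (b j))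
      (MvPolynomial.homogeneousComponent j G) =
      Polynomial.X ^ j * Polynomial.C (MvPolynomial.aeval b
        (MvPolynomial.homogeneousComponent j G)) := by
    rw [(MvPolynomial.homogeneousComponent_isHomogeneous j G).aeval_mul_left]
    congr 1
    exact MvPolynomial.aeval_algebraMap_apply _ _ _
  by_cases hdeg : G.totalDegree < i
  · rw [MvPolynomial.homogeneousComponent_eq_zero _ _ hdeg, map_zero]
  rw [← MvPolynomial.sum_homogeneousComponent G, map_sum] at hG
  simp only [hterm] at hG
  have hc := congrArg (fun p => Polynomial.coeff p i) hG
  simp only [Polynomial.finsetSum_coeff, Polynomial.coeff_X_pow_mul', Polynomial.coeff_zero,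
    Polynomial.coeff_C] at hc
  rw [Finset.sum_eq_single i] at hc
  · simpa using hc
  · intro j _ hj
    split_ifs with h1 h2
    · omega
    · rfl
    · rfl
  · intro h
    exact absurd (Finset.mem_range.mpr (by omega)) h

namespace ProjMult

attribute [local instance] MvPolynomial.gradedAlgebra

variable {n : ℕ}

/-- The forms in an ideal. -/
def formsIn (P : Ideal (Coord n)) : Set (Coord n) := {f | (∃ d : ℕ, f.IsHomogeneous d) ∧ f ∈ P}

theorem isClosed_zeros_formsIn (P : Ideal (Coord n)) : IsClosed (zeros (formsIn P)) :=
  isClosed_zeros fun _ hf => hf.1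

theorem zeros_formsIn_subset {Q : Set (PSpace n)} {ℓ : Coord n} {P : Ideal (Coord n)}
    (hclosed : IsClosed Q) (hP : sliceIdeal Q ℓ ≤ P) :
    zeros (formsIn P) ⊆ Q := by
  intro x hx
  by_contra hxQ
  rw [← x.mk_rep] at hxQ
  obtain ⟨f, hf, hd, hne⟩ := exists_eval_ne_zero_of_notMem hclosed x.rep_nonzero hxQ
  exact hne (hx f ⟨hd, hP (homIdeal_le_sliceIdeal Q ℓ hf)⟩)

section

variable {Q : Set (PSpace n)} {ℓ : Coord n} {P : Ideal (Coord n)} [P.IsPrime]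

/-- By the Nullstellensatz it suffices to test `f` on the affine zeros of `P`; these lie in the
slice and represent projective zeros of the forms in `P`. -/
theorem mem_of_forall_zeros_formsIn (hclosed : IsClosed Q) (hℓ : ℓ.IsHomogeneous 1)
    (hP : sliceIdeal Q ℓ ≤ P) {f : Coord n} {d : ℕ} (hf : f.IsHomogeneous d)
    (h : ∀ x ∈ zeros (formsIn P), MvPolynomial.eval x.rep f = 0) : f ∈ P := by
  rw [← MvPolynomial.IsPrime.vanishingIdeal_zeroLocus (K := ℂ) P]
  intro v hv
  have hvs : v ∈ slice Q ℓ := by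
    rw [mem_slice_iff hclosed hℓ]
    exact fun g hg => hv g (hP hg)
  obtain ⟨-, hv0, -⟩ := hvs
  refine (eval_rep_eq_zero_iff hf hv0).mp (h _ fun g hg => ?_)
  obtain ⟨⟨e, he⟩, hgP⟩ := hg
  exact (eval_rep_eq_zero_iff he hv0).mpr (hv g hgP)

theorem isIrreducible_zeros_formsIn (hclosed : IsClosed Q) (hℓ : ℓ.IsHomogeneous 1)
    (hP : sliceIdeal Q ℓ ≤ P) : IsIrreducible (zeros (formsIn P)) := by
  have hprime : P.IsPrime := inferInstance
  constructor
  · by_contra hne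
    rw [Set.not_nonempty_iff_eq_empty] at hne
    apply hprime.ne_top
    rw [Ideal.eq_top_iff_one]
    refine mem_of_forall_zeros_formsIn hclosed hℓ hP (MvPolynomial.isHomogeneous_one _ _) ?_
    rw [hne]
    exact fun x hx => hx.elim
  · rw [isPreirreducible_iff_isClosed_union_isClosed]
    intro Z₁ Z₂ hZ₁ hZ₂ hsub
    by_contra! hcon
    obtain ⟨h1, h2⟩ := hcon
    obtain ⟨x, hx, hx1⟩ := Set.not_subset.mp h1
    obtain ⟨y, hy, hy2⟩ := Set.not_subset.mp h2
    obtain ⟨S₁, hS₁, rfl⟩ := isClosed_iff_exists_eq_zeros.mp hZ₁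
    obtain ⟨S₂, hS₂, rfl⟩ := isClosed_iff_exists_eq_zeros.mp hZ₂
    simp only [zeros, Set.mem_ofPred_eq, not_forall] at hx1 hy2
    obtain ⟨f, hf, hfx⟩ := hx1
    obtain ⟨g, hg, hgy⟩ := hy2
    obtain ⟨d, hd⟩ := hS₁ f hf
    obtain ⟨e, he⟩ := hS₂ g hg
    have hfg : f * g ∈ P := by
      refine mem_of_forall_zeros_formsIn hclosed hℓ hP (hd.mul he) fun w hw => ?_
      rw [map_mul, mul_eq_zero]
      exact (hsub hw).imp (fun h => h f hf) fun h => h g hg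
    rcases hprime.mem_or_mem hfg with h | h
    · exact hfx (hx f ⟨⟨d, hd⟩, h⟩)
    · exact hgy (hy g ⟨⟨e, he⟩, h⟩)

end

theorem isIrreducible_preimage_val {X : Type*} [TopologicalSpace X] {Z Q : Set X} (hZ : IsIrreducible Z)
    (hZQ : Z ⊆ Q) : IsIrreducible ((Subtype.val : Q → X) ⁻¹' Z) := by
  obtain ⟨⟨x, hx⟩, hpre⟩ := hZ
  refine ⟨⟨⟨x, hZQ hx⟩, hx⟩, ?_⟩
  intro u v hu hv ⟨y, hyZ, hyu⟩ ⟨w, hwZ, hwv⟩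
  obtain ⟨u', hu', rfl⟩ := isOpen_induced_iff.mp hu
  obtain ⟨v', hv', rfl⟩ := isOpen_induced_iff.mp hv
  obtain ⟨t, htZ, htu, htv⟩ := hpre u' v' hu' hv' ⟨y, hyZ, hyu⟩ ⟨w, hwZ, hwv⟩
  exact ⟨⟨t, hZQ htZ⟩, htZ, htu, htv⟩

/-- The dimension of an affine chart is at most the dimension of the projective set. -/
theorem ringKrullDim_chart_le {Q : Set (PSpace n)} (hclosed : IsClosed Q) {ℓ : Coord n}
    (hℓ : ℓ.IsHomogeneous 1) :
    ringKrullDim (Coord n ⧸ sliceIdeal Q ℓ) ≤ topologicalKrullDim Q := by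
  let I (p : PrimeSpectrum (Coord n ⧸ sliceIdeal Q ℓ)) : Ideal (Coord n) :=
    p.asIdeal.comap (Ideal.Quotient.mk (sliceIdeal Q ℓ))
  have hI (p : PrimeSpectrum (Coord n ⧸ sliceIdeal Q ℓ)) : sliceIdeal Q ℓ ≤ I p := by
    intro f hf
    change Ideal.Quotient.mk _ f ∈ p.asIdeal
    rw [Ideal.Quotient.eq_zero_iff_mem.mpr hf]
    exact Ideal.zero_mem _
  have hprime (p : PrimeSpectrum (Coord n ⧸ sliceIdeal Q ℓ)) : (I p).IsPrime :=
    Ideal.comap_isPrime _ _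
  -- A prime of the chart is sent to the projective zero set of its forms. This is strictly antitone
  -- because each class contains a form, and forms of a prime are detected on its zero set.
  let F : (PrimeSpectrum (Coord n ⧸ sliceIdeal Q ℓ))ᵒᵈ → TopologicalSpace.IrreducibleCloseds Q :=
    fun p => ⟨Subtype.val ⁻¹' zeros (formsIn (I (OrderDual.ofDual p))),
      isIrreducible_preimage_val (isIrreducible_zeros_formsIn hclosed hℓ (hI _))
        (zeros_formsIn_subset hclosed (hI _)),
      (isClosed_zeros_formsIn _).preimage continuous_subtype_val⟩
  have hF : StrictMono F := by
    intro p p' hpp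
    have hlt : OrderDual.ofDual p' < OrderDual.ofDual p := hpp
    refine lt_of_le_not_ge ?_ fun hle => ?_
    · intro x hx f hf
      exact hx f ⟨hf.1, hlt.le hf.2⟩
    · apply hlt.not_ge
      change (OrderDual.ofDual p).asIdeal ≤ (OrderDual.ofDual p').asIdeal
      intro b hb
      obtain ⟨f, rfl⟩ := Ideal.Quotient.mk_surjective b
      obtain ⟨G, hG, hGf⟩ := MvPolynomial.exists_isHomogeneous_sub_mem hℓ f
      have hGf' : Ideal.Quotient.mk (sliceIdeal Q ℓ) G = Ideal.Quotient.mk (sliceIdeal Q ℓ) f :=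
        Ideal.Quotient.eq.mpr (span_sub_one_le_sliceIdeal Q ℓ hGf)
      rw [← hGf'] at hb ⊢
      refine mem_of_forall_zeros_formsIn (P := I (OrderDual.ofDual p')) hclosed hℓ (hI _) hG
        fun x hx => ?_
      have hxQ := zeros_formsIn_subset hclosed (hI _) hx
      exact hle (show (⟨x, hxQ⟩ : Q) ∈ F p' from hx) G ⟨⟨_, hG⟩, hb⟩
  rw [ringKrullDim, ← Order.krullDim_orderDual, topologicalKrullDim]
  exact Order.krullDim_le_of_strictMono F hF

/-- A closed irreducible set of codimension at least two lies on a cone over a hypersurface with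
any prescribed vertex. -/
theorem exists_pullback_mem_homIdeal {k : ℕ} {Q : Set (PSpace (k + 1))} (hclosed : IsClosed Q)
    (hirr : IsIrreducible Q) (hcodim : topologicalKrullDim Q + 2 ≤ (k : WithBot ℕ∞))
    (μ : (Fin (k + 1) → ℂ) →ₗ[ℂ] (Fin k → ℂ)) :
    ∃ (G : Coord k) (d : ℕ), G.IsHomogeneous d ∧ G ≠ 0 ∧ pullback μ G ∈ homIdeal Q := by
  obtain ⟨q, hq⟩ := hirr.1
  obtain ⟨i, hi⟩ := Function.ne_iff.mp q.rep_nonzero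
  have hℓ : (MvPolynomial.X i : Coord (k + 1)).IsHomogeneous 1 := MvPolynomial.isHomogeneous_X _ _
  have hℓQ : (MvPolynomial.X i : Coord (k + 1)) ∉ homIdeal Q := fun h => by
    have := mem_homIdeal.mp h q.rep q.rep_nonzero (by rwa [q.mk_rep])
    rw [MvPolynomial.eval_X] at this
    exact hi this
  have hprime := isPrime_sliceIdeal hirr hℓ hℓQ
  have : IsDomain (Coord (k + 1) ⧸ sliceIdeal Q (MvPolynomial.X i)) :=
    (Ideal.Quotient.isDomain_iff_prime _).mpr hprime
  obtain ⟨s, g, hg, hfin⟩ := exists_finite_inj_algHom_of_fg ℂ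
    (Coord (k + 1) ⧸ sliceIdeal Q (MvPolynomial.X i))
  have htr := trdeg_eq_of_finite g hg hfin
  have hs := (le_ringKrullDim_of_isIntegral g hg hfin.to_isIntegral).trans
    (ringKrullDim_chart_le hclosed hℓ)
  -- Here `s` is the transcendence degree of the chart, at most the dimension of `Q`. With
  -- codimension at least 2 the `k` coordinates of `μ` exceed `s + 1` and must satisfy a homogeneous
  -- relation.
  have hsk : s + 1 < k := by
    have h1 : (s : WithBot ℕ∞) + 2 ≤ k := le_trans (by gcongr) hcodim
    have h2 : s + 2 ≤ k := by exact_mod_cast h1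
    omega
  obtain ⟨G, d, hG, hG0, hGz⟩ := exists_isHomogeneous_aeval_eq_zero htr hsk
    (fun j => Ideal.Quotient.mkₐ ℂ (sliceIdeal Q (MvPolynomial.X i))
      (linForm (LinearMap.proj j ∘ₗ μ)))
  refine ⟨G, d, hG, hG0, ?_⟩
  rw [aeval_comp_eq] at hGz
  have hmem : pullback μ G ∈ sliceIdeal Q (MvPolynomial.X i) :=
    Ideal.Quotient.eq_zero_iff_mem.mp hGz
  exact ((isPrime_homIdeal hirr).mem_or_mem (mul_mem_homIdeal_of_mem_sliceIdeal hℓ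
    (isHomogeneous_pullback μ hG) hmem)).resolve_left hℓQ

end ProjMult

/-! ### Unramified single-point fibres and birationality of the general projection. -/

section Core

variable {k A B : Type u} [Field k] [CommRing A] [CommRing B] [Algebra k A]
  [Algebra k B] [Algebra A B] [IsScalarTower k A B]

/-- A finite extension with a single, unramified rational point over `εA` is locally at `εA`
generated by `1`. -/
theorem exists_smul_mem_range_of_le_sup_sq [IsAlgClosed k] [Module.Finite A B] [IsNoetherianRing B]
    (εA : A →ₐ[k] k) (εB : B →ₐ[k] k)
    (h : ∀ ε' : B →ₐ[k] k, (∀ a, ε' (algebraMap A B a) = εA a) → ε' = εB)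
    (hM : RingHom.ker εB ≤ (RingHom.ker εA).map (algebraMap A B) ⊔ RingHom.ker εB ^ 2) :
    ∃ s : A, εA s = 1 ∧ ∀ b : B, ∃ a : A, algebraMap A B a = s • b := by
  set M := RingHom.ker εB with hMdef
  set I := (RingHom.ker εA).map (algebraMap A B) with hIdef
  -- Iterating the unramifiedness, and using that a power of `M` lies in `I` because there is only
  -- one point in the fibre, yields `M ≤ I`.
  have hpow (r : ℕ) : M ≤ I ⊔ M ^ (r + 1) := by
    induction r with
    | zero => rw [zero_add, pow_one]; exact le_sup_right
    | succ r ih =>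
      refine ih.trans (sup_le le_sup_left ?_)
      rw [pow_succ]
      refine (Ideal.mul_mono_right hM).trans ?_
      rw [Ideal.mul_sup, ← pow_add]
      exact sup_le_sup Ideal.mul_le_right le_rfl
  obtain ⟨r, hr⟩ := Ideal.exists_pow_le_of_le_radical_of_fg (I := M) (J := I)
    (fun y hy => exists_pow_mem_map εA εB h y hy) (IsNoetherian.noetherian M)
  have hMI : M ≤ I := (hpow r).trans
    (sup_le le_rfl ((Ideal.pow_le_pow_right (Nat.le_succ r)).trans hr))
  -- Nakayama: modulo the ideal of `εA` the module `B` is generated by 1, since every element is a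
  -- constant plus an element of `M ≤ I`.
  obtain ⟨s, hs1, hs⟩ := Submodule.exists_sub_one_mem_and_smul_le_of_fg_of_le_sup
    (I := RingHom.ker εA) (N := LinearMap.range (Algebra.linearMap A B)) (N' := ⊤) (P := ⊤)
    Module.Finite.fg_top le_rfl (by
      rintro b -
      rw [Ideal.smul_top_eq_map]
      have hb : b - algebraMap k B (εB b) ∈ M := by
        rw [hMdef, RingHom.mem_ker, map_sub, AlgHom.commutes]
        exact sub_self _
      rw [← add_sub_cancel (algebraMap k B (εB b)) b]
      refine Submodule.add_mem_sup ⟨algebraMap k A (εB b), ?_⟩ (hMI hb)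
      rw [Algebra.linearMap_apply, ← IsScalarTower.algebraMap_apply])
  refine ⟨s, ?_, fun b => ?_⟩
  · rw [RingHom.mem_ker, map_sub, map_one, sub_eq_zero] at hs1
    exact hs1
  · obtain ⟨a, ha⟩ := hs (Submodule.smul_mem_pointwise_smul b s ⊤ trivial)
    exact ⟨a, ha⟩

end Core

namespace ProjMult

attribute [local instance] MvPolynomial.gradedAlgebra

variable {n : ℕ}

theorem homogeneousComponent_zero_shift (v : Fin n → ℂ) (f : Coord n) :
    MvPolynomial.homogeneousComponent 0 (shift v f) = MvPolynomial.C (MvPolynomial.eval v f) := by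
  rw [MvPolynomial.homogeneousComponent_zero, ← MvPolynomial.constantCoeff_eq,
    ← MvPolynomial.eval_zero, eval_shift, zero_add]

/-- The linear part of `w ↦ f (v + w)` is the differential of `f` at `v`. -/
theorem eval_homogeneousComponent_one_shift (v a : Fin n → ℂ) (f : Coord n) :
    MvPolynomial.eval a (MvPolynomial.homogeneousComponent 1 (shift v f)) =
      ∑ i, a i * MvPolynomial.eval v (MvPolynomial.pderiv i f) := by
  induction f using MvPolynomial.induction_on with
  | C c =>
    rw [shift, MvPolynomial.aeval_C]
    simp [MvPolynomial.algebraMap_eq, MvPolynomial.homogeneousComponent_eq_zero]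
  | add f g hf hg =>
    have : shift v (f + g) = shift v f + shift v g := map_add _ _ _
    rw [this, map_add, map_add, hf, hg, ← Finset.sum_add_distrib]
    refine Finset.sum_congr rfl fun i _ => ?_
    rw [map_add, map_add, mul_add]
  | mul_X f j hf =>
    have : shift v (f * MvPolynomial.X j) =
        shift v f * MvPolynomial.X j + MvPolynomial.C (v j) * shift v f := by
      rw [shift, map_mul, MvPolynomial.aeval_X, mul_add, mul_comm (MvPolynomial.C (v j))]
      rfl
    have h1 := MvPolynomial.homogeneousComponent_mul_of_isHomogeneous (shift v f)
      (MvPolynomial.isHomogeneous_X ℂ j) 0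
    rw [zero_add] at h1
    rw [this, map_add, map_add, h1, homogeneousComponent_zero_shift,
      MvPolynomial.homogeneousComponent_C_mul, map_mul, map_mul, MvPolynomial.eval_C,
      MvPolynomial.eval_C, MvPolynomial.eval_X, hf, Finset.mul_sum]
    simp only [MvPolynomial.pderiv_mul, map_add, map_mul, MvPolynomial.eval_X,
      MvPolynomial.pderiv_X, mul_add, Finset.sum_add_distrib]
    rw [add_comm]
    congr 1
    · exact Finset.sum_congr rfl fun i _ => by ring
    · rw [Finset.sum_eq_single j]
      · simp [mul_comm]
      · intro i _ hij
        simp [Pi.single_eq_of_ne hij.symm]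
      · simp

/-- A nonempty proper algebraic set has a form in its ideal with a partial derivative outside
of the ideal. -/
theorem exists_pderiv_notMem_homIdeal {Q : Set (PSpace n)} (hne : Q.Nonempty)
    (h : ∃ (d : ℕ) (f : Coord n), f.IsHomogeneous d ∧ f ≠ 0 ∧ f ∈ homIdeal Q) :
    ∃ (d : ℕ) (f : Coord n) (i : Fin n), f.IsHomogeneous d ∧ f ∈ homIdeal Q ∧
      MvPolynomial.pderiv i f ∉ homIdeal Q := by
  classical
  obtain ⟨f, hf, hf0, hfQ⟩ := Nat.find_spec h
  set d := Nat.find h with hd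
  by_contra! hcon
  -- A nonzero partial derivative in the ideal would contradict the minimality of the degree. If all
  -- vanish, Euler's identity makes `f` constant, and a constant vanishing at a point is zero.
  have hz (i : Fin n) : MvPolynomial.pderiv i f = 0 := by
    by_contra hi
    rcases Nat.eq_zero_or_pos d with h0 | h0
    · rw [h0, ← MvPolynomial.totalDegree_zero_iff_isHomogeneous,
        MvPolynomial.totalDegree_eq_zero_iff_eq_C] at hf
      rw [hf, MvPolynomial.pderiv_C] at hi
      exact hi rfl
    · exact Nat.find_min h (m := d - 1) (by omega) ⟨_, hf.pderiv, hi, hcon d f i hf hfQ⟩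
  have he := hf.sum_X_mul_pderiv
  simp only [hz, mul_zero, Finset.sum_const_zero] at he
  have h0 : d = 0 := (smul_eq_zero.mp he.symm).resolve_right hf0
  rw [h0, ← MvPolynomial.totalDegree_zero_iff_isHomogeneous,
    MvPolynomial.totalDegree_eq_zero_iff_eq_C] at hf
  obtain ⟨q, hq⟩ := hne
  have := mem_homIdeal.mp hfQ q.rep q.rep_nonzero (by rwa [q.mk_rep])
  rw [hf, MvPolynomial.eval_C] at this
  rw [this, MvPolynomial.C_0] at hf
  exact hf0 hf

theorem exists_linearMap_ker_eq_span {k : ℕ} {v : Fin (k + 1) → ℂ} (hv : v ≠ 0) :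
    ∃ μ : (Fin (k + 1) → ℂ) →ₗ[ℂ] (Fin k → ℂ), Function.Surjective μ ∧ μ v = 0 := by
  have h1 := Submodule.finrank_quotient_add_finrank (ℂ ∙ v)
  rw [finrank_span_singleton hv, Module.finrank_fin_fun] at h1
  obtain ⟨e⟩ := FiniteDimensional.nonempty_linearEquiv_of_finrank_eq
    (R := ℂ) (M := (Fin (k + 1) → ℂ) ⧸ ℂ ∙ v) (M' := Fin k → ℂ)
    (by rw [Module.finrank_fin_fun]; omega)
  refine ⟨e.toLinearMap ∘ₗ (ℂ ∙ v).mkQ, e.surjective.comp (Submodule.mkQ_surjective _), ?_⟩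
  rw [LinearMap.comp_apply, Submodule.mkQ_apply,
    (Submodule.Quotient.mk_eq_zero _).mpr (Submodule.mem_span_singleton_self v), map_zero]

theorem pullback_ne_zero {m : ℕ} {μ : (Fin m → ℂ) →ₗ[ℂ] (Fin n → ℂ)}
    (hμ : Function.Surjective μ) {G : Coord n} (hG : G ≠ 0) : pullback μ G ≠ 0 := by
  refine fun h => hG (coord_ext fun w => ?_)
  obtain ⟨v, rfl⟩ := hμ w
  rw [← eval_pullback, h, map_zero, map_zero]

section Chart

variable {k : ℕ} {φ : (Fin (k + 1) → ℂ) →ₗ[ℂ] (Fin k → ℂ)} {a q : PSpace (k + 1)}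
  {Q : Set (PSpace (k + 1))} {τ : (Fin k → ℂ) →ₗ[ℂ] ℂ} {T : (Fin (k + 1) → ℂ) →ₗ[ℂ] ℂ}
  {σ : (Fin k → ℂ) →ₗ[ℂ] (Fin (k + 1) → ℂ)}

/-- A projection with a regular inverse near a point of the image is birational. -/
theorem isBirationalOntoImage_of_eval_eq {hφ : LinearMap.ker φ = a.submodule} {ha : a ∉ Q}
    (hq : q ∈ Q) (hτq : τ (φ q.rep) = 1) {S : Coord k} (hS : MvPolynomial.eval (φ q.rep) S = 1)
    {g : Fin (k + 1) → Coord k}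
    (hg : ∀ v ∈ slice Q (pullback φ (linForm τ)), ∀ i,
      MvPolynomial.eval (φ v) (g i) = MvPolynomial.eval (φ v) S * v i) :
    IsBirationalOntoImage (projFrom a φ hφ Q ha) := by
  choose F hF hFg using fun i =>
    MvPolynomial.exists_isHomogeneous_sub_mem (isHomogeneous_linForm τ) (g i)
  obtain ⟨D, hD⟩ : ∃ D, ∀ i, (g i).totalDegree ≤ D :=
    ⟨Finset.univ.sup fun i => (g i).totalDegree,
      fun i => Finset.le_sup (f := fun i => (g i).totalDegree) (Finset.mem_univ i)⟩
  -- The powers of `τ` equalize the degrees. The one extra factor makes all components vanish where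
  -- `τ = 0`, so the rational inverse has to be checked only in the chart.
  let G : Fin (k + 1) → Coord k := fun i => F i * linForm τ ^ (D - (g i).totalDegree + 1)
  have hG (i : Fin (k + 1)) : (G i).IsHomogeneous (D + 1) := by
    have := (hF i).mul ((isHomogeneous_linForm τ).pow (D - (g i).totalDegree + 1))
    have hi := hD i
    rwa [one_mul, show (g i).totalDegree + (D - (g i).totalDegree + 1) = D + 1 by omega] at this
  have hG0 {w : Fin k → ℂ} (hw : τ w = 0) (i : Fin (k + 1)) : MvPolynomial.eval w (G i) = 0 := by
    simp only [G]
    rw [map_mul, map_pow, eval_linForm, hw, zero_pow (Nat.succ_ne_zero _), mul_zero]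
  have hG1 {w : Fin k → ℂ} (hw : τ w = 1) (i : Fin (k + 1)) :
      MvPolynomial.eval w (G i) = MvPolynomial.eval w (g i) := by
    simp only [G]
    rw [map_mul, map_pow, eval_linForm, hw, one_pow, mul_one]
    obtain ⟨c, hc⟩ := Ideal.mem_span_singleton'.mp (hFg i)
    have := congrArg (MvPolynomial.eval w) hc
    rw [map_mul, map_sub, eval_linForm, hw, map_one, sub_self, mul_zero, map_sub] at this
    exact (sub_eq_zero.mp this.symm)
  have hev (x : Q) (hx : τ (φ x.1.rep) ≠ 0) : ∃ c : ℂ, c ≠ 0 ∧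
      (fun i => MvPolynomial.eval (projFrom a φ hφ Q ha x).rep (G i)) =
        (c * MvPolynomial.eval (φ ((τ (φ x.1.rep))⁻¹ • x.1.rep)) S) • x.1.rep := by
    obtain ⟨c, hc⟩ := Projectivization.exists_smul_eq_mk_rep ℂ (φ x.1.rep)
      (map_rep_ne_zero hφ (fun h => ha (h ▸ x.2)))
    have hne : (τ (φ x.1.rep))⁻¹ • x.1.rep ≠ 0 := smul_ne_zero (inv_ne_zero hx) x.1.rep_nonzero
    have h1 : τ (φ ((τ (φ x.1.rep))⁻¹ • x.1.rep)) = 1 := by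
      rw [map_smul, map_smul, smul_eq_mul, inv_mul_cancel₀ hx]
    have hrep : (projFrom a φ hφ Q ha x).rep =
        ((c : ℂ) * τ (φ x.1.rep)) • φ ((τ (φ x.1.rep))⁻¹ • x.1.rep) := by
      rw [projFrom, ← hc, map_smul, smul_smul, mul_assoc, mul_inv_cancel₀ hx, mul_one]
      rfl
    refine ⟨((c : ℂ) * τ (φ x.1.rep)) ^ (D + 1) * (τ (φ x.1.rep))⁻¹,
      mul_ne_zero (pow_ne_zero _ (mul_ne_zero c.ne_zero hx)) (inv_ne_zero hx), ?_⟩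
    funext i
    rw [hrep, (hG i).eval_smul, hG1 h1, hg _ (mem_slice_pullback_iff.mpr
      ⟨by rw [eval_linForm, h1], hne, by rw [mk_smul_eq x.1.rep_nonzero, x.1.mk_rep]; exact x.2⟩)]
    simp only [Pi.smul_apply, smul_eq_mul]
    ring
  refine ⟨D + 1, G, hG, ⟨⟨q, hq⟩, ?_⟩, fun x hx => ?_⟩
  · obtain ⟨c, hc, h⟩ := hev ⟨q, hq⟩ (by rw [hτq]; exact one_ne_zero)
    rw [h, hτq, inv_one, one_smul, hS, mul_one]
    exact smul_ne_zero hc q.rep_nonzero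
  · have hτx : τ (φ x.1.rep) ≠ 0 := by
      intro h0
      apply hx
      funext i
      obtain ⟨c, hc⟩ := Projectivization.exists_smul_eq_mk_rep ℂ (φ x.1.rep)
        (map_rep_ne_zero hφ (fun h => ha (h ▸ x.2)))
      refine hG0 ?_ i
      rw [projFrom, ← hc]
      change τ ((c : ℂ) • φ x.1.rep) = 0
      rw [map_smul, h0, smul_zero]
    obtain ⟨c, -, h⟩ := hev x hτx
    conv_rhs => rw [← x.1.mk_rep]
    rw [Projectivization.mk_eq_mk_iff']
    exact ⟨_, h.symm⟩

/-- Near a point of the image with a single preimage, at which the center is not tangent, the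
coordinates of the preimage are regular functions. -/
theorem exists_eval_eq_of_chart {A B : Type} [CommRing A] [CommRing B] [Algebra ℂ A] [Algebra ℂ B]
    {πA : Coord k →ₐ[ℂ] A} {πB : Coord (k + 1) →ₐ[ℂ] B}
    (hclosed : IsClosed Q) (hq : q ∈ Q) (ha : a ∉ Q) (hφ : LinearMap.ker φ = a.submodule)
    (hτq : τ (φ q.rep) = 1) (hTq : T q.rep = 0) (hσ : ∀ w, w = σ (φ w) + T w • a.rep)
    (hπA : Function.Surjective πA) (hπB : Function.Surjective πB)
    (hB : ∀ f, πB f = 0 ↔ f ∈ sliceIdeal Q (pullback φ (linForm τ)))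
    (hA : ∀ f, πA f = 0 ↔ pullback φ f ∈ sliceIdeal Q (pullback φ (linForm τ)))
    {εA : A →ₐ[ℂ] ℂ} {εB : B →ₐ[ℂ] ℂ} (hεA : ∀ f, εA (πA f) = MvPolynomial.eval (φ q.rep) f)
    (hεB : ∀ f, εB (πB f) = MvPolynomial.eval q.rep f)
    (hline : lineThrough a q ∩ Q = {q}) {f : Coord (k + 1)} (hf : f ∈ homIdeal Q)
    (hfa : MvPolynomial.eval a.rep (MvPolynomial.homogeneousComponent 1 (shift q.rep f)) ≠ 0) :
    ∃ (S : Coord k) (g : Fin (k + 1) → Coord k), MvPolynomial.eval (φ q.rep) S = 1 ∧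
      ∀ v ∈ slice Q (pullback φ (linForm τ)), ∀ i,
        MvPolynomial.eval (φ v) (g i) = MvPolynomial.eval (φ v) S * v i := by
  have hℓ := isHomogeneous_pullback φ (isHomogeneous_linForm τ)
  let F : A →ₐ[ℂ] B := AlgHom.liftOfSurjective πA hπA (πB.comp (pullback φ)) fun g hg =>
    (hB _).mpr ((hA g).mp hg)
  let : Algebra A B := F.toRingHom.toAlgebra
  have : IsScalarTower ℂ A B := IsScalarTower.of_algebraMap_eq fun c => (F.commutes c).symm
  have hAB (g : Coord k) : algebraMap A B (πA g) = πB (pullback φ g) :=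
    AlgHom.liftOfSurjective_apply _ _ _ _ _
  have := finite_chart hclosed ha hσ hπB hB hAB
  have : IsNoetherianRing B := isNoetherianRing_of_surjective _ _ πB.toRingHom hπB
  have hB' {f g : Coord (k + 1)} : πB f = πB g ↔ ∀ v ∈ slice Q (pullback φ (linForm τ)),
      MvPolynomial.eval v f = MvPolynomial.eval v g := by
    rw [← sub_eq_zero, ← map_sub, hB, mem_sliceIdeal]
    simp only [map_sub, sub_eq_zero]
  let p : Fin (k + 1) → Coord (k + 1) := fun i => MvPolynomial.X i - MvPolynomial.C (q.rep i)
  let z : Fin (k + 1) → B := fun i => πB (p i)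
  have hz_shift (f : Coord (k + 1)) : MvPolynomial.aeval z (shift q.rep f) = πB f := by
    simp only [z]
    rw [aeval_comp_eq]
    congr 1
    apply coord_ext
    intro v
    rw [eval_aeval, eval_shift]
    congr 1
    congr 1
    funext i
    simp [p]
  have hzsurj : Function.Surjective (MvPolynomial.aeval (R := ℂ) z) := by
    intro b
    obtain ⟨f, rfl⟩ := hπB b
    exact ⟨_, hz_shift f⟩
  have hzε (i : Fin (k + 1)) : εB (z i) = 0 := by
    simp only [z, p]
    rw [hεB, map_sub, MvPolynomial.eval_X, MvPolynomial.eval_C, sub_self]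
  have hzM := span_range_eq_ker z εB hzsurj hzε
  let u : Fin (k + 1) → A := fun i => πA (linForm (LinearMap.proj i ∘ₗ σ) -
    MvPolynomial.C (σ (φ q.rep) i))
  have huε (i : Fin (k + 1)) : u i ∈ RingHom.ker εA := by
    simp only [u]
    rw [RingHom.mem_ker, hεA, map_sub, eval_linForm, MvPolynomial.eval_C]
    exact sub_self _
  have hyM : πB (linForm T) ∈ RingHom.ker εB := by
    rw [RingHom.mem_ker, hεB, eval_linForm, hTq]
  have hzu (i : Fin (k + 1)) : z i = algebraMap A B (u i) + a.rep i • πB (linForm T) := by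
    simp only [z, u, p]
    rw [hAB, ← map_smul, ← map_add, hB']
    intro v _
    have h1 := congrFun (hσ v) i
    have h2 := congrFun (hσ q.rep) i
    rw [hTq, zero_smul, add_zero] at h2
    simp only [Pi.add_apply, Pi.smul_apply, smul_eq_mul] at h1
    simp only [map_sub, map_add, MvPolynomial.smul_eval, MvPolynomial.eval_X, MvPolynomial.eval_C,
      eval_pullback, eval_linForm]
    change v i - q.rep i = σ (φ v) i - σ (φ q.rep) i + a.rep i * T v
    rw [← h2]
    linear_combination h1
  -- For `m = 0` the conclusion is `y ∈ I + M ^ 2`: a form with nonzero differential along `a` makes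
  -- the fibre unramified at `q`.
  have hy := MvPolynomial.pow_mem_of_aeval_eq_zero (k := ℂ) (m := 0) hzu
    (fun i => Ideal.mem_map_of_mem _ (huε i)) hzε hyM (F := shift q.rep f) (fun j hj => by
      obtain rfl : j = 0 := by omega
      rw [homogeneousComponent_zero_shift,
        mem_homIdeal.mp hf q.rep q.rep_nonzero (by rwa [q.mk_rep]), MvPolynomial.C_0]) hfa (by
      rw [hz_shift, hB]
      exact homIdeal_le_sliceIdeal Q _ hf)
  rw [zero_add, pow_one, pow_zero, Ideal.one_eq_top, Ideal.mul_top] at hy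
  obtain ⟨s, hs, hrange⟩ := exists_smul_mem_range_of_le_sup_sq εA εB
    ((lineThrough_inter_eq_singleton_iff hclosed hq ha hφ hℓ
      (fun w => by rw [eval_pullback, eval_linForm]) hτq hπA hπB hB hAB hεA hεB).mp hline) (by
    rw [← hzM, Ideal.span_le]
    rintro _ ⟨i, rfl⟩
    rw [hzM, hzu]
    exact Submodule.add_mem _ (Ideal.mem_sup_left (Ideal.mem_map_of_mem _ (huε i)))
      (Submodule.smul_of_tower_mem _ _ hy))
  obtain ⟨S, rfl⟩ := hπA s
  choose g hg using fun i => hrange (πB (MvPolynomial.X i))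
  choose G hG using fun i => hπA (g i)
  refine ⟨S, G, by rw [← hεA, hs], fun v hv i => ?_⟩
  have h1 := hg i
  rw [← hG, hAB, Algebra.smul_def, hAB, ← map_mul, hB'] at h1
  have h2 := h1 v hv
  rwa [map_mul, eval_pullback, eval_pullback, MvPolynomial.eval_X] at h2

end Chart

/-- One good point `q` suffices: if `q` is the only point of `Q` on its line through `a` and the
differential of `f` at `q` is nonzero along `a`, the inverse is regular near the image of `q`. -/
theorem isBirationalOntoImage_projFrom {k : ℕ} {Q : Set (PSpace (k + 1))} (hclosed : IsClosed Q)
    {a q : PSpace (k + 1)} (hq : q ∈ Q) (ha : a ∉ Q)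
    {φ : (Fin (k + 1) → ℂ) →ₗ[ℂ] (Fin k → ℂ)} (hφ : LinearMap.ker φ = a.submodule)
    (hline : lineThrough a q ∩ Q = {q}) {f : Coord (k + 1)} (hf : f ∈ homIdeal Q)
    (hfa : MvPolynomial.eval a.rep (MvPolynomial.homogeneousComponent 1 (shift q.rep f)) ≠ 0) :
    IsBirationalOntoImage (projFrom a φ hφ Q ha) := by
  have hφ' (w : Fin (k + 1) → ℂ) : φ w = 0 ↔ ∃ c : ℂ, c • a.rep = w := by
    rw [← LinearMap.mem_ker, hφ, Projectivization.submodule_eq, Submodule.mem_span_singleton]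
  have hφq : φ q.rep ≠ 0 := map_rep_ne_zero hφ (fun h => ha (h ▸ hq))
  obtain ⟨τ, T, σ, hτq, -, hTq, hσ⟩ := exists_projection_coordinates a.rep_nonzero hφ' hφq
  have hqs : q.rep ∈ slice Q (pullback φ (linForm τ)) :=
    mem_slice_pullback_iff.mpr ⟨by rw [eval_linForm, hτq], q.rep_nonzero, by rwa [q.mk_rep]⟩
  have hA (f : Coord k) : f ∈ sliceIdeal (Set.range (projFrom a φ hφ Q ha)) (linForm τ) ↔
      pullback φ f ∈ sliceIdeal Q (pullback φ (linForm τ)) := by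
    rw [sliceIdeal_range_projFrom, Ideal.mem_comap]
  let εA : (Coord k ⧸ sliceIdeal (Set.range (projFrom a φ hφ Q ha)) (linForm τ)) →ₐ[ℂ] ℂ :=
    Ideal.Quotient.liftₐ _ (MvPolynomial.aeval (φ q.rep)) fun f hf => by
      have := mem_sliceIdeal.mp ((hA f).mp hf) _ hqs
      rwa [eval_pullback] at this
  let εB : (Coord (k + 1) ⧸ sliceIdeal Q (pullback φ (linForm τ))) →ₐ[ℂ] ℂ :=
    Ideal.Quotient.liftₐ _ (MvPolynomial.aeval q.rep) fun f hf => mem_sliceIdeal.mp hf _ hqs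
  obtain ⟨S, g, hS, hg⟩ := exists_eval_eq_of_chart (πA := Ideal.Quotient.mkₐ ℂ _)
    (πB := Ideal.Quotient.mkₐ ℂ _) (εA := εA) (εB := εB) hclosed hq ha hφ hτq hTq hσ
    (Ideal.Quotient.mkₐ_surjective ℂ _) (Ideal.Quotient.mkₐ_surjective ℂ _)
    (fun f => Ideal.Quotient.eq_zero_iff_mem)
    (fun f => Ideal.Quotient.eq_zero_iff_mem.trans (hA f)) (fun _ => rfl) (fun _ => rfl)
    hline hf hfa
  exact isBirationalOntoImage_of_eval_eq hq hτq hS hg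

/-- If a cone with vertex `q` contains `Q` but not `a`, then the line joining `a` and `q` meets
`Q` only in `q`. -/
theorem lineThrough_inter_eq_singleton_of_pullback {m : ℕ} {Q : Set (PSpace n)} {a q : PSpace n}
    (hq : q ∈ Q) {μ : (Fin n → ℂ) →ₗ[ℂ] (Fin m → ℂ)} (hμ : μ q.rep = 0) {G : Coord m} {d : ℕ}
    (hG : G.IsHomogeneous d) (hGQ : pullback μ G ∈ homIdeal Q)
    (ha : MvPolynomial.eval a.rep (pullback μ G) ≠ 0) : lineThrough a q ∩ Q = {q} := by
  apply le_antisymm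
  · rintro x ⟨hx, hxQ⟩
    rw [← x.mk_rep] at hx hxQ
    obtain ⟨s, t, hst⟩ := (mk_mem_lineThrough_iff x.rep_nonzero).mp hx
    have h1 := mem_homIdeal.mp hGQ _ x.rep_nonzero hxQ
    rw [eval_pullback, ← hst, map_add, map_smul, map_smul, hμ, smul_zero, add_zero,
      hG.eval_smul, ← eval_pullback] at h1
    have hs : s = 0 := eq_zero_of_pow_eq_zero ((mul_eq_zero.mp h1).resolve_right ha)
    rw [hs, zero_smul, zero_add] at hst
    rw [Set.mem_singleton_iff, ← x.mk_rep]
    conv_rhs => rw [← q.mk_rep]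
    rw [Projectivization.mk_eq_mk_iff']
    exact ⟨t, hst⟩
  · rintro x hx
    rw [Set.mem_singleton_iff.mp hx]
    exact ⟨le_sup_right (a := a.submodule) (b := q.submodule), hq⟩

/-- The projection from a general point is birational onto its image. -/
theorem exists_isOpen_isBirationalOntoImage {k : ℕ} {Q : Set (PSpace (k + 1))}
    (hclosed : IsClosed Q) (hirr : IsIrreducible Q)
    (hcodim : topologicalKrullDim Q + 2 ≤ (k : WithBot ℕ∞)) :
    ∃ U : Set (PSpace (k + 1)), IsOpen U ∧ U.Nonempty ∧ ∀ a ∈ U, ∃ ha : a ∉ Q,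
      ∀ (φ : (Fin (k + 1) → ℂ) →ₗ[ℂ] (Fin k → ℂ)) (hφ : LinearMap.ker φ = a.submodule),
        IsBirationalOntoImage (projFrom a φ hφ Q ha) := by
  have hcone (v : Fin (k + 1) → ℂ) (hv : v ≠ 0) : ∃ (μ : (Fin (k + 1) → ℂ) →ₗ[ℂ] (Fin k → ℂ))
      (G : Coord k) (d : ℕ), μ v = 0 ∧ G.IsHomogeneous d ∧ pullback μ G ≠ 0 ∧
        pullback μ G ∈ homIdeal Q := by
    obtain ⟨μ, hμ, hμv⟩ := exists_linearMap_ker_eq_span hv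
    obtain ⟨G, d, hG, hG0, hGQ⟩ := exists_pullback_mem_homIdeal hclosed hirr hcodim μ
    exact ⟨μ, G, d, hμv, hG, pullback_ne_zero hμ hG0, hGQ⟩
  obtain ⟨x, hx⟩ := hirr.1
  -- The cones show that the ideal of `Q` is nonzero; a form in it with a derivative outside the
  -- ideal has nonzero differential at some point `q` of `Q`.
  obtain ⟨d, f, i, hf, hfQ, hi⟩ := exists_pderiv_notMem_homIdeal ⟨x, hx⟩ (by
    obtain ⟨μ, G, d, -, hG, hG0, hGQ⟩ := hcone x.rep x.rep_nonzero
    exact ⟨d, _, isHomogeneous_pullback μ hG, hG0, hGQ⟩)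
  rw [isHomogeneous_mem_homIdeal_iff hf.pderiv] at hi
  push Not at hi
  obtain ⟨q, hq, hqi⟩ := hi
  obtain ⟨μ, G, e, hμq, hG, hG0, hGQ⟩ := hcone q.rep q.rep_nonzero
  let δ := MvPolynomial.homogeneousComponent 1 (shift q.rep f)
  have hδ : δ.IsHomogeneous 1 := MvPolynomial.homogeneousComponent_isHomogeneous _ _
  have hδ0 : δ ≠ 0 := by
    intro h
    apply hqi
    have h1 := eval_homogeneousComponent_one_shift q.rep (Pi.single i 1) f
    rw [show MvPolynomial.homogeneousComponent 1 (shift q.rep f) = 0 from h, map_zero,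
      Finset.sum_eq_single i (fun j _ hj => by rw [Pi.single_eq_of_ne hj, zero_mul]) (by simp),
      Pi.single_eq_same, one_mul] at h1
    exact h1.symm
  have hprod := (isHomogeneous_pullback μ hG).mul hδ
  -- Avoiding the cone `pullback μ G` with vertex `q` keeps `a` off `Q` and makes the line through
  -- `q` meet `Q` only there; avoiding `δ = 0` makes the differential of `f` at `q` nonzero along
  -- `a`.
  refine ⟨(zeros {pullback μ G * δ})ᶜ, (isClosed_zeros ?_).isOpen_compl, ?_, fun a haU => ?_⟩
  · rintro _ rfl
    exact ⟨_, hprod⟩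
  · by_contra hempty
    rw [Set.not_nonempty_iff_eq_empty, Set.compl_empty_iff] at hempty
    apply mul_ne_zero hG0 hδ0
    apply coord_ext
    intro v
    rw [map_zero]
    by_cases hv : v = 0
    · rw [map_mul, hv]
      have := hδ.eval_smul 0 (0 : Fin (k + 1) → ℂ)
      rw [zero_smul, pow_one, zero_mul] at this
      rw [this, mul_zero]
    · have : Projectivization.mk ℂ v hv ∈ zeros {pullback μ G * δ} := hempty ▸ Set.mem_univ _
      exact (eval_rep_eq_zero_iff hprod hv).mp (this _ rfl)
  · have hne : MvPolynomial.eval a.rep (pullback μ G * δ) ≠ 0 := fun h =>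
      haU (by rintro _ rfl; exact h)
    rw [map_mul] at hne
    have ha : a ∉ Q := fun haQ => left_ne_zero_of_mul hne
      (mem_homIdeal.mp hGQ a.rep a.rep_nonzero (by rwa [a.mk_rep]))
    exact ⟨ha, fun φ hφ => isBirationalOntoImage_projFrom hclosed hq ha hφ
      (lineThrough_inter_eq_singleton_of_pullback hq hμq hG hGQ (left_ne_zero_of_mul hne)) hfQ
      (right_ne_zero_of_mul hne)⟩

end ProjMult

theorem proposition6 (k : ℕ) (Q : Set (ProjMult.PSpace (k + 1)))
    (hclosed : IsClosed Q) (hirr : IsIrreducible Q)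
    (hcodim : topologicalKrullDim Q + 2 ≤ (k : WithBot ℕ∞)) :
    -- the projection from a general point is birational onto its image
    (∃ U : Set (ProjMult.PSpace (k + 1)), IsOpen U ∧ U.Nonempty ∧ ∀ a ∈ U, ∃ ha : a ∉ Q,
      ∀ (φ : (Fin (k + 1) → ℂ) →ₗ[ℂ] (Fin k → ℂ)) (hφ : LinearMap.ker φ = a.submodule),
        ProjMult.IsBirationalOntoImage (ProjMult.projFrom a φ hφ Q ha)) ∧
    -- for every birational projection and every point `q` of `Q`, the criterion holds
    (∀ (a : ProjMult.PSpace (k + 1)) (ha : a ∉ Q)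
      (φ : (Fin (k + 1) → ℂ) →ₗ[ℂ] (Fin k → ℂ)) (hφ : LinearMap.ker φ = a.submodule),
      ProjMult.IsBirationalOntoImage (ProjMult.projFrom a φ hφ Q ha) →
      ∀ q : Q,
        ProjMult.mult (Set.range (ProjMult.projFrom a φ hφ Q ha))
            (ProjMult.projFrom a φ hφ Q ha q) = ProjMult.mult Q q.1 ↔
          ProjMult.lineThrough a q.1 ∩ Q = {q.1} ∧
          ¬ ProjMult.lineThrough a q.1 ⊆ ProjMult.tangentCone Q q.1) :=
  ⟨ProjMult.exists_isOpen_isBirationalOntoImage hclosed hirr hcodim,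
    fun _ ha _ hφ hbir q => ProjMult.mult_projFrom_eq_iff hclosed hirr ha hφ hbir q⟩
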